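/- Let $\mathbb F$ be a field of characteristic $0$. Let $X$ be a connected finite simplicial complex, whose simplices are nonempty and determined by their vertex sets; its geometric realization is also denoted $X$. Let $\delta:\mathbb Z_{\ge 0}\to\mathbb Z$ be a perversity: $\delta(0)=0$ and for every $k\ge 0$ the function $\delta$ maps $\{0,\dots,k\}$ bijectively onto $\{a,a+1,\dots,a+k\}$ for some integer $a\le 0$. For a simplex $\Delta$ put $\delta(\Delta)=\delta(\dim\Delta)$, and write $\Delta\leftrightarrow\Delta'$ (incident) if one of $\Delta,\Delta'$ is a face of the other. *Constructible sheaves.* The open simplices of the first barycentric subdivision $\hat X$ are the open simplices $\hat\Delta$ spanned by the barycenters of nonempty sets of pairwise incident simplices of $X$. The $(-\delta)$-perverse simplex ${}^{-\delta}\!\Delta\subseteq X$ of a simplex $\Delta$ is the union of those $\hat\Delta$ which have the barycenter of $\Delta$ as a vertex and such that $-\delta(\Delta')\le-\delta(\Delta)$ for every simplex $\Delta'$ of $X$ whose barycenter is a vertex of $\hat\Delta$. Let $\mathfrak{Sh}_c(X,\delta)$ be the full subcategory of sheaves $\mathbf A$ of $\mathbb F$-vector spaces on $X$ such that, for every simplex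 $\Delta$, the inverse image of $\mathbf A$ on ${}^{-\delta}\!\Delta$ is isomorphic to the constant sheaf of a finite-dimensional vector space. *Modules and linear algebra data.* Let $Q$ be the quiver whose vertices are the simplices of $X$, with exactly one arrow $\Delta\to\Delta'$ if $\delta(\Delta)=\delta(\Delta')+1$ and $\Delta\leftrightarrow\Delta'$, and no other arrows. Let $B(X,\delta)$ be the quotient of the path algebra $\mathbb FQ$ (products written like compositions, from right to left) by the relations $b(\Delta_1,\Delta'')\,b(\Delta',\Delta_1)=b(\Delta_2,\Delta'')\,b(\Delta',\Delta_2)$ for all arrows $\Delta'\to\Delta_1\to\Delta''$ and $\Delta'\to\Delta_2\to\Delta''$, where $b(\Delta,\Delta')$ is the class of the arrow $\Delta\to\Delta'$; let $e_\Delta$ be the class of the trivial path at $\Delta$. Let $\mathcal R(X,\delta)$ be the category of finite-dimensional left $B(X,\delta)$-modules. By linear algebra data we mean a vector space $S(\Delta)$ for every simplex $\Delta$ and a linear map $s(\Delta,\Delta'):S(\Delta)\to S(\Delta')$ for every arrow $\Delta\to\Delta'$, such that $s(\Delta_1,\Delta'')\circ s(\Delta',\Delta_1)=s(\Delta_2,\Delta'')\circ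 s(\Delta',\Delta_2)$ for all arrows as above (the equivalence axiom); morphisms are families of linear maps commuting with the maps $s$. Then: 1. The categories $\mathcal R(X,\delta)$ and $\mathfrak{Sh}_c(X,\delta)$ are canonically equivalent. Precisely, let $U_\Delta$ be the open set that is the union of the ${}^{-\delta}\!\Delta'$ over all $\Delta'$ which can be reached from $\Delta$ by a (possibly trivial) path in $Q$. There is an equivalence $E:\mathcal R(X,\delta)\to\mathfrak{Sh}_c(X,\delta)$ such that, naturally in $M$, the linear algebra data $\Delta\mapsto\Gamma(U_\Delta,E(M))$ with the restriction maps of the sheaf $E(M)$ are isomorphic to the linear algebra data $\Delta\mapsto e_\Delta M$ with the multiplications by $b(\Delta,\Delta')$. 2. The functor $M\mapsto\bigl((e_\Delta M)_\Delta,\ \text{multiplication by } b(\Delta,\Delta')\bigr)$ is an equivalence from $\mathcal R(X,\delta)$ to the category of linear algebra data with all $S(\Delta)$ finite-dimensional. -/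

import Mathlib

universe u

open CategoryTheory TopologicalSpace Opposite

/-! ### Perversities -/

/-- A perversity: `δ 0 = 0`, and `δ` maps every interval `{0, …, k}` bijectively onto an interval
`{a, …, a + k}` of integers with `a ≤ 0`. -/
def IsPerversity (δ : ℕ → ℤ) : Prop :=
  δ 0 = 0 ∧ ∀ k : ℕ, ∃ a : ℤ, a ≤ 0 ∧ Set.BijOn δ (Set.Icc 0 k) (Set.Icc a (a + k))

namespace AbstractSimplicialComplex

noncomputable section

/-! ### Simplices, realization, barycentric subdivision, perverse simplices -/

section Geometry

variable {V : Type u} [Fintype V] (K : AbstractSimplicialComplex V)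

/-- The (nonempty) simplices of `K`. -/
abbrev Simplex : Type u := {s : Finset V // s ∈ K.faces}

instance : Fintype K.Simplex := Fintype.ofFinite _

/-- The geometric realization in barycentric coordinates, with the topology induced from `ℝ^V`. -/
def realization : Set (V → ℝ) :=
  {x | (∀ v, 0 ≤ x v) ∧ ∑ v, x v = 1 ∧ ∃ s ∈ K.faces, (s : Set V) = Function.support x}

/-- The realization of `K` as a topological space. -/
abbrev space : TopCat.{u} := TopCat.of K.realization

variable {K}

/-- The dimension of a simplex. -/
def Simplex.dim (Δ : K.Simplex) : ℕ := Δ.1.card - 1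

/-- The barycenter of a simplex. -/
def Simplex.barycenter (Δ : K.Simplex) : V → ℝ :=
  Set.indicator (Δ.1 : Set V) fun _ ↦ (Δ.1.card : ℝ)⁻¹

/-- Two simplices are incident if one is a face of the other. -/
def Simplex.Incident (Δ Δ' : K.Simplex) : Prop := Δ.1 ⊆ Δ'.1 ∨ Δ'.1 ⊆ Δ.1

variable (K)

/-- The simplices of the first barycentric subdivision: nonempty sets of (barycenters of)
pairwise incident simplices of `K`. -/
def IsFlag (c : Finset K.Simplex) : Prop :=
  c.Nonempty ∧ ∀ Δ ∈ c, ∀ Δ' ∈ c, Δ.Incident Δ'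

/-- The open simplex spanned by the barycenters of the members of `c`. -/
def openSubdivisionSimplex (c : Finset K.Simplex) : Set K.space :=
  {x | ∃ w : K.Simplex → ℝ, (∀ Δ ∈ c, 0 < w Δ) ∧ ∑ Δ ∈ c, w Δ = 1 ∧
    x.1 = ∑ Δ ∈ c, w Δ • Δ.barycenter}

/-- The `ε`-perverse simplex of `Δ`: the union of all open simplices of the barycentric subdivision
among whose vertices the barycenter of `Δ` is the one with the largest value of `ε`. -/
def perverseSimplex (ε : ℕ → ℤ) (Δ : K.Simplex) : Set K.space :=
  ⋃ c ∈ {c : Finset K.Simplex | K.IsFlag c ∧ Δ ∈ c ∧ ∀ Δ' ∈ c, ε Δ'.dim ≤ ε Δ.dim},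
    K.openSubdivisionSimplex c

/-- The inclusion of a perverse simplex into the realization. -/
def perverseInclusion (ε : ℕ → ℤ) (Δ : K.Simplex) :
    TopCat.of (K.perverseSimplex ε Δ) ⟶ K.space :=
  TopCat.ofHom ⟨Subtype.val, continuous_subtype_val⟩

end Geometry

/-! ### Constructible sheaves -/

section Sheaves

variable (F : Type u) [Field F] {V : Type u} [Fintype V] (K : AbstractSimplicialComplex V)

/-- A sheaf of `F`-vector spaces is constructible with respect to the `ε`-perverse triangulation
if its inverse image on every `ε`-perverse simplex is isomorphic to the constant sheaf of a
finite-dimensional vector space. -/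
def IsPerverselyConstructible (ε : ℕ → ℤ) :
    ObjectProperty (TopCat.Sheaf (ModuleCat.{u} F) K.space) := fun A ↦
  ∀ Δ : K.Simplex, ∃ W : ModuleCat.{u} F, Module.Finite F W ∧
    Nonempty ((TopCat.Sheaf.pullback (ModuleCat.{u} F) (K.perverseInclusion ε Δ)).obj A ≅
      (constantSheaf (Opens.grothendieckTopology (TopCat.of (K.perverseSimplex ε Δ)))
        (ModuleCat.{u} F)).obj W)

/-- The category of `δ`-sheaves: sheaves on `|K|` that are constructible with respect to the
`(-δ)`-perverse triangulation. -/
abbrev DeltaSheaf (δ : ℕ → ℤ) : Type (u + 1) :=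
  (K.IsPerverselyConstructible F (fun k ↦ -δ k)).FullSubcategory

end Sheaves

/-! ### The quiver, its algebra, and the quotient by the equivalence relations -/

section Algebra

variable (F : Type u) [Field F] {V : Type u} [Fintype V] (K : AbstractSimplicialComplex V)
  (δ : ℕ → ℤ)

/-- There is an arrow `Δ ⟶ Δ'` iff `δ(Δ) = δ(Δ') + 1` and `Δ`, `Δ'` are incident. -/
def HasArrow (Δ Δ' : K.Simplex) : Prop := δ Δ.dim = δ Δ'.dim + 1 ∧ Δ.Incident Δ'

/-- The arrows of the quiver, as pairs (source, target). -/
abbrev Arrow : Type u := {p : K.Simplex × K.Simplex // K.HasArrow δ p.1 p.2}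

/-- The free algebra on the vertices and the arrows of the quiver. -/
abbrev FreeQuiverAlgebra : Type u := FreeAlgebra F (K.Simplex ⊕ K.Arrow δ)

/-- The relations of the path algebra: the trivial paths are orthogonal idempotents with sum `1`,
and they act as left (right) identities on arrows ending (starting) at the vertex.
Products are written from right to left, like composition of maps. -/
inductive PathRel : FreeQuiverAlgebra F K δ → FreeQuiverAlgebra F K δ → Prop
  | idem (Δ : K.Simplex) :
      PathRel (FreeAlgebra.ι F (Sum.inl Δ) * FreeAlgebra.ι F (Sum.inl Δ))
        (FreeAlgebra.ι F (Sum.inl Δ))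
  | orth (Δ Δ' : K.Simplex) (h : Δ ≠ Δ') :
      PathRel (FreeAlgebra.ι F (Sum.inl Δ) * FreeAlgebra.ι F (Sum.inl Δ')) 0
  | one : PathRel (∑ Δ : K.Simplex, FreeAlgebra.ι F (Sum.inl Δ)) 1
  | target (a : K.Arrow δ) :
      PathRel (FreeAlgebra.ι F (Sum.inl a.1.2) * FreeAlgebra.ι F (Sum.inr a))
        (FreeAlgebra.ι F (Sum.inr a))
  | source (a : K.Arrow δ) :
      PathRel (FreeAlgebra.ι F (Sum.inr a) * FreeAlgebra.ι F (Sum.inl a.1.1))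
        (FreeAlgebra.ι F (Sum.inr a))

/-- The quiver (path) algebra, presented by trivial paths and arrows. -/
abbrev QuiverAlgebra : Type u := RingQuot (PathRel F K δ)

/-- The arrow `Δ ⟶ Δ'` as an element of the quiver algebra. -/
def arrowElt {Δ Δ' : K.Simplex} (h : K.HasArrow δ Δ Δ') : QuiverAlgebra F K δ :=
  RingQuot.mkAlgHom F (PathRel F K δ) (FreeAlgebra.ι F (Sum.inr ⟨(Δ, Δ'), h⟩))

/-- The equivalence relations: any two paths of length two with the same source and the same target
are identified. -/
inductive EquivalenceRel : QuiverAlgebra F K δ → QuiverAlgebra F K δ → Prop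
  | mk {Δ' Δ₁ Δ₂ Δ'' : K.Simplex} (h₁ : K.HasArrow δ Δ' Δ₁) (h₁' : K.HasArrow δ Δ₁ Δ'')
      (h₂ : K.HasArrow δ Δ' Δ₂) (h₂' : K.HasArrow δ Δ₂ Δ'') :
      EquivalenceRel (arrowElt F K δ h₁' * arrowElt F K δ h₁)
        (arrowElt F K δ h₂' * arrowElt F K δ h₂)

/-- The algebra `B(K, δ)`. -/
abbrev AlgebraB : Type u := RingQuot (EquivalenceRel F K δ)

/-- The idempotent `e_Δ` of `B(K, δ)`. -/
def idemB (Δ : K.Simplex) : AlgebraB F K δ :=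
  RingQuot.mkAlgHom F (EquivalenceRel F K δ)
    (RingQuot.mkAlgHom F (PathRel F K δ) (FreeAlgebra.ι F (Sum.inl Δ)))

/-- The generator `b(Δ, Δ')` of `B(K, δ)`. -/
def genB {Δ Δ' : K.Simplex} (h : K.HasArrow δ Δ Δ') : AlgebraB F K δ :=
  RingQuot.mkAlgHom F (EquivalenceRel F K δ) (arrowElt F K δ h)

lemma idemB_mul_genB {Δ Δ' : K.Simplex} (h : K.HasArrow δ Δ Δ') :
    idemB F K δ Δ' * genB F K δ h = genB F K δ h := by
  unfold idemB genB arrowElt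
  rw [← map_mul, ← map_mul, RingQuot.mkAlgHom_rel F (PathRel.target ⟨(Δ, Δ'), h⟩)]

lemma genB_mul_genB {Δ' Δ₁ Δ₂ Δ'' : K.Simplex} (h₁ : K.HasArrow δ Δ' Δ₁)
    (h₁' : K.HasArrow δ Δ₁ Δ'') (h₂ : K.HasArrow δ Δ' Δ₂) (h₂' : K.HasArrow δ Δ₂ Δ'') :
    genB F K δ h₁' * genB F K δ h₁ = genB F K δ h₂' * genB F K δ h₂ := by
  unfold genB
  rw [← map_mul, ← map_mul, RingQuot.mkAlgHom_rel F (EquivalenceRel.mk h₁ h₁' h₂ h₂')]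

open scoped ModuleCat in
/-- Left `B(K, δ)`-modules that are finite-dimensional over `F`. -/
def IsFiniteDimensionalModule : ObjectProperty (ModuleCat.{u} (AlgebraB F K δ)) := fun M ↦
  Module.Finite F M

/-- The category `R(K, δ)` of finite-dimensional left `B(K, δ)`-modules. -/
abbrev CategoryR : Type (u + 1) := (IsFiniteDimensionalModule F K δ).FullSubcategory

end Algebra

/-! ### Linear algebra data subject to the equivalence axiom -/

section LinearData

variable (F : Type u) [Field F] {V : Type u} [Fintype V] (K : AbstractSimplicialComplex V)
  (δ : ℕ → ℤ)

/-- Linear algebra data: a vector space for each simplex, a restriction map for each arrow, and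
the equivalence axiom. No finiteness is imposed here, see `FinLinearData`. -/
structure LinearData where
  /-- the stalk at a simplex -/
  stalk : K.Simplex → ModuleCat.{u} F
  /-- the restriction maps -/
  res : ∀ {Δ Δ' : K.Simplex}, K.HasArrow δ Δ Δ' → (stalk Δ ⟶ stalk Δ')
  /-- the equivalence axiom -/
  equivalence : ∀ {Δ' Δ₁ Δ₂ Δ'' : K.Simplex} (h₁ : K.HasArrow δ Δ' Δ₁)
    (h₁' : K.HasArrow δ Δ₁ Δ'') (h₂ : K.HasArrow δ Δ' Δ₂) (h₂' : K.HasArrow δ Δ₂ Δ''),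
    res h₁ ≫ res h₁' = res h₂ ≫ res h₂'

variable {F K δ} in
/-- Morphisms: stalkwise linear maps commuting with the restriction maps. -/
@[ext]
structure LinearData.Hom (S T : LinearData F K δ) where
  /-- the map on stalks -/
  app : ∀ Δ : K.Simplex, S.stalk Δ ⟶ T.stalk Δ
  comm : ∀ {Δ Δ' : K.Simplex} (h : K.HasArrow δ Δ Δ'), S.res h ≫ app Δ' = app Δ ≫ T.res h

instance : Category (LinearData F K δ) where
  Hom := LinearData.Hom
  id S := { app := fun _ ↦ 𝟙 _, comm := fun h ↦ by simp }
  comp f g :=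
    { app := fun Δ ↦ f.app Δ ≫ g.app Δ
      comm := fun h ↦ by
        rw [← Category.assoc, f.comm h, Category.assoc, g.comm h, Category.assoc] }
  id_comp f := LinearData.Hom.ext (funext fun _ ↦ Category.id_comp _)
  comp_id f := LinearData.Hom.ext (funext fun _ ↦ Category.comp_id _)
  assoc f g h := LinearData.Hom.ext (funext fun _ ↦ Category.assoc _ _ _)

/-- All stalks are finite-dimensional. -/
def IsFiniteDimensionalData : ObjectProperty (LinearData F K δ) := fun S ↦
  ∀ Δ : K.Simplex, Module.Finite F (S.stalk Δ)

/-- Linear algebra data with finite-dimensional stalks. -/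
abbrev FinLinearData : Type (u + 1) := (IsFiniteDimensionalData F K δ).FullSubcategory

end LinearData

/-! ### The comparison functors -/

section Comparison

variable (F : Type u) [Field F] {V : Type u} [Fintype V] (K : AbstractSimplicialComplex V)
  (δ : ℕ → ℤ)

open scoped ModuleCat

variable {F K δ} in
/-- The action of an element of `B(K, δ)` on a module, as an `F`-linear map. -/
def act (M : ModuleCat.{u} (AlgebraB F K δ)) (b : AlgebraB F K δ) : M →ₗ[F] M :=
  Algebra.lsmul F F M b

lemma act_mul (M : ModuleCat.{u} (AlgebraB F K δ)) (a b : AlgebraB F K δ) (m : M) :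
    act M (a * b) m = act M a (act M b m) :=
  mul_smul a b m

variable {F K δ} in
/-- The subspace `e_Δ M` of a module `M`. -/
def stalkSubmodule (M : ModuleCat.{u} (AlgebraB F K δ)) (Δ : K.Simplex) : Submodule F M :=
  LinearMap.range (act M (idemB F K δ Δ))

lemma act_genB_mem (M : ModuleCat.{u} (AlgebraB F K δ)) {Δ Δ' : K.Simplex}
    (h : K.HasArrow δ Δ Δ') (m : M) : act M (genB F K δ h) m ∈ stalkSubmodule M Δ' :=
  ⟨act M (genB F K δ h) m, by rw [← act_mul, idemB_mul_genB]⟩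

lemma map_act {M N : ModuleCat.{u} (AlgebraB F K δ)} (f : M ⟶ N) (b : AlgebraB F K δ) (m : M) :
    f.hom (act M b m) = act N b (f.hom m) :=
  f.hom.map_smul b m

variable {F K δ} in
/-- Multiplication by `b(Δ, Δ')`, as a map `e_Δ M → e_Δ' M`. -/
def stalkRes (M : ModuleCat.{u} (AlgebraB F K δ)) {Δ Δ' : K.Simplex} (h : K.HasArrow δ Δ Δ') :
    stalkSubmodule M Δ →ₗ[F] stalkSubmodule M Δ' :=
  (act M (genB F K δ h)).restrict fun m _ ↦ act_genB_mem F K δ M h m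

variable {F K δ} in
/-- The restriction of a module homomorphism `M → N` to a map `e_Δ M → e_Δ N`. -/
def stalkMap {M N : ModuleCat.{u} (AlgebraB F K δ)} (f : M ⟶ N) (Δ : K.Simplex) :
    stalkSubmodule M Δ →ₗ[F] stalkSubmodule N Δ :=
  (f.hom.restrictScalars F).restrict <| by
    rintro _ ⟨m, rfl⟩
    exact ⟨f.hom m, (map_act F K δ f _ m).symm⟩

/-- The linear algebra data of a module `M`: the stalk at `Δ` is `e_Δ M`, and the restriction map
of the arrow `Δ ⟶ Δ'` is multiplication by `b(Δ, Δ')`. -/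
def moduleData : ModuleCat.{u} (AlgebraB F K δ) ⥤ LinearData F K δ where
  obj M :=
    { stalk := fun Δ ↦ ModuleCat.of F (stalkSubmodule M Δ)
      res := fun h ↦ ModuleCat.ofHom (stalkRes M h)
      equivalence := fun h₁ h₁' h₂ h₂' ↦ ModuleCat.hom_ext <| LinearMap.ext fun m ↦
        Subtype.ext <| by
          change act M _ (act M _ m.1) = act M _ (act M _ m.1)
          rw [← act_mul, ← act_mul, genB_mul_genB F K δ h₁ h₁' h₂ h₂'] }
  map {M N} f :=
    { app := fun Δ ↦ ModuleCat.ofHom (stalkMap f Δ)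
      comm := fun h ↦ ModuleCat.hom_ext <| LinearMap.ext fun m ↦
        Subtype.ext <| map_act F K δ f _ m.1 }
  map_id M := LinearData.Hom.ext <| funext fun Δ ↦ ModuleCat.hom_ext <| LinearMap.ext fun m ↦ rfl
  map_comp f g := LinearData.Hom.ext <| funext fun Δ ↦ ModuleCat.hom_ext <|
    LinearMap.ext fun m ↦ rfl

/-- The partial order generated by the arrows: `Δ ≤ Δ'` iff there is a path from `Δ` to `Δ'`. -/
def PathLE (Δ Δ' : K.Simplex) : Prop := Relation.ReflTransGen (K.HasArrow δ) Δ Δ'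

/-- The perverse open star of `Δ`: the union of the `(-δ)`-perverse simplices of all `Δ' ≥ Δ`.
For a perversity `δ` this union is open, so it equals its interior; the interior is taken so that
the definition makes sense for every function `δ`. -/
def perverseStar (Δ : K.Simplex) : Opens K.space :=
  ⟨interior (⋃ Δ' ∈ {Δ' | K.PathLE δ Δ Δ'}, K.perverseSimplex (fun k ↦ -δ k) Δ'), isOpen_interior⟩

lemma perverseStar_le {Δ Δ' : K.Simplex} (h : K.HasArrow δ Δ Δ') :
    K.perverseStar δ Δ' ≤ K.perverseStar δ Δ :=
  interior_mono <| Set.biUnion_mono (fun _ h' ↦ Relation.ReflTransGen.head h h') fun _ _ ↦ le_rfl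

/-- The linear algebra data of a sheaf `A`: the stalk at `Δ` is the space of sections of `A` over
the perverse open star of `Δ`, and the restriction maps are those of `A`. -/
def sheafData : TopCat.Sheaf (ModuleCat.{u} F) K.space ⥤ LinearData F K δ where
  obj A :=
    { stalk := fun Δ ↦ A.presheaf.obj (op (K.perverseStar δ Δ))
      res := fun h ↦ A.presheaf.map (homOfLE (K.perverseStar_le δ h)).op
      equivalence := fun _ _ _ _ ↦ by
        rw [← Functor.map_comp, ← Functor.map_comp]
        rfl }
  map f :=
    { app := fun Δ ↦ f.hom.app (op (K.perverseStar δ Δ))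
      comm := fun h ↦ f.hom.naturality _ }
  map_id A := rfl
  map_comp f g := rfl

end Comparison

end

end AbstractSimplicialComplex

/-! Modules and linear algebra data correspond as for any path algebra with relations: a module is
the direct sum of its subspaces `e_Δ M`, and conversely `∏ S(Δ)` carries an action of `B(K, δ)`. It
remains to compare linear algebra data with constructible sheaves.

Let `pole δ x` be the simplex of least rank `δ` among the vertices of the open subdivision simplex
containing `x`; the fibres of `pole` are the perverse simplices. Near `x` this set of vertices can
only grow, and incident simplices are comparable in the path order, so near `x` the pole only moves
forward along paths (`eventually_pathLE_pole`). Hence the perverse stars are open, and a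
constructible sheaf should amount to a functor on the path order.

From data to sheaves: the equivalence axiom concerns paths of length two, but it forces all parallel
paths to act equally (`IsComposite.unique`). The reason is combinatorial: arrows lead to faces while
ranks are nonnegative and to cofaces while they are nonpositive, and two first steps towards the
same target are joined by exchanging one vertex at a time (`linked_chain`). The sections of
`sheafOf` are the families of elements of `S(pole x)` locally compatible with the path maps. Its
stalk at `x` is `S(pole x)`, and following segments shows that its sections on the star of `Δ` are
`S(Δ)` (`starSection_bijective`). This gives full faithfulness.

From sheaves to data: a germ at a point of one stratum extends to nearby points of another. The
resulting linear map does not depend on the points, because the segment joining them can be deformed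
(`transports_homotopy`), and such maps compose along flags (`transport_transport`). If two paths of
length two have different middle vertices, their ends are incident (`incident_of_two_paths`), so
both composites equal the direct transport; this is the equivalence axiom. Taking values of sections
is then an isomorphism from the given sheaf to the sheaf of its data, as is seen on stalks. -/

noncomputable section

open Topology TopCat TopCat.Presheaf

/-! ### Sheaves of families cut out by a local linear condition -/

section LocalSections

variable {F : Type u} [Field F] {X : TopCat.{u}} (M : X → ModuleCat.{u} F)
  (C : ∀ x y, Submodule F (M x × M y))

/-- The families `s x ∈ M x`, `x ∈ U`, such that for every `x` the relation `C x y` holds between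
`s x` and `s y` for all `y` near `x`. -/
def localSectionsSubmodule (U : Opens X) : Submodule F (∀ x : U, M x.1) where
  carrier := {s | ∀ x : U, ∀ᶠ y in 𝓝 x, (s x, s y) ∈ C x.1 y.1}
  zero_mem' := fun x ↦ Filter.Eventually.of_forall fun y ↦ (C x.1 y.1).zero_mem
  add_mem' := fun hs ht x ↦ by
    filter_upwards [hs x, ht x] with y h h' using (C x.1 y.1).add_mem h h'
  smul_mem' := fun a s hs x ↦ by
    filter_upwards [hs x] with y h using (C x.1 y.1).smul_mem a h

variable {M C} in
lemma localSections_eventually {U : Opens X} (s : localSectionsSubmodule M C U) {x : X}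
    (hx : x ∈ U) : ∀ᶠ y in 𝓝 x, ∀ hy : y ∈ U, (s.1 ⟨x, hx⟩, s.1 ⟨y, hy⟩) ∈ C x y := by
  have h := s.2 ⟨x, hx⟩
  rw [nhds_subtype_eq_comap, Filter.eventually_comap] at h
  filter_upwards [h] with y hy hyU using hy ⟨y, hyU⟩ rfl

/-- Restriction of local sections. -/
def localSectionsRestrict {U U' : Opens X} (h : U' ≤ U) :
    localSectionsSubmodule M C U →ₗ[F] localSectionsSubmodule M C U' where
  toFun s := ⟨fun x ↦ s.1 ⟨x.1, h x.2⟩, fun x ↦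
    (continuous_inclusion h).continuousAt.eventually (s.2 ⟨x.1, h x.2⟩)⟩
  map_add' _ _ := rfl
  map_smul' _ _ := rfl

/-- The presheaf of local sections. -/
def localSectionsPresheaf : X.Presheaf (ModuleCat.{u} F) where
  obj U := ModuleCat.of F (localSectionsSubmodule M C U.unop)
  map i := ModuleCat.ofHom (localSectionsRestrict M C i.unop.le)

/-- The condition at `x` involves only points near `x`, so a family glued pointwise may be tested on
any member of the cover containing `x`. -/
lemma localSectionsPresheaf_isSheaf : (localSectionsPresheaf M C).IsSheaf := by
  rw [isSheaf_iff_isSheafUniqueGluing]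
  intro ι U sf hsf
  have hsf' : ∀ i j (x : X) (hi : x ∈ U i) (hj : x ∈ U j),
      (sf i).1 ⟨x, hi⟩ = (sf j).1 ⟨x, hj⟩ := fun i j x hi hj ↦
    congrFun (congrArg Subtype.val (hsf i j)) ⟨x, hi, hj⟩
  have hU : ∀ x : (iSup U : Opens X), ∃ i, x.1 ∈ U i := fun x ↦ by
    exact Opens.mem_iSup.mp x.2
  choose k hk using hU
  have hval : ∀ (x : (iSup U : Opens X)) (i) (hi : x.1 ∈ U i),
      (sf (k x)).1 ⟨x.1, hk x⟩ = (sf i).1 ⟨x.1, hi⟩ := fun x i hi ↦ hsf' _ _ _ _ _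
  refine ⟨⟨fun x ↦ (sf (k x)).1 ⟨x.1, hk x⟩, fun x ↦ ?_⟩, ?_, ?_⟩
  · have hx := (sf (k x)).2 ⟨x.1, hk x⟩
    have hle : U (k x) ≤ iSup U := le_iSup U _
    -- The inclusion is open, so a point has the same neighbourhoods in the member of the cover as
    -- in the union.
    have hopen : IsOpenEmbedding (Set.inclusion hle) :=
      .of_comp _ (iSup U : Opens X).2.isOpenEmbedding_subtypeVal
        (U (k x)).2.isOpenEmbedding_subtypeVal
    have := (hopen.map_nhds_eq ⟨x.1, hk x⟩)
    change ∀ᶠ y in 𝓝 x, _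
    rw [show x = Set.inclusion hle ⟨x.1, hk x⟩ from rfl, ← this, Filter.eventually_map]
    filter_upwards [hx] with y hy
    rw [hval (Set.inclusion hle y) (k x) y.2]
    exact hy
  · intro i
    exact Subtype.ext (funext fun x ↦ hval ⟨x.1, _⟩ i x.2)
  · intro t ht
    exact Subtype.ext (funext fun x ↦
      (congrFun (congrArg Subtype.val (ht (k x))) ⟨x.1, hk x⟩ :))

/-- The sheaf of local sections. -/
def localSections : TopCat.Sheaf (ModuleCat.{u} F) X :=
  ⟨localSectionsPresheaf M C, localSectionsPresheaf_isSheaf M C⟩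

/-- Evaluation of germs of local sections at the base point. -/
def stalkEval (x : X) : (localSections M C).presheaf.stalk x ⟶ M x :=
  Limits.colimit.desc _
    { pt := M x
      ι :=
        { app := fun U ↦ ModuleCat.ofHom
            ((LinearMap.proj (⟨x, U.unop.2⟩ : U.unop.1)).comp (Submodule.subtype _))
          naturality := fun _ _ _ ↦ rfl } }

lemma stalkEval_germ (x : X) (U : Opens X) (hx : x ∈ U)
    (s : (localSections M C).presheaf.obj (op U)) :
    stalkEval M C x ((localSections M C).presheaf.germ U x hx s) = s.1 ⟨x, hx⟩ := by
  have : (localSections M C).presheaf.germ U x hx ≫ stalkEval M C x = ModuleCat.ofHom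
      ((LinearMap.proj (⟨x, hx⟩ : U)).comp (Submodule.subtype _)) :=
    Limits.colimit.ι_desc _ _
  exact congr($this s)

/-- `hfun` says that the value 0 at `x` forces the value 0 nearby, which makes a germ vanishing at
`x` zero; `hsurj` realizes every value. -/
lemma stalkEval_bijective (x : X)
    (hfun : ∀ᶠ y in 𝓝 x, ∀ b, ((0 : M x), b) ∈ C x y → b = 0)
    (hsurj : ∀ m : M x, ∃ (U : Opens X) (hx : x ∈ U) (s : localSectionsSubmodule M C U),
      s.1 ⟨x, hx⟩ = m) :
    Function.Bijective (stalkEval M C x) := by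
  constructor
  · rw [injective_iff_map_eq_zero]
    intro a ha
    obtain ⟨U, hx, s, rfl⟩ := (localSections M C).presheaf.exists_germ_eq a
    rw [stalkEval_germ] at ha
    have h2 : ∀ᶠ y in 𝓝 x, ∀ hy : y ∈ U, s.1 ⟨y, hy⟩ = 0 := by
      filter_upwards [localSections_eventually s hx, hfun] with y hy hy' hyU
      have := hy hyU
      rw [ha] at this
      exact hy' _ this
    obtain ⟨W, hW, hWo, hxW⟩ := eventually_nhds_iff.mp h2
    let W' : Opens X := ⟨W, hWo⟩ ⊓ U
    have hxW' : x ∈ W' := ⟨hxW, hx⟩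
    rw [← (localSections M C).presheaf.germ_res_apply
      (homOfLE (inf_le_right : W' ≤ U)) x hxW' s]
    have : (localSections M C).presheaf.map (homOfLE (inf_le_right : W' ≤ U)).op s = 0 :=
      Subtype.ext (funext fun y ↦ hW y.1 y.2.1 y.2.2)
    rw [this, map_zero]
  · intro m
    obtain ⟨U, hx, s, rfl⟩ := hsurj m
    exact ⟨(localSections M C).presheaf.germ U x hx s, stalkEval_germ ..⟩

end LocalSections

/-! ### Stalks and sheafification -/

section Stalks

variable {F : Type u} [Field F] {X Z : TopCat.{u}}

/-- The map induced by a morphism of presheaves on the stalks at `x`. -/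
def stalkHom {P Q : X.Presheaf (ModuleCat.{u} F)} (f : P ⟶ Q) (x : X) : P.stalk x ⟶ Q.stalk x :=
  (stalkFunctor _ x).map f

lemma stalkHom_germ {P Q : X.Presheaf (ModuleCat.{u} F)} (f : P ⟶ Q) (U : Opens X) (x : X)
    (hx : x ∈ U) (s : P.obj (op U)) :
    stalkHom f x (P.germ U x hx s) = Q.germ U x hx (f.app (op U) s) :=
  stalkFunctor_map_germ_apply U x hx f s

lemma isLocallyInjective_of_stalk {P Q : X.Presheaf (ModuleCat.{u} F)} (f : P ⟶ Q)
    (h : ∀ x, Function.Injective (stalkHom f x)) :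
    CategoryTheory.Presheaf.IsLocallyInjective (Opens.grothendieckTopology X) f where
  equalizerSieve_mem {U} s t hst x hx := by
    have : P.germ U.unop x hx s = P.germ U.unop x hx t := by
      apply h x
      rw [stalkHom_germ, stalkHom_germ]
      exact congrArg _ hst
    obtain ⟨W, hW, i, j, e⟩ := P.germ_eq x hx hx s t this
    obtain rfl : i = j := Subsingleton.elim _ _
    exact ⟨W, i, e, hW⟩

lemma stalk_injective_of_isLocallyInjective {P Q : X.Presheaf (ModuleCat.{u} F)} (f : P ⟶ Q)
    [CategoryTheory.Presheaf.IsLocallyInjective (Opens.grothendieckTopology X) f] (x : X) :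
    Function.Injective (stalkHom f x) := by
  intro a b hab
  obtain ⟨U, hU, s, rfl⟩ := P.exists_germ_eq a
  obtain ⟨V, hV, t, rfl⟩ := P.exists_germ_eq b
  rw [stalkHom_germ, stalkHom_germ] at hab
  obtain ⟨W, hW, i, j, e⟩ := Q.germ_eq x hU hV _ _ hab
  rw [← NatTrans.naturality_apply, ← NatTrans.naturality_apply] at e
  obtain ⟨W', k, hk, hW'⟩ := CategoryTheory.Presheaf.equalizerSieve_mem
    (Opens.grothendieckTopology X) f _ _ e x hW
  have hk' : P.map k.op (P.map i.op s) = P.map k.op (P.map j.op t) := hk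
  rw [← P.germ_res_apply i x hW, ← P.germ_res_apply j x hW,
    ← P.germ_res_apply k x hW', ← P.germ_res_apply k x hW', hk']

/-- The unit of sheafification is locally injective and locally surjective, and both properties pass
to stalks. -/
lemma isIso_stalk_toSheafify (P : X.Presheaf (ModuleCat.{u} F)) (x : X) :
    IsIso (stalkHom (toSheafify (Opens.grothendieckTopology X) P) x) := by
  rw [ConcreteCategory.isIso_iff_bijective]
  refine ⟨stalk_injective_of_isLocallyInjective _ x, ?_⟩
  exact (locally_surjective_iff_surjective_on_stalks _).mp
    (inferInstanceAs (CategoryTheory.Presheaf.IsLocallySurjective _ _)) x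

/-- A sheaf receiving a stalkwise bijective morphism from a presheaf is its sheafification. -/
lemma nonempty_sheafification_iso (P : X.Presheaf (ModuleCat.{u} F))
    (B : TopCat.Sheaf (ModuleCat.{u} F) X) (f : P ⟶ B.presheaf)
    (h : ∀ x, Function.Bijective (stalkHom f x)) :
    Nonempty ((presheafToSheaf (Opens.grothendieckTopology X) _).obj P ≅ B) := by
  have h1 := isLocallyInjective_of_stalk f fun x ↦ (h x).1
  have h2 : CategoryTheory.Presheaf.IsLocallySurjective (Opens.grothendieckTopology X) f :=
    (locally_surjective_iff_surjective_on_stalks f).mpr fun x ↦ (h x).2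
  have h3 : (Opens.grothendieckTopology X).W f :=
    (GrothendieckTopology.W_iff_isLocallyBijective _ f).mpr ⟨h1, h2⟩
  rw [GrothendieckTopology.W_iff] at h3
  exact ⟨asIso ((presheafToSheaf (Opens.grothendieckTopology X) _).map f) ≪≫
    (sheafificationNatIso (Opens.grothendieckTopology X) _).symm.app B⟩

end Stalks

/-! ### Constant inverse images -/

section Constant

variable {F : Type u} [Field F] {X Z : TopCat.{u}} (W : ModuleCat.{u} F)

/-- The constant presheaf. -/
abbrev constantPresheaf (Z : TopCat.{u}) : Z.Presheaf (ModuleCat.{u} F) :=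
  (Functor.const _).obj W

/-- The constant sheaf on a space. -/
abbrev constSheaf (Z : TopCat.{u}) : TopCat.Sheaf (ModuleCat.{u} F) Z :=
  (constantSheaf (Opens.grothendieckTopology Z) (ModuleCat.{u} F)).obj W

/-- All restriction maps of the constant presheaf are identities, so the colimit over neighbourhoods
is `W` itself. -/
lemma constantPresheaf_germ_bijective (z : Z) :
    Function.Bijective ((constantPresheaf W Z).germ ⊤ z (Opens.mem_top z)) := by
  constructor
  · intro a b hab
    obtain ⟨U, _, _, _, e⟩ := (constantPresheaf W Z).germ_eq z
      (Opens.mem_top z) (Opens.mem_top z) a b hab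
    exact e
  · intro a
    obtain ⟨U, hU, s, rfl⟩ := (constantPresheaf W Z).exists_germ_eq a
    exact ⟨s, ((constantPresheaf W Z).germ_res_apply (homOfLE le_top : U ⟶ ⊤) z hU s).symm⟩

/-- The global sections of the constant sheaf with constant value. -/
def constantSection (w : W) :
    (constSheaf W Z).presheaf.obj (op ⊤) :=
  (toSheafify (Opens.grothendieckTopology Z) (constantPresheaf W Z)).app (op ⊤) w

/-- The stalks of the constant sheaf. -/
def constantStalk (z : Z) : W ⟶
    (constSheaf W Z).presheaf.stalk z :=
  (constantPresheaf W Z).germ ⊤ z (Opens.mem_top z) ≫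
    stalkHom (toSheafify (Opens.grothendieckTopology Z) (constantPresheaf W Z)) z

lemma constantStalk_apply (z : Z) (w : W) :
    constantStalk W z w = Presheaf.germ
      (constSheaf W Z).presheaf
        ⊤ z (Opens.mem_top z) (constantSection W w) :=
  stalkHom_germ _ _ _ _ _

instance (z : Z) : IsIso (constantStalk W z) := by
  have h := isIso_stalk_toSheafify (constantPresheaf W Z) z
  have : IsIso ((constantPresheaf W Z).germ ⊤ z (Opens.mem_top z)) :=
    (ConcreteCategory.isIso_iff_bijective _).mpr (constantPresheaf_germ_bijective W z)
  exact IsIso.comp_isIso' this h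

/-- The values of a section of a constant sheaf form a locally constant function. -/
lemma inv_constantStalk_germ_eventually (U : Opens Z)
    (s : (constSheaf W Z).presheaf.obj
      (op U)) (z : Z) (hz : z ∈ U) :
    ∀ᶠ z' in 𝓝 z, ∀ hz' : z' ∈ U,
      inv (constantStalk W z') ((constSheaf W Z).presheaf.germ U z' hz' s) =
        inv (constantStalk W z) ((constSheaf W Z).presheaf.germ U z hz s) := by
  let B := (constSheaf W Z).presheaf
  set w := inv (constantStalk W z) (B.germ U z hz s) with hw
  -- The section and the constant section `w` have the same germ at `z`, hence agree on a
  -- neighbourhood; there the value is `w`.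
  have h : B.germ U z hz s = B.germ ⊤ z (Opens.mem_top z) (constantSection W w) := by
    rw [← constantStalk_apply, hw]
    simp
  obtain ⟨O, hO, i, j, e⟩ := B.germ_eq z hz (Opens.mem_top z) _ _ h
  filter_upwards [O.2.mem_nhds hO] with z' hz' hz'U
  have h' : B.germ U z' hz'U s = constantStalk W z' w := by
    rw [constantStalk_apply, ← B.germ_res_apply i z' hz', ← B.germ_res_apply j z' hz', e]
  change inv (constantStalk W z') (B.germ U z' hz'U s) = w
  rw [h']
  simp

/-- A family of isomorphisms between the stalks of `A` along `i` and `W`, such that the values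
of sections of `A` are locally constant. -/
structure StalkTrivialization (i : Z ⟶ X) (A : TopCat.Sheaf (ModuleCat.{u} F) X) where
  /-- the isomorphisms with the stalks -/
  iso : ∀ z : Z, A.presheaf.stalk (i z) ≅ W
  eventually_eq : ∀ (U : Opens X) (s : A.presheaf.obj (op U)) (z : Z) (hz : i z ∈ U),
    ∀ᶠ z' in 𝓝 z, ∀ hz' : i z' ∈ U, (iso z').hom (A.presheaf.germ U (i z') hz' s) =
      (iso z).hom (A.presheaf.germ U (i z) hz s)

/-- The inverse image is the sheafification of the presheaf inverse image `P`, so `φ` yields a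
stalkwise isomorphism `α` from `P` to the constant sheaf. The stalk of `P` at `z` is that of `A` at
`i z`, and sections of `A` become sections of the constant sheaf, whose values are locally constant.
-/
lemma nonempty_stalkTrivialization (i : Z ⟶ X) (A : TopCat.Sheaf (ModuleCat.{u} F) X)
    (φ : (TopCat.Sheaf.pullback (ModuleCat.{u} F) i).obj A ≅
      constSheaf W Z) :
    Nonempty (StalkTrivialization W i A) := by
  let P := (Presheaf.pullback (ModuleCat.{u} F) i).obj A.presheaf
  let B := constSheaf W Z
  let ψ : (presheafToSheaf (Opens.grothendieckTopology Z) _).obj P ≅ B :=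
    ((TopCat.Sheaf.pullbackIso (ModuleCat.{u} F) i).app A).symm ≪≫ φ
  let α : P ⟶ B.presheaf := toSheafify (Opens.grothendieckTopology Z) P ≫ ψ.hom.hom
  have hα : ∀ z, IsIso (stalkHom α z) := fun z ↦ by
    have h1 := isIso_stalk_toSheafify P z
    have h2 : IsIso (stalkHom ψ.hom.hom z) := by
      have : IsIso ψ.hom.hom := inferInstanceAs (IsIso ((sheafToPresheaf _ _).map ψ.hom))
      exact Functor.map_isIso (stalkFunctor _ z) ψ.hom.hom
    have : stalkHom α z = stalkHom (toSheafify (Opens.grothendieckTopology Z) P) z ≫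
        stalkHom ψ.hom.hom z := Functor.map_comp _ _ _
    rw [this]
    infer_instance
  have hgerm : ∀ (U : Opens X) (s : A.presheaf.obj (op U)) (z : Z) (hz : i z ∈ U),
      stalkHom α z ((stalkPullbackIso _ i A.presheaf z).hom (A.presheaf.germ U (i z) hz s)) =
        B.presheaf.germ ((Opens.map i).obj U) z hz (α.app _
          (((pullbackPushforwardAdjunction _ i).unit.app A.presheaf).app (op U) s)) := by
    intro U s z hz
    refine Eq.trans (congrArg (stalkHom α z) ?_) (stalkHom_germ α _ _ _ _)
    exact congr($(germ_stalkPullbackHom _ i A.presheaf z U hz) s)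
  refine ⟨⟨fun z ↦ stalkPullbackIso _ i A.presheaf z ≪≫ asIso (stalkHom α z) ≪≫
    (asIso (constantStalk W z)).symm, fun U s z hz ↦ ?_⟩⟩
  filter_upwards [inv_constantStalk_germ_eventually W ((Opens.map i).obj U) (α.app _
    (((pullbackPushforwardAdjunction _ i).unit.app A.presheaf).app (op U) s)) z hz] with z' h hz'
  have key : ∀ (z : Z) (hz : i z ∈ U), (stalkPullbackIso _ i A.presheaf z ≪≫
      asIso (stalkHom α z) ≪≫ (asIso (constantStalk W z)).symm).hom
        (A.presheaf.germ U (i z) hz s) = inv (constantStalk W z)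
          (B.presheaf.germ ((Opens.map i).obj U) z hz (α.app _
          (((pullbackPushforwardAdjunction _ i).unit.app A.presheaf).app (op U) s))) :=
    fun z hz ↦ congrArg (inv (constantStalk W z)) (hgerm U s z hz)
  rw [key z hz, key z' hz']
  exact h hz'

/-- The sheaf of locally constant functions. -/
def locallyConstantSheaf (Z : TopCat.{u}) : TopCat.Sheaf (ModuleCat.{u} F) Z :=
  localSections (fun _ : Z ↦ W) (fun _ _ ↦ LinearMap.eqLocus (LinearMap.fst F W W)
    (LinearMap.snd F W W))

lemma stalkEval_locallyConstant_bijective (z : Z) :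
    Function.Bijective (stalkEval (fun _ : Z ↦ W) (fun _ _ ↦ LinearMap.eqLocus
      (LinearMap.fst F W W) (LinearMap.snd F W W)) z) :=
  stalkEval_bijective _ _ z (Filter.Eventually.of_forall fun _ _ h ↦ h.symm) fun m ↦
    ⟨⊤, Opens.mem_top z, ⟨fun _ ↦ m, fun _ ↦ Filter.Eventually.of_forall fun _ ↦ rfl⟩, rfl⟩

lemma nonempty_constantSheaf_iso (Z : TopCat.{u}) :
    Nonempty (constSheaf W Z ≅
      locallyConstantSheaf W Z) := by
  let f : constantPresheaf W Z ⟶ (locallyConstantSheaf W Z).presheaf :=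
    { app := fun U ↦ ModuleCat.ofHom
        { toFun := fun w ↦ ⟨fun _ ↦ w, fun _ ↦ Filter.Eventually.of_forall fun _ ↦ rfl⟩
          map_add' := fun _ _ ↦ rfl
          map_smul' := fun _ _ ↦ rfl }
      naturality := fun _ _ _ ↦ rfl }
  refine nonempty_sheafification_iso _ _ f fun z ↦ ?_
  have h := stalkEval_locallyConstant_bijective W z
  have hc : ∀ w, stalkEval _ _ z (stalkHom f z
      ((constantPresheaf W Z).germ ⊤ z (Opens.mem_top z) w)) = w :=
    fun w ↦ (congrArg (stalkEval _ _ z) (stalkHom_germ f _ _ _ _)).trans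
      (stalkEval_germ _ _ z ⊤ (Opens.mem_top z) _)
  -- The composite is the identity of `W`; its two outer factors are bijective, hence so is the
  -- middle one.
  have hc' : Function.Bijective (stalkEval _ _ z ∘ stalkHom f z ∘
      (constantPresheaf W Z).germ ⊤ z (Opens.mem_top z)) := by
    convert Function.bijective_id
    ext w
    exact hc w
  have := (Function.Bijective.of_comp_iff' h _).mp hc'
  exact (Function.Bijective.of_comp_iff _ (constantPresheaf_germ_bijective W z)).mp this

/-- Sending a section to its locally constant function of values is a map from `A` to the direct
image of the sheaf of locally constant functions. On stalks its adjoint is given by the isomorphisms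
`τ.iso`, so it exhibits the target as the sheafification of the presheaf inverse image. -/
lemma StalkTrivialization.nonempty_iso {i : Z ⟶ X} {A : TopCat.Sheaf (ModuleCat.{u} F) X}
    (τ : StalkTrivialization W i A) :
    Nonempty ((TopCat.Sheaf.pullback (ModuleCat.{u} F) i).obj A ≅
      constSheaf W Z) := by
  obtain ⟨e⟩ := nonempty_constantSheaf_iso W Z
  let P := (Presheaf.pullback (ModuleCat.{u} F) i).obj A.presheaf
  let β : A.presheaf ⟶ (Presheaf.pushforward _ i).obj (locallyConstantSheaf W Z).presheaf :=
    { app := fun U ↦ ModuleCat.ofHom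
        { toFun := fun s ↦ ⟨fun z ↦ (τ.iso z.1).hom (A.presheaf.germ U.unop (i z.1) z.2 s),
            fun z ↦ by
              have := (continuous_subtype_val (p := (· ∈ (Opens.map i).obj U.unop))).continuousAt
                |>.eventually (τ.eventually_eq U.unop s z.1 z.2)
              filter_upwards [this] with z' hz' using (hz' z'.2).symm⟩
          map_add' := fun s t ↦ Subtype.ext (funext fun z ↦
            (A.presheaf.germ U.unop (i z.1) z.2 ≫ (τ.iso z.1).hom).hom.map_add s t)
          map_smul' := fun a s ↦ Subtype.ext (funext fun z ↦
            (A.presheaf.germ U.unop (i z.1) z.2 ≫ (τ.iso z.1).hom).hom.map_smul a s) }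
      naturality := fun U U' j ↦ by
        ext s
        exact Subtype.ext (funext fun z ↦ congrArg (τ.iso z.1).hom
          (A.presheaf.germ_res_apply j.unop (i z.1) z.2 s)) }
  let f : P ⟶ (locallyConstantSheaf W Z).presheaf :=
    ((pullbackPushforwardAdjunction _ i).homEquiv _ _).symm β
  have hf : ∀ U s, f.app (op ((Opens.map i).obj U))
      (((pullbackPushforwardAdjunction _ i).unit.app A.presheaf).app (op U) s) =
        β.app (op U) s := by
    intro U s
    have := ((pullbackPushforwardAdjunction (ModuleCat.{u} F) i).homEquiv_unit
      (X := A.presheaf) (f := f)).symm.trans (Equiv.apply_symm_apply _ β)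
    exact congr(($this).app (op U) s)
  obtain ⟨e'⟩ := nonempty_sheafification_iso P (locallyConstantSheaf W Z) f fun z ↦ by
    have h := stalkEval_locallyConstant_bijective W z
    have h1 : Function.Bijective (stalkPullbackIso _ i A.presheaf z).hom :=
      ConcreteCategory.bijective_of_isIso _
    have h2 : stalkEval _ _ z ∘ stalkHom f z ∘ (stalkPullbackIso _ i A.presheaf z).hom =
        (τ.iso z).hom := by
      funext a
      obtain ⟨U, hU, s, rfl⟩ := A.presheaf.exists_germ_eq a
      have h3 : (stalkPullbackIso _ i A.presheaf z).hom (A.presheaf.germ U (i z) hU s) =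
          P.germ ((Opens.map i).obj U) z hU
            (((pullbackPushforwardAdjunction _ i).unit.app A.presheaf).app (op U) s) :=
        congr($(germ_stalkPullbackHom _ i A.presheaf z U hU) s)
      refine (congrArg (fun a ↦ stalkEval _ _ z (stalkHom f z a)) h3).trans ?_
      refine (congrArg (fun a ↦ stalkEval _ _ z a) (stalkHom_germ f _ z hU _)).trans ?_
      refine (stalkEval_germ _ _ z _ hU _).trans ?_
      rw [hf]
      rfl
    have h4 : Function.Bijective (stalkEval _ _ z ∘ stalkHom f z ∘
        (stalkPullbackIso _ i A.presheaf z).hom) := by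
      rw [h2]
      exact ConcreteCategory.bijective_of_isIso _
    exact (Function.Bijective.of_comp_iff _ h1).mp ((Function.Bijective.of_comp_iff' h _).mp h4)
  exact ⟨(TopCat.Sheaf.pullbackIso (ModuleCat.{u} F) i).app A ≪≫ e' ≪≫ e.symm⟩

end Constant

end

noncomputable section

namespace AbstractSimplicialComplex

/-! ### Modules and linear algebra data -/

section Modules

variable {F : Type u} [Field F] {V : Type u} [Fintype V] {K : AbstractSimplicialComplex V}
  {δ : ℕ → ℤ}

lemma idemB_mul_self (Δ : K.Simplex) : idemB F K δ Δ * idemB F K δ Δ = idemB F K δ Δ := by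
  unfold idemB
  rw [← map_mul, ← map_mul, RingQuot.mkAlgHom_rel F (PathRel.idem Δ)]

lemma idemB_mul_of_ne {Δ Δ' : K.Simplex} (h : Δ ≠ Δ') :
    idemB F K δ Δ * idemB F K δ Δ' = 0 := by
  unfold idemB
  rw [← map_mul, ← map_mul, RingQuot.mkAlgHom_rel F (PathRel.orth Δ Δ' h), map_zero, map_zero]

lemma sum_idemB : ∑ Δ : K.Simplex, idemB F K δ Δ = 1 := by
  unfold idemB
  rw [← map_sum, ← map_sum, RingQuot.mkAlgHom_rel F PathRel.one, map_one, map_one]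

lemma genB_mul_idemB {Δ Δ' : K.Simplex} (h : K.HasArrow δ Δ Δ') :
    genB F K δ h * idemB F K δ Δ = genB F K δ h := by
  unfold idemB genB arrowElt
  rw [← map_mul, ← map_mul, RingQuot.mkAlgHom_rel F (PathRel.source ⟨(Δ, Δ'), h⟩)]

/-- The idempotents and the arrows generate `B(K, δ)`. -/
lemma algebraB_subalgebra_eq_top (S : Subalgebra F (AlgebraB F K δ))
    (h1 : ∀ Δ, idemB F K δ Δ ∈ S)
    (h2 : ∀ {Δ Δ' : K.Simplex} (h : K.HasArrow δ Δ Δ'), genB F K δ h ∈ S) : S = ⊤ := by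
  rw [eq_top_iff]
  rintro b -
  obtain ⟨b, rfl⟩ := RingQuot.mkAlgHom_surjective F _ b
  obtain ⟨b, rfl⟩ := RingQuot.mkAlgHom_surjective F _ b
  induction b using FreeAlgebra.induction with
  | grade0 r => simpa only [AlgHom.commutes] using S.algebraMap_mem r
  | grade1 x =>
    rcases x with Δ | ⟨⟨Δ, Δ'⟩, h⟩
    · exact h1 Δ
    · exact h2 h
  | mul a b ha hb => simpa only [map_mul] using S.mul_mem ha hb
  | add a b ha hb => simpa only [map_add] using S.add_mem ha hb

open scoped ModuleCat

variable (M N : ModuleCat.{u} (AlgebraB F K δ))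

lemma act_idemB_of_mem {Δ : K.Simplex} {m : M} (hm : m ∈ stalkSubmodule M Δ) :
    act M (idemB F K δ Δ) m = m := by
  obtain ⟨m, rfl⟩ := hm
  rw [← act_mul, idemB_mul_self]

lemma act_idemB_of_mem_ne {Δ Δ' : K.Simplex} (h : Δ ≠ Δ') {m : M}
    (hm : m ∈ stalkSubmodule M Δ') : act M (idemB F K δ Δ) m = 0 := by
  obtain ⟨m, rfl⟩ := hm
  rw [← act_mul, idemB_mul_of_ne h]
  exact zero_smul _ m

lemma sum_act_idemB (m : M) : ∑ Δ : K.Simplex, act M (idemB F K δ Δ) m = m := by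
  have : ∑ Δ : K.Simplex, act M (idemB F K δ Δ) m = (∑ Δ : K.Simplex, idemB F K δ Δ) • m :=
    (Finset.sum_smul ..).symm
  rw [this, sum_idemB, one_smul]

/-- The projection of `M` onto `e_Δ M`. -/
def stalkProj (Δ : K.Simplex) : M →ₗ[F] stalkSubmodule M Δ :=
  (act M (idemB F K δ Δ)).rangeRestrict

variable {M N}

lemma stalkProj_of_mem {Δ : K.Simplex} {m : M} (hm : m ∈ stalkSubmodule M Δ) :
    stalkProj M Δ m = ⟨m, hm⟩ :=
  Subtype.ext (act_idemB_of_mem M hm)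

lemma stalkProj_of_mem_ne {Δ Δ' : K.Simplex} (h : Δ ≠ Δ') {m : M}
    (hm : m ∈ stalkSubmodule M Δ') : stalkProj M Δ m = 0 :=
  Subtype.ext (act_idemB_of_mem_ne M h hm)

/-- The map `M → N` assembled from maps `e_Δ M → e_Δ N`. -/
def assembleLinear (α : ∀ Δ, stalkSubmodule M Δ →ₗ[F] stalkSubmodule N Δ) : M →ₗ[F] N :=
  ∑ Δ, (Submodule.subtype _).comp ((α Δ).comp (stalkProj M Δ))

lemma assembleLinear_of_mem (α : ∀ Δ, stalkSubmodule M Δ →ₗ[F] stalkSubmodule N Δ)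
    {Δ : K.Simplex} {m : M} (hm : m ∈ stalkSubmodule M Δ) :
    assembleLinear α m = (α Δ ⟨m, hm⟩).1 := by
  unfold assembleLinear
  rw [LinearMap.sum_apply, Finset.sum_eq_single Δ]
  · change (α Δ (stalkProj M Δ m)).1 = _
    rw [stalkProj_of_mem hm]
  · intro Δ' _ h
    change (α Δ' (stalkProj M Δ' m)).1 = _
    rw [stalkProj_of_mem_ne h hm, map_zero]
    rfl
  · simp

lemma act_idemB_assembleLinear (α : ∀ Δ, stalkSubmodule M Δ →ₗ[F] stalkSubmodule N Δ)
    (Δ : K.Simplex) (m : M) :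
    act N (idemB F K δ Δ) (assembleLinear α m) = (α Δ (stalkProj M Δ m)).1 := by
  unfold assembleLinear
  rw [LinearMap.sum_apply, map_sum, Finset.sum_eq_single Δ]
  · exact act_idemB_of_mem N (α Δ (stalkProj M Δ m)).2
  · intro Δ' _ h
    exact act_idemB_of_mem_ne N h.symm (α Δ' (stalkProj M Δ' m)).2
  · simp

lemma assembleLinear_act (α : ∀ Δ, stalkSubmodule M Δ →ₗ[F] stalkSubmodule N Δ)
    (hα : ∀ {Δ Δ' : K.Simplex} (h : K.HasArrow δ Δ Δ') (m : stalkSubmodule M Δ),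
      α Δ' (stalkRes M h m) = stalkRes N h (α Δ m)) (b : AlgebraB F K δ) (m : M) :
    assembleLinear α (act M b m) = act N b (assembleLinear α m) := by
  -- The elements whose action commutes with the assembled map form a subalgebra, so only the
  -- generators need checking.
  let S : Subalgebra F (AlgebraB F K δ) :=
    { carrier := {b | ∀ m, assembleLinear α (act M b m) = act N b (assembleLinear α m)}
      mul_mem' := fun {a b} ha hb m ↦ by
        rw [act_mul, ha, hb, act_mul]
      add_mem' := fun {a b} ha hb m ↦ by
        have h1 : act M (a + b) m = act M a m + act M b m := add_smul _ _ _
        have h2 : ∀ n, act N (a + b) n = act N a n + act N b n := fun n ↦ add_smul _ _ _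
        rw [h1, map_add, ha, hb, h2]
      algebraMap_mem' := fun r m ↦ by
        have h1 : act M (algebraMap F _ r) m = r • m := algebraMap_smul _ r m
        have h2 : ∀ n, act N (algebraMap F _ r) n = r • n := fun n ↦ algebraMap_smul _ r n
        rw [h1, h2, map_smul] }
  have : S = ⊤ := by
    refine algebraB_subalgebra_eq_top S (fun Δ m ↦ ?_) (fun {Δ Δ'} h m ↦ ?_)
    · rw [act_idemB_assembleLinear, assembleLinear_of_mem α (Δ := Δ) ⟨m, rfl⟩]
      rfl
    · rw [assembleLinear_of_mem α (act_genB_mem F K δ M h m)]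
      have h1 : (⟨act M (genB F K δ h) m, act_genB_mem F K δ M h m⟩ : stalkSubmodule M Δ') =
          stalkRes M h (stalkProj M Δ m) := Subtype.ext <| by
        change _ = act M (genB F K δ h) (act M (idemB F K δ Δ) m)
        rw [← act_mul, genB_mul_idemB]
      rw [h1, hα]
      change act N (genB F K δ h) (α Δ (stalkProj M Δ m)).1 = _
      rw [← act_idemB_assembleLinear, ← act_mul, genB_mul_idemB]
  exact (this ▸ Algebra.mem_top : b ∈ S) m

/-- Since `m = ∑ e_Δ m`, a homomorphism is determined by its restrictions to the subspaces `e_Δ M`.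
-/
instance : (K.moduleData F δ).Faithful where
  map_injective {M N f g} h := by
    ext m
    have key : ∀ Δ, f.hom (act M (idemB F K δ Δ) m) = g.hom (act M (idemB F K δ Δ) m) := fun Δ ↦
      congrArg Subtype.val
        (congr($(congrFun (congrArg LinearData.Hom.app h) Δ) (stalkProj M Δ m)) :
          stalkMap f Δ (stalkProj M Δ m) = stalkMap g Δ (stalkProj M Δ m))
    rw [← sum_act_idemB M m, map_sum, map_sum]
    exact Finset.sum_congr rfl fun Δ _ ↦ key Δ

instance : (K.moduleData F δ).Full where
  map_surjective {M N} α := by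
    let β : ∀ Δ, stalkSubmodule M Δ →ₗ[F] stalkSubmodule N Δ := fun Δ ↦ (α.app Δ).hom
    have hβ : ∀ {Δ Δ' : K.Simplex} (h : K.HasArrow δ Δ Δ') (m : stalkSubmodule M Δ),
      β Δ' (stalkRes M h m) = stalkRes N h (β Δ m) := fun h m ↦ congr($(α.comm h) m)
    refine ⟨ModuleCat.ofHom
      { toFun := assembleLinear β
        map_add' := map_add _
        map_smul' := assembleLinear_act β hβ }, ?_⟩
    refine LinearData.Hom.ext (funext fun Δ ↦ ModuleCat.hom_ext (LinearMap.ext fun m ↦ ?_))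
    exact Subtype.ext (assembleLinear_of_mem β m.2)

end Modules

/-! ### From linear algebra data back to modules -/

section TotalSpace

variable {F : Type u} [Field F] {V : Type u} [Fintype V] {K : AbstractSimplicialComplex V}
  {δ : ℕ → ℤ} (S : LinearData F K δ)

open Classical in
/-- The endomorphism of `∏ S(Δ)` given by a vertex or an arrow. -/
def generatorEnd : K.Simplex ⊕ K.Arrow δ → Module.End F (∀ Δ, S.stalk Δ)
  | Sum.inl Δ => (LinearMap.single F _ Δ).comp (LinearMap.proj Δ)
  | Sum.inr a => (LinearMap.single F _ a.1.2).comp ((S.res a.2).hom.comp (LinearMap.proj a.1.1))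

/-- The action of the quiver algebra on `∏ S(Δ)`. -/
def quiverRep : QuiverAlgebra F K δ →ₐ[F] Module.End F (∀ Δ, S.stalk Δ) :=
  RingQuot.liftAlgHom F ⟨FreeAlgebra.lift F (generatorEnd S), by
    classical
    rintro _ _ (Δ | ⟨Δ, Δ', h⟩ | _ | a | a)
    all_goals
      refine LinearMap.ext fun m ↦ funext fun Δ₀ ↦ ?_
    · simp [generatorEnd]
    · simp [generatorEnd, h]
    · simp [generatorEnd, Finset.sum_apply]
    · simp [generatorEnd]
    · simp [generatorEnd]⟩

lemma quiverRep_arrowElt {Δ Δ' : K.Simplex} (h : K.HasArrow δ Δ Δ') :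
    quiverRep S (arrowElt F K δ h) = generatorEnd S (Sum.inr ⟨(Δ, Δ'), h⟩) := by
  unfold quiverRep arrowElt
  rw [RingQuot.liftAlgHom_mkAlgHom_apply, FreeAlgebra.lift_ι_apply]

/-- The action of `B(K, δ)` on `∏ S(Δ)`. -/
def totalRep : AlgebraB F K δ →ₐ[F] Module.End F (∀ Δ, S.stalk Δ) :=
  RingQuot.liftAlgHom F ⟨quiverRep S, by
    classical
    rintro _ _ ⟨h₁, h₁', h₂, h₂'⟩
    rw [map_mul, map_mul, quiverRep_arrowElt, quiverRep_arrowElt, quiverRep_arrowElt,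
      quiverRep_arrowElt]
    refine LinearMap.ext fun m ↦ ?_
    have := congr($(S.equivalence h₁ h₁' h₂ h₂') (m _))
    simpa [generatorEnd] using congrArg (Pi.single _) this⟩

lemma totalRep_genB {Δ Δ' : K.Simplex} (h : K.HasArrow δ Δ Δ') :
    totalRep S (genB F K δ h) = generatorEnd S (Sum.inr ⟨(Δ, Δ'), h⟩) := by
  unfold totalRep genB
  rw [RingQuot.liftAlgHom_mkAlgHom_apply, quiverRep_arrowElt]

lemma totalRep_idemB (Δ : K.Simplex) :
    totalRep S (idemB F K δ Δ) = generatorEnd S (Sum.inl Δ) := by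
  unfold totalRep idemB
  rw [RingQuot.liftAlgHom_mkAlgHom_apply]
  unfold quiverRep
  rw [RingQuot.liftAlgHom_mkAlgHom_apply, FreeAlgebra.lift_ι_apply]

/-- The product `∏ S(Δ)`, carrying the action of `B(K, δ)`. -/
def TotalSpace : Type u := ∀ Δ, S.stalk Δ

instance : AddCommGroup (TotalSpace S) := inferInstanceAs (AddCommGroup (∀ Δ, S.stalk Δ))

instance : Module (AlgebraB F K δ) (TotalSpace S) :=
  Module.compHom (∀ Δ, S.stalk Δ) (totalRep S).toRingHom

/-- The module `∏ S(Δ)` over `B(K, δ)`. -/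
def totalModule : ModuleCat.{u} (AlgebraB F K δ) := ModuleCat.of _ (TotalSpace S)

open scoped ModuleCat

/-- The module `∏ S(Δ)`, as a vector space. -/
def totalEquiv : totalModule S ≃ₗ[F] (∀ Δ, S.stalk Δ) where
  toFun m := m
  invFun m := m
  left_inv _ := rfl
  right_inv _ := rfl
  map_add' _ _ := rfl
  -- On the module, `F` acts through `algebraMap`, which the algebra homomorphism `totalRep` sends
  -- to ordinary scalars.
  map_smul' r m :=
    LinearMap.congr_fun ((totalRep S).commutes r) (show ∀ Δ, S.stalk Δ from m)

lemma totalEquiv_act (b : AlgebraB F K δ) (m : totalModule S) :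
    totalEquiv S (act _ b m) = totalRep S b (totalEquiv S m) := rfl

open Classical in
lemma totalEquiv_act_idemB (Δ : K.Simplex) (m : totalModule S) :
    totalEquiv S (act _ (idemB F K δ Δ) m) =
      (Pi.single Δ (totalEquiv S m Δ) : ∀ Δ, S.stalk Δ) := by
  rw [totalEquiv_act, totalRep_idemB]
  rfl

open Classical in
lemma totalEquiv_act_genB {Δ Δ' : K.Simplex} (h : K.HasArrow δ Δ Δ') (m : totalModule S) :
    totalEquiv S (act _ (genB F K δ h) m) =
      (Pi.single Δ' (S.res h (totalEquiv S m Δ)) : ∀ Δ, S.stalk Δ) := by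
  rw [totalEquiv_act, totalRep_genB]
  rfl

/-- The stalks of the module `∏ S(Δ)`. -/
def totalStalkEquiv (Δ : K.Simplex) : stalkSubmodule (totalModule S) Δ ≃ₗ[F] S.stalk Δ :=
  LinearEquiv.ofBijective
    ((LinearMap.proj Δ).comp ((totalEquiv S).toLinearMap.comp (Submodule.subtype _))) <| by
    classical
    constructor
    · rintro ⟨m, hm⟩ ⟨n, hn⟩ h
      refine Subtype.ext ((totalEquiv S).injective ?_)
      change totalEquiv S m = totalEquiv S n
      rw [← act_idemB_of_mem _ hm, ← act_idemB_of_mem _ hn, totalEquiv_act_idemB,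
        totalEquiv_act_idemB]
      exact congrArg (Pi.single Δ) h
    · intro x
      refine ⟨⟨_, ⟨(totalEquiv S).symm (Pi.single Δ x), rfl⟩⟩, ?_⟩
      change totalEquiv S (act _ (idemB F K δ Δ) _) Δ = x
      rw [totalEquiv_act_idemB]
      simp

/-- The linear algebra data of the module `∏ S(Δ)` are `S`. -/
def moduleDataTotalIso : (K.moduleData F δ).obj (totalModule S) ≅ S where
  hom :=
    { app := fun Δ ↦ ModuleCat.ofHom (totalStalkEquiv S Δ).toLinearMap
      comm := fun {Δ Δ'} h ↦ by
        classical
        ext m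
        change totalEquiv S (act _ (genB F K δ h) m.1) Δ' = S.res h (totalEquiv S m.1 Δ)
        rw [totalEquiv_act_genB, Pi.single_eq_same] }
  inv :=
    { app := fun Δ ↦ ModuleCat.ofHom (totalStalkEquiv S Δ).symm.toLinearMap
      comm := fun {Δ Δ'} h ↦ by
        classical
        ext x
        obtain ⟨m, rfl⟩ := (totalStalkEquiv S Δ).surjective x
        change (totalStalkEquiv S Δ').symm (S.res h (totalStalkEquiv S Δ m)) =
          stalkRes _ h ((totalStalkEquiv S Δ).symm (totalStalkEquiv S Δ m))
        rw [LinearEquiv.symm_apply_apply, LinearEquiv.symm_apply_eq]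
        change S.res h (totalEquiv S m.1 Δ) = totalEquiv S (act _ (genB F K δ h) m.1) Δ'
        rw [totalEquiv_act_genB, Pi.single_eq_same] }
  hom_inv_id := LinearData.Hom.ext <| funext fun Δ ↦ ModuleCat.hom_ext <| LinearMap.ext fun m ↦
    (totalStalkEquiv S Δ).symm_apply_apply m
  inv_hom_id := LinearData.Hom.ext <| funext fun Δ ↦ ModuleCat.hom_ext <| LinearMap.ext fun m ↦
    (totalStalkEquiv S Δ).apply_symm_apply m

variable (F K δ)

/-- The functor from finite-dimensional modules to finite-dimensional linear algebra data. -/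
def finModuleData : K.CategoryR F δ ⥤ K.FinLinearData F δ :=
  ObjectProperty.lift _ (ObjectProperty.ι _ ⋙ K.moduleData F δ) fun M Δ ↦ by
    have : Module.Finite F M.obj := M.property
    exact Module.Finite.range (act M.obj (idemB F K δ Δ))

instance : (finModuleData F K δ).Faithful :=
  Functor.Faithful.of_comp_iso (H := ObjectProperty.ι _ ⋙ K.moduleData F δ)
    (ObjectProperty.liftCompιIso _ _ _)

instance : (finModuleData F K δ).Full :=
  Functor.Full.of_comp_faithful_iso (H := ObjectProperty.ι _ ⋙ K.moduleData F δ)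
    (ObjectProperty.liftCompιIso _ _ _)

instance : (finModuleData F K δ).EssSurj where
  mem_essImage S := by
    have : ∀ Δ, Module.Finite F (S.obj.stalk Δ) := S.property
    have h : Module.Finite F (totalModule S.obj) := Module.Finite.equiv (totalEquiv S.obj).symm
    exact ⟨⟨totalModule S.obj, h⟩,
      ⟨(ObjectProperty.fullyFaithfulι _).preimageIso (moduleDataTotalIso S.obj)⟩⟩

instance : (finModuleData F K δ).IsEquivalence where

end TotalSpace

end AbstractSimplicialComplex

end

noncomputable section

/-! ### Perversities -/

namespace IsPerversity

variable {δ : ℕ → ℤ} (hδ : IsPerversity δ)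
include hδ

lemma injective : Function.Injective δ := by
  intro j k h
  obtain ⟨a, -, ha⟩ := hδ.2 (max j k)
  exact ha.injOn (by simp) (by simp) h

/-- The values of `δ` on `{0, …, k}` form an interval containing `0 = δ 0` and `δ k`, hence
everything in between. -/
lemma exists_le_of_nonneg {k : ℕ} {i : ℤ} (h0 : 0 ≤ i) (hi : i ≤ δ k) : ∃ j ≤ k, δ j = i := by
  obtain ⟨a, ha, hb⟩ := hδ.2 k
  have hk := hb.mapsTo (show k ∈ Set.Icc 0 k by simp)
  obtain ⟨j, hj, rfl⟩ := hb.surjOn (show i ∈ Set.Icc a (a + k) from ⟨by omega, hi.trans hk.2⟩)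
  exact ⟨j, hj.2, rfl⟩

lemma exists_le_of_nonpos {k : ℕ} {i : ℤ} (h0 : i ≤ 0) (hi : δ k ≤ i) : ∃ j ≤ k, δ j = i := by
  obtain ⟨a, ha, hb⟩ := hδ.2 k
  have hk := hb.mapsTo (show k ∈ Set.Icc 0 k by simp)
  have h0' := hb.mapsTo (show 0 ∈ Set.Icc 0 k by simp)
  rw [hδ.1] at h0'
  obtain ⟨j, hj, rfl⟩ := hb.surjOn
    (show i ∈ Set.Icc a (a + k) from ⟨hk.1.trans hi, h0.trans h0'.2⟩)
  exact ⟨j, hj.2, rfl⟩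

/-- This and `le_of_nonpos` are how perversity is used: among nonnegative ranks, higher rank means
higher dimension, and among nonpositive ranks, lower rank means higher dimension. Incident simplices
are thereby ordered by inclusion according to rank. -/
lemma le_of_nonneg {j k : ℕ} (h0 : 0 ≤ δ j) (h : δ j ≤ δ k) : j ≤ k := by
  obtain ⟨i, hi, e⟩ := hδ.exists_le_of_nonneg h0 h
  exact hδ.injective e ▸ hi

lemma le_of_nonpos {j k : ℕ} (h0 : δ j ≤ 0) (h : δ k ≤ δ j) : j ≤ k := by
  obtain ⟨i, hi, e⟩ := hδ.exists_le_of_nonpos h0 h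
  exact hδ.injective e ▸ hi

lemma eq_zero_iff {j : ℕ} : δ j = 0 ↔ j = 0 :=
  ⟨fun h ↦ hδ.injective (h.trans hδ.1.symm), fun h ↦ h ▸ hδ.1⟩

lemma one_eq : δ 1 = 1 ∨ δ 1 = -1 := by
  obtain ⟨a, ha, hb⟩ := hδ.2 1
  have h0 := hb.mapsTo (show 0 ∈ Set.Icc 0 1 by simp)
  have h1 := hb.mapsTo (show 1 ∈ Set.Icc 0 1 by simp)
  have hne : δ 1 ≠ 0 := fun h ↦ one_ne_zero (hδ.eq_zero_iff.mp h)
  rw [hδ.1] at h0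
  simp only [Set.mem_Icc, Nat.cast_one] at h0 h1
  omega

end IsPerversity

namespace AbstractSimplicialComplex

variable {V : Type u} {K : AbstractSimplicialComplex V}

/-! ### The path order -/

section PathOrder

lemma Simplex.nonempty (Δ : K.Simplex) : Δ.1.Nonempty := (K.isRelLowerSet_faces Δ.2).1

lemma Simplex.card_eq (Δ : K.Simplex) : Δ.1.card = Δ.dim + 1 := by
  have := Δ.nonempty.card_pos
  unfold Simplex.dim
  omega

/-- The face of a simplex with prescribed vertices. -/
def Simplex.face (Δ : K.Simplex) (s : Finset V) (hs : s ⊆ Δ.1) (h : s.Nonempty) : K.Simplex :=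
  ⟨s, (K.isRelLowerSet_faces Δ.2).2 hs h⟩

/-- A vertex as a simplex. -/
def vertexSimplex (v : V) : K.Simplex := ⟨{v}, K.singleton_mem v⟩

lemma vertexSimplex_dim (v : V) : (vertexSimplex v : K.Simplex).dim = 0 := by
  simp [vertexSimplex, Simplex.dim]

lemma Simplex.eq_of_subset {Δ Δ' : K.Simplex} (h : Δ.1 ⊆ Δ'.1) (h' : Δ'.dim ≤ Δ.dim) : Δ = Δ' :=
  Subtype.ext <| Finset.eq_of_subset_of_card_le h <| by
    rw [Δ.card_eq, Δ'.card_eq]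
    omega

lemma Simplex.dim_mono {Δ Δ' : K.Simplex} (h : Δ.1 ⊆ Δ'.1) : Δ.dim ≤ Δ'.dim := by
  have := Finset.card_le_card h
  rw [Δ.card_eq, Δ'.card_eq] at this
  omega

lemma Simplex.Incident.symm {Δ Δ' : K.Simplex} (h : Δ.Incident Δ') : Δ'.Incident Δ := Or.symm h

lemma Simplex.Incident.subset {Δ Δ' : K.Simplex} (h : Δ.Incident Δ') (h' : Δ.dim ≤ Δ'.dim) :
    Δ.1 ⊆ Δ'.1 := by
  rcases h with h | h
  · exact h
  · rw [Simplex.eq_of_subset h h']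

lemma Simplex.eq_vertexSimplex {Δ : K.Simplex} (h : Δ.dim = 0) {v : V} (hv : v ∈ Δ.1) :
    Δ = vertexSimplex v :=
  (Simplex.eq_of_subset (by simpa [vertexSimplex] using hv) (by simp [h])).symm

/-- Between two simplices there are simplices of all intermediate dimensions. -/
lemma exists_between {s : Finset V} {Δ : K.Simplex} (h : s ⊆ Δ.1) {j : ℕ} (hs : s.card ≤ j + 1)
    (hj : j ≤ Δ.dim) : ∃ D : K.Simplex, s ⊆ D.1 ∧ D.1 ⊆ Δ.1 ∧ D.dim = j := by
  obtain ⟨t, h1, h2, h3⟩ := Finset.exists_subsuperset_card_eq h hs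
    (by rw [Δ.card_eq]; omega)
  exact ⟨Δ.face t h2 (by rw [← Finset.card_pos]; omega), h1, h2, by
    simp [Simplex.dim, Simplex.face, h3]⟩

variable {δ : ℕ → ℤ} (hδ : IsPerversity δ)

lemma pathLE_refl (Δ : K.Simplex) : K.PathLE δ Δ Δ := Relation.ReflTransGen.refl

lemma PathLE.trans {Δ Δ' Δ'' : K.Simplex} (h : K.PathLE δ Δ Δ') (h' : K.PathLE δ Δ' Δ'') :
    K.PathLE δ Δ Δ'' :=
  Relation.ReflTransGen.trans h h'

lemma PathLE.rank_le {Δ Δ' : K.Simplex} (h : K.PathLE δ Δ Δ') : δ Δ'.dim ≤ δ Δ.dim := by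
  induction h with
  | refl => rfl
  | tail _ h ih =>
    have := h.1
    omega

lemma PathLE.eq_of_rank_eq {Δ Δ' : K.Simplex} (h : K.PathLE δ Δ Δ')
    (hr : δ Δ.dim = δ Δ'.dim) : Δ = Δ' := by
  rcases Relation.ReflTransGen.cases_head h with h | ⟨D, h1, h2⟩
  · exact h
  · have := h1.1
    have := PathLE.rank_le h2
    omega

include hδ

lemma HasArrow.subset_of_nonneg {Δ Δ' : K.Simplex} (h : K.HasArrow δ Δ Δ') (h0 : 0 ≤ δ Δ'.dim) :
    Δ'.1 ⊆ Δ.1 :=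
  h.2.symm.subset (hδ.le_of_nonneg h0 (by have := h.1; omega))

lemma HasArrow.subset_of_nonpos {Δ Δ' : K.Simplex} (h : K.HasArrow δ Δ Δ') (h0 : δ Δ.dim ≤ 0) :
    Δ.1 ⊆ Δ'.1 :=
  h.2.subset (hδ.le_of_nonpos h0 (by have := h.1; omega))

/-- The rank `δ Δ.dim - 1` is attained in a dimension between those of `B` and `Δ`, and a simplex of
that dimension fits between them. Iteration produces the paths of `pathLE_of_subset_of_nonneg`. -/
lemma exists_arrow_down {Δ B : K.Simplex} (hB : B.1 ⊆ Δ.1) (h0 : 0 ≤ δ B.dim)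
    (h : δ B.dim < δ Δ.dim) : ∃ D, K.HasArrow δ Δ D ∧ B.1 ⊆ D.1 ∧ D.1 ⊆ Δ.1 := by
  obtain ⟨j, hj, e⟩ := hδ.exists_le_of_nonneg (k := Δ.dim) (i := δ Δ.dim - 1)
    (by omega) (by omega)
  have hBj : B.dim ≤ j := hδ.le_of_nonneg h0 (by omega)
  obtain ⟨D, h1, h2, h3⟩ := exists_between hB (j := j) (by rw [B.card_eq]; omega) hj
  exact ⟨D, ⟨by rw [h3]; omega, Or.inr h2⟩, h1, h2⟩

lemma exists_arrow_up {Δ B : K.Simplex} (hB : Δ.1 ⊆ B.1) (h0 : δ Δ.dim ≤ 0)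
    (h : δ B.dim < δ Δ.dim) : ∃ D, K.HasArrow δ Δ D ∧ Δ.1 ⊆ D.1 ∧ D.1 ⊆ B.1 := by
  obtain ⟨j, hj, e⟩ := hδ.exists_le_of_nonpos (k := B.dim) (i := δ Δ.dim - 1)
    (by omega) (by omega)
  have hBj : Δ.dim ≤ j := hδ.le_of_nonpos h0 (by omega)
  obtain ⟨D, h1, h2, h3⟩ := exists_between hB (j := j) (by rw [Δ.card_eq]; omega) hj
  exact ⟨D, ⟨by rw [h3]; omega, Or.inl h1⟩, h1, h2⟩

lemma pathLE_of_subset_of_nonneg {Δ Δ' : K.Simplex} (h : Δ'.1 ⊆ Δ.1) (h0 : 0 ≤ δ Δ'.dim)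
    (hle : δ Δ'.dim ≤ δ Δ.dim) : K.PathLE δ Δ Δ' := by
  obtain ⟨n, hn⟩ : ∃ n : ℕ, δ Δ.dim = δ Δ'.dim + n := ⟨(δ Δ.dim - δ Δ'.dim).toNat, by omega⟩
  induction n generalizing Δ with
  | zero =>
    rw [Simplex.eq_of_subset h (hδ.injective (by omega : δ Δ.dim = δ Δ'.dim)).le]
    exact Relation.ReflTransGen.refl
  | succ n ih =>
    obtain ⟨D, h1, h2, h3⟩ := exists_arrow_down hδ h h0 (by omega)
    have := h1.1
    exact Relation.ReflTransGen.head h1 (ih h2 (by omega) (by omega))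

lemma pathLE_of_subset_of_nonpos {Δ Δ' : K.Simplex} (h : Δ.1 ⊆ Δ'.1) (h0 : δ Δ.dim ≤ 0)
    (hle : δ Δ'.dim ≤ δ Δ.dim) : K.PathLE δ Δ Δ' := by
  obtain ⟨n, hn⟩ : ∃ n : ℕ, δ Δ.dim = δ Δ'.dim + n := ⟨(δ Δ.dim - δ Δ'.dim).toNat, by omega⟩
  induction n generalizing Δ with
  | zero =>
    rw [Simplex.eq_of_subset h (hδ.injective (by omega : δ Δ.dim = δ Δ'.dim)).ge]
    exact Relation.ReflTransGen.refl
  | succ n ih =>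
    obtain ⟨D, h1, h2, h3⟩ := exists_arrow_up hδ h h0 (by omega)
    have := h1.1
    exact Relation.ReflTransGen.head h1 (ih h3 (by omega) (by omega) (by omega))

/-- A path between opposite signs of rank can pass through the common vertex `v`, which has rank 0.
-/
lemma pathLE_of_mem {Δ Δ' : K.Simplex} {v : V} (h : v ∈ Δ.1) (h' : v ∈ Δ'.1)
    (h0 : 0 ≤ δ Δ.dim) (h0' : δ Δ'.dim ≤ 0) : K.PathLE δ Δ Δ' := by
  have hv : δ (vertexSimplex v : K.Simplex).dim = 0 := by rw [vertexSimplex_dim, hδ.1]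
  refine Relation.ReflTransGen.trans (b := vertexSimplex v)
    (pathLE_of_subset_of_nonneg hδ (by simpa [vertexSimplex] using h) hv.ge (by omega))
    (pathLE_of_subset_of_nonpos hδ (by simpa [vertexSimplex] using h') hv.le (by omega))

/-- The three kinds of comparable pairs in the path order. -/
lemma PathLE.cases {Δ Δ' : K.Simplex} (h : K.PathLE δ Δ Δ') :
    (0 ≤ δ Δ'.dim ∧ Δ'.1 ⊆ Δ.1) ∨ (δ Δ.dim ≤ 0 ∧ Δ.1 ⊆ Δ'.1) ∨
      (0 ≤ δ Δ.dim ∧ δ Δ'.dim ≤ 0 ∧ ∃ v ∈ Δ.1, v ∈ Δ'.1) := by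
  induction h using Relation.ReflTransGen.head_induction_on with
  | refl =>
    rcases le_total 0 (δ Δ'.dim) with h | h
    · exact Or.inl ⟨h, subset_rfl⟩
    · exact Or.inr (Or.inl ⟨h, subset_rfl⟩)
  | head h h' ih =>
    rename_i D D₁
    have hr := h.1
    have hr' := PathLE.rank_le h'
    rcases ih with ⟨h0, hs⟩ | ⟨h0, hs⟩ | ⟨h0, h0', v, hv, hv'⟩
    · exact Or.inl ⟨h0, hs.trans (h.subset_of_nonneg hδ (h0.trans hr'))⟩
    · by_cases hD : δ D.dim ≤ 0
      · exact Or.inr (Or.inl ⟨hD, (h.subset_of_nonpos hδ hD).trans hs⟩)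
      -- Here `D` has positive rank while `D₁` has rank at most 0, so `D₁` has rank exactly 0 and
      -- lies in both `D` and `Δ'`.
      · obtain ⟨v, hv⟩ := D₁.nonempty
        exact Or.inr (Or.inr ⟨by omega, by omega, v,
          h.subset_of_nonneg hδ (by omega) hv, hs hv⟩)
    · exact Or.inr (Or.inr ⟨by omega, h0', v, h.subset_of_nonneg hδ h0 hv, hv'⟩)

/-- Incident simplices are comparable in the path order. -/
lemma pathLE_of_incident {Δ Δ' : K.Simplex} (h : Δ.Incident Δ') (hle : δ Δ'.dim ≤ δ Δ.dim) :
    K.PathLE δ Δ Δ' := by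
  by_cases h0 : 0 ≤ δ Δ'.dim
  · exact pathLE_of_subset_of_nonneg hδ (h.symm.subset (hδ.le_of_nonneg h0 hle)) h0 hle
  by_cases h1 : δ Δ.dim ≤ 0
  · exact pathLE_of_subset_of_nonpos hδ (h.subset (hδ.le_of_nonpos h1 hle)) h1 hle
  rcases h with h | h
  · obtain ⟨v, hv⟩ := Δ.nonempty
    exact pathLE_of_mem hδ hv (h hv) (by omega) (by omega)
  · obtain ⟨v, hv⟩ := Δ'.nonempty
    exact pathLE_of_mem hδ (h hv) hv (by omega) (by omega)

/-- If two paths of length two with the same ends have different middle vertices, then the ends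
and the middle vertices are incident. -/
lemma incident_of_two_paths {Δ' Δ₁ Δ₂ Δ'' : K.Simplex} (h₁ : K.HasArrow δ Δ' Δ₁)
    (h₁' : K.HasArrow δ Δ₁ Δ'') (h₂ : K.HasArrow δ Δ' Δ₂) (h₂' : K.HasArrow δ Δ₂ Δ'')
    (hne : Δ₁ ≠ Δ₂) : Δ'.Incident Δ'' := by
  have e1 := h₁.1
  have e1' := h₁'.1
  have e2 := h₂.1
  by_cases h0 : 0 ≤ δ Δ''.dim
  · exact Or.inr ((h₁'.subset_of_nonneg hδ h0).trans (h₁.subset_of_nonneg hδ (by omega)))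
  by_cases h1 : δ Δ'.dim ≤ 0
  · exact Or.inl ((h₁.subset_of_nonpos hδ h1).trans (h₁'.subset_of_nonpos hδ (by omega)))
  -- In the remaining case the ends have ranks `1` and `-1`, so both middle simplices have rank 0
  -- and are vertices.
  have d1 : Δ₁.dim = 0 := hδ.eq_zero_iff.mp (by omega)
  have d2 : Δ₂.dim = 0 := hδ.eq_zero_iff.mp (by omega)
  obtain ⟨v, hv⟩ := Δ₁.nonempty
  obtain ⟨w, hw⟩ := Δ₂.nonempty
  have hvw : v ≠ w := fun h ↦ hne
    ((Simplex.eq_vertexSimplex d1 hv).trans (h ▸ (Simplex.eq_vertexSimplex d2 hw).symm))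
  have hv' := h₁.subset_of_nonneg hδ (by omega) hv
  have hw' := h₂.subset_of_nonneg hδ (by omega) hw
  have hv'' := h₁'.subset_of_nonpos hδ (by omega) hv
  have hw'' := h₂'.subset_of_nonpos hδ (by omega) hw
  classical
  have key : ∀ {D D' : K.Simplex}, v ∈ D.1 → w ∈ D.1 → v ∈ D'.1 → w ∈ D'.1 → D.dim = 1 →
      D.1 ⊆ D'.1 := by
    intro D D' h1 h2 h3 h4 h5
    have : ({v, w} : Finset V) = D.1 := by
      refine Finset.eq_of_subset_of_card_le (by simp [Finset.insert_subset_iff, h1, h2]) ?_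
      rw [D.card_eq, h5, Finset.card_pair hvw]
    rw [← this]
    simp [Finset.insert_subset_iff, h3, h4]
  -- Edges have rank `1` or `-1`, so one of the two ends is the edge `{v, w}`, which is a face of
  -- the other.
  rcases hδ.one_eq with h | h
  · exact Or.inl (key hv' hw' hv'' hw'' (hδ.injective (by omega)))
  · exact Or.inr (key hv'' hw'' hv' hw' (hδ.injective (by omega)))

end PathOrder

end AbstractSimplicialComplex

end

noncomputable section

namespace AbstractSimplicialComplex

variable {V : Type u} {K : AbstractSimplicialComplex V}

/-! ### Linear algebra data as functors on the path order -/

section PathIndependence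

variable {δ : ℕ → ℤ} (hδ : IsPerversity δ)

/-- Two first steps `D`, `D'` of paths from `Δ` to `Δ'` which can be followed by a common
second step. -/
def Linked (δ : ℕ → ℤ) (Δ Δ' D D' : K.Simplex) : Prop :=
  K.HasArrow δ Δ D ∧ K.HasArrow δ Δ D' ∧
    ∃ E, K.HasArrow δ D E ∧ K.HasArrow δ D' E ∧ K.PathLE δ E Δ'

open Classical in
/-- Replacing a vertex of `D₁` by a vertex of `D₂` reduces the difference. -/
lemma card_exchange_sdiff_lt {s t : Finset V} {a b : V} (ha : a ∈ s \ t) (hb : b ∈ t \ s) :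
    (insert b (s.erase a) \ t).card < (s \ t).card := by
  refine Finset.card_lt_card ((Finset.ssubset_iff_of_subset ?_).mpr ⟨a, ha, ?_⟩)
  · intro x hx
    simp only [Finset.mem_sdiff, Finset.mem_insert, Finset.mem_erase] at hx hb ⊢
    rcases hx with ⟨rfl | hx, hx'⟩
    · exact absurd hb.1 hx'
    · exact ⟨hx.2, hx'⟩
  · simp only [Finset.mem_sdiff, Finset.mem_insert, Finset.mem_erase] at ha hb ⊢
    rintro ⟨rfl | h, -⟩
    · exact ha.2 hb.1
    · exact h.1 rfl

open Classical in
lemma card_exchange {s t : Finset V} {a b : V} (ha : a ∈ s \ t) (hb : b ∈ t \ s) :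
    (insert b (s.erase a)).card = s.card := by
  simp only [Finset.mem_sdiff] at ha hb
  rw [Finset.card_insert_of_notMem (by simp [hb.2]), Finset.card_erase_add_one ha.1]

include hδ

-- Exchange argument: replacing a vertex of `D₁` outside `D₂` by one of `D₂` outside `D₁` gives a
-- first step `D` closer to `D₂` that still contains `B`. A common second step for `D₁` and `D` is
-- found between `B` and `D₁` without the removed vertex.
open Classical in
lemma linked_chain_down {Δ Δ' B D₁ D₂ : K.Simplex} (h₁ : K.HasArrow δ Δ D₁)
    (h₂ : K.HasArrow δ Δ D₂) (hB₁ : B.1 ⊆ D₁.1) (hB₂ : B.1 ⊆ D₂.1) (h0 : 0 ≤ δ B.dim)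
    (hlt : δ B.dim < δ D₁.dim) (hB : K.PathLE δ B Δ') :
    Relation.ReflTransGen (Linked δ Δ Δ') D₁ D₂ := by
  induction hn : (D₁.1 \ D₂.1).card using Nat.strong_induction_on generalizing D₁ with
  | _ n ih =>
  have e1 := h₁.1
  have e2 := h₂.1
  have hdim : D₁.dim = D₂.dim := hδ.injective (by omega)
  by_cases hsub : D₁.1 ⊆ D₂.1
  · rw [Simplex.eq_of_subset hsub hdim.ge]
  have hsub' : ¬ D₂.1 ⊆ D₁.1 := fun h ↦ hsub (by rw [Simplex.eq_of_subset h hdim.le])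
  obtain ⟨a, ha1, ha2⟩ := Finset.not_subset.mp hsub
  obtain ⟨b, hb1, hb2⟩ := Finset.not_subset.mp hsub'
  have ha : a ∈ D₁.1 \ D₂.1 := Finset.mem_sdiff.mpr ⟨ha1, ha2⟩
  have hb : b ∈ D₂.1 \ D₁.1 := Finset.mem_sdiff.mpr ⟨hb1, hb2⟩
  have hΔ1 := h₁.subset_of_nonneg hδ (by omega)
  have hΔ2 := h₂.subset_of_nonneg hδ (by omega)
  have hDs : insert b (D₁.1.erase a) ⊆ Δ.1 :=
    Finset.insert_subset (hΔ2 hb1) ((Finset.erase_subset _ _).trans hΔ1)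
  obtain ⟨D, hD⟩ : ∃ D : K.Simplex, D.1 = insert b (D₁.1.erase a) :=
    ⟨Δ.face _ hDs (Finset.insert_nonempty _ _), rfl⟩
  have hDdim : D.dim = D₁.dim := by
    have := card_exchange ha hb
    rw [← hD, D.card_eq, D₁.card_eq] at this
    omega
  have hBe : B.1 ⊆ D₁.1.erase a := fun x hx ↦
    Finset.mem_erase.mpr ⟨fun h ↦ ha2 (h ▸ hB₂ hx), hB₁ hx⟩
  have hΔD : K.HasArrow δ Δ D := ⟨by rw [hDdim]; exact e1, Or.inr (hD ▸ hDs)⟩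
  have hBD : B.1 ⊆ D.1 := hD ▸ hBe.trans (Finset.subset_insert _ _)
  refine Relation.ReflTransGen.head (b := D) ⟨h₁, hΔD, ?_⟩ ?_
  -- A second step has dimension `j < D₁.dim`, so its `j + 1` vertices can be chosen in `D₁.1.erase
  -- a`, which has `D₁.dim` elements and contains `B`.
  · obtain ⟨j, hj, e⟩ := hδ.exists_le_of_nonneg (k := D₁.dim) (i := δ D₁.dim - 1)
      (by omega) (by omega)
    have hjlt : j < D₁.dim := lt_of_le_of_ne hj fun h ↦ by rw [h] at e; omega
    have hBj : B.dim ≤ j := hδ.le_of_nonneg h0 (by omega)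
    have hce := Finset.card_erase_of_mem ha1
    rw [D₁.card_eq] at hce
    obtain ⟨t, h1, h2, h3⟩ := Finset.exists_subsuperset_card_eq hBe (n := j + 1)
      (by rw [B.card_eq]; omega) (by omega)
    obtain ⟨E, hE⟩ : ∃ E : K.Simplex, E.1 = t :=
      ⟨D₁.face t (h2.trans (Finset.erase_subset _ _)) (B.nonempty.mono h1), rfl⟩
    have hEdim : E.dim = j := by
      rw [← hE, E.card_eq] at h3
      omega
    have hED : E.1 ⊆ D.1 := hE ▸ hD ▸ h2.trans (Finset.subset_insert _ _)
    exact ⟨E, ⟨by rw [hEdim]; omega, Or.inr (hE ▸ h2.trans (Finset.erase_subset _ _))⟩,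
      ⟨by rw [hEdim, hDdim]; omega, Or.inr hED⟩,
      (pathLE_of_subset_of_nonneg hδ (hE ▸ h1) h0 (by rw [hEdim]; omega)).trans hB⟩
  · refine ih _ ?_ hΔD hBD (by rw [hDdim]; exact hlt) rfl
    rw [← hn, hD]
    exact card_exchange_sdiff_lt ha hb

-- The same exchange for nonpositive ranks, where arrows enlarge simplices: the common second step
-- now contains `D₁` together with the new vertex and stays inside `Δ'`.
open Classical in
lemma linked_chain_up {Δ Δ' D₁ D₂ : K.Simplex} (h₁ : K.HasArrow δ Δ D₁)
    (h₂ : K.HasArrow δ Δ D₂) (hB₁ : D₁.1 ⊆ Δ'.1) (hB₂ : D₂.1 ⊆ Δ'.1) (h0 : δ Δ.dim ≤ 0)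
    (hlt : δ Δ'.dim < δ D₁.dim) :
    Relation.ReflTransGen (Linked δ Δ Δ') D₁ D₂ := by
  induction hn : (D₁.1 \ D₂.1).card using Nat.strong_induction_on generalizing D₁ with
  | _ n ih =>
  have e1 := h₁.1
  have e2 := h₂.1
  have hdim : D₁.dim = D₂.dim := hδ.injective (by omega)
  by_cases hsub : D₁.1 ⊆ D₂.1
  · rw [Simplex.eq_of_subset hsub hdim.ge]
  have hsub' : ¬ D₂.1 ⊆ D₁.1 := fun h ↦ hsub (by rw [Simplex.eq_of_subset h hdim.le])
  obtain ⟨a, ha1, ha2⟩ := Finset.not_subset.mp hsub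
  obtain ⟨b, hb1, hb2⟩ := Finset.not_subset.mp hsub'
  have ha : a ∈ D₁.1 \ D₂.1 := Finset.mem_sdiff.mpr ⟨ha1, ha2⟩
  have hb : b ∈ D₂.1 \ D₁.1 := Finset.mem_sdiff.mpr ⟨hb1, hb2⟩
  have hΔ1 := h₁.subset_of_nonpos hδ h0
  have hΔ2 := h₂.subset_of_nonpos hδ h0
  have hDs : insert b (D₁.1.erase a) ⊆ Δ'.1 :=
    Finset.insert_subset (hB₂ hb1) ((Finset.erase_subset _ _).trans hB₁)
  obtain ⟨D, hD⟩ : ∃ D : K.Simplex, D.1 = insert b (D₁.1.erase a) :=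
    ⟨Δ'.face _ hDs (Finset.insert_nonempty _ _), rfl⟩
  have hDdim : D.dim = D₁.dim := by
    have := card_exchange ha hb
    rw [← hD, D.card_eq, D₁.card_eq] at this
    omega
  have hΔDs : Δ.1 ⊆ D.1 := fun x hx ↦ hD ▸ Finset.mem_insert_of_mem
    (Finset.mem_erase.mpr ⟨fun h ↦ ha2 (h ▸ hΔ2 hx), hΔ1 hx⟩)
  have hΔD : K.HasArrow δ Δ D := ⟨by rw [hDdim]; exact e1, Or.inl hΔDs⟩
  refine Relation.ReflTransGen.head (b := D) ⟨h₁, hΔD, ?_⟩ ?_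
  -- A second step has dimension `j > D₁.dim`, which leaves room for the `D₁.dim + 2` vertices of
  -- `insert b D₁.1`.
  · obtain ⟨j, hj, e⟩ := hδ.exists_le_of_nonpos (k := Δ'.dim) (i := δ D₁.dim - 1)
      (by omega) (by omega)
    have hjle : D₁.dim ≤ j := hδ.le_of_nonpos (by omega) (by omega)
    have hjlt : D₁.dim < j := lt_of_le_of_ne hjle fun h ↦ by rw [← h] at e; omega
    obtain ⟨E, hE1, hE2, hE3⟩ := exists_between (Finset.insert_subset (hB₂ hb1) hB₁) (j := j)
      (by rw [Finset.card_insert_of_notMem hb2, D₁.card_eq]; omega) hj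
    have hD₁E : D₁.1 ⊆ E.1 := (Finset.subset_insert _ _).trans hE1
    have hDE : D.1 ⊆ E.1 := hD ▸ (Finset.insert_subset_insert _ (Finset.erase_subset _ _)).trans hE1
    exact ⟨E, ⟨by rw [hE3]; omega, Or.inl hD₁E⟩, ⟨by rw [hE3, hDdim]; omega, Or.inl hDE⟩,
      pathLE_of_subset_of_nonpos hδ hE2 (by rw [hE3]; omega) (by rw [hE3]; omega)⟩
  · refine ih _ ?_ hΔD (hD ▸ hDs) (by rw [hDdim]; exact hlt) rfl
    rw [← hn, hD]
    exact card_exchange_sdiff_lt ha hb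

/-- Any two first steps of paths from `Δ` to `Δ'` are linked by a chain. -/
lemma linked_chain {Δ Δ' D₁ D₂ : K.Simplex} (h₁ : K.HasArrow δ Δ D₁) (h₂ : K.HasArrow δ Δ D₂)
    (h₁' : K.PathLE δ D₁ Δ') (h₂' : K.PathLE δ D₂ Δ') :
    Relation.ReflTransGen (Linked δ Δ Δ') D₁ D₂ := by
  classical
  have e1 := h₁.1
  have e2 := h₂.1
  have r1 := h₁'.rank_le
  have r2 := h₂'.rank_le
  have hv : ∀ v, δ (vertexSimplex v : K.Simplex).dim = 0 := fun v ↦ by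
    rw [vertexSimplex_dim, hδ.1]
  rcases eq_or_lt_of_le r1 with hr | hlt
  · rw [h₁'.eq_of_rank_eq hr.symm, h₂'.eq_of_rank_eq (by omega)]
  by_cases h0 : δ Δ.dim ≤ 0
  · refine linked_chain_up hδ h₁ h₂ ?_ ?_ h0 hlt
    · rcases h₁'.cases hδ with h | h | h
      · omega
      · exact h.2
      · omega
    · rcases h₂'.cases hδ with h | h | h
      · omega
      · exact h.2
      · omega
  by_cases h0' : 0 ≤ δ Δ'.dim
  · refine linked_chain_down hδ h₁ h₂ (B := Δ') ?_ ?_ h0' hlt Relation.ReflTransGen.refl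
    · rcases h₁'.cases hδ with h | h | h
      · exact h.2
      · omega
      · obtain ⟨v, h1, h2⟩ := h.2.2
        have : Δ' = vertexSimplex v :=
          Simplex.eq_vertexSimplex (hδ.eq_zero_iff.mp (by omega)) h2
        simpa [this, vertexSimplex] using h1
    · rcases h₂'.cases hδ with h | h | h
      · exact h.2
      · omega
      · obtain ⟨v, h1, h2⟩ := h.2.2
        have : Δ' = vertexSimplex v :=
          Simplex.eq_vertexSimplex (hδ.eq_zero_iff.mp (by omega)) h2
        simpa [this, vertexSimplex] using h1
  -- From here on `Δ` has positive and `Δ'` negative rank, and each of `D₁`, `D₂` shares a vertex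
  -- with `Δ'`.
  have common : ∀ {D : K.Simplex}, 0 ≤ δ D.dim → K.PathLE δ D Δ' → ∃ v ∈ D.1, v ∈ Δ'.1 := by
    intro D hD h
    rcases h.cases hδ with h | h | h
    · omega
    · obtain ⟨v, hv⟩ := D.nonempty
      exact ⟨v, hv, h.2 hv⟩
    · exact h.2.2
  obtain ⟨v, hv1, hv2⟩ := common (by omega) h₁'
  obtain ⟨w, hw1, hw2⟩ := common (by omega) h₂'
  have hvΔ' : K.PathLE δ (vertexSimplex v) Δ' := pathLE_of_subset_of_nonpos hδ
    (by simpa [vertexSimplex] using hv2) (hv v).le (by rw [hv]; omega)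
  have hwΔ' : K.PathLE δ (vertexSimplex w) Δ' := pathLE_of_subset_of_nonpos hδ
    (by simpa [vertexSimplex] using hw2) (hv w).le (by rw [hv]; omega)
  by_cases hΔ1 : δ Δ.dim = 1
  · have d1 : D₁.dim = 0 := hδ.eq_zero_iff.mp (by omega)
    have d2 : D₂.dim = 0 := hδ.eq_zero_iff.mp (by omega)
    have hD1 := Simplex.eq_vertexSimplex d1 hv1
    have hD2 := Simplex.eq_vertexSimplex d2 hw1
    -- Both first steps are vertices of `Δ'`; a face of `Δ'` of rank `-1` has positive dimension and
    -- can be chosen to contain both.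
    refine Relation.ReflTransGen.single ⟨h₁, h₂, ?_⟩
    obtain ⟨j, hj, e⟩ := hδ.exists_le_of_nonpos (k := Δ'.dim) (i := -1) (by omega) (by omega)
    have hj0 : j ≠ 0 := fun h ↦ by
      rw [h, hδ.1] at e
      omega
    obtain ⟨E, hE1, hE2, hE3⟩ := exists_between (s := {v, w}) (Δ := Δ') (j := j)
      (by simp [Finset.insert_subset_iff, hv2, hw2])
      (Finset.card_le_two.trans (by omega)) hj
    simp only [Finset.insert_subset_iff, Finset.singleton_subset_iff] at hE1
    refine ⟨E, ⟨by rw [hE3]; omega, Or.inl ?_⟩, ⟨by rw [hE3]; omega, Or.inl ?_⟩,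
      pathLE_of_subset_of_nonpos hδ hE2 (by rw [hE3]; omega) (by rw [hE3]; omega)⟩
    · rw [hD1]
      simpa [vertexSimplex] using hE1.1
    · rw [hD2]
      simpa [vertexSimplex] using hE1.2
  · have hD₁0 : D₁.dim ≠ 0 := fun h ↦ by
      have := hδ.eq_zero_iff.mpr h
      omega
    have s1 := h₁.subset_of_nonneg hδ (by omega)
    have s2 := h₂.subset_of_nonneg hδ (by omega)
    -- An intermediate first step `D` containing both `v` and `w` splits the chain into one over the
    -- vertex `v` and one over the vertex `w`. It exists because first steps here have positive
    -- dimension.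
    obtain ⟨D, hD1, hD2, hD3⟩ := exists_between (s := {v, w}) (Δ := Δ) (j := D₁.dim)
      (by simp [Finset.insert_subset_iff, s1 hv1, s2 hw1])
      (Finset.card_le_two.trans (by omega)) (Simplex.dim_mono s1)
    simp only [Finset.insert_subset_iff, Finset.singleton_subset_iff] at hD1
    have hΔD : K.HasArrow δ Δ D := ⟨by rw [hD3]; exact e1, Or.inr hD2⟩
    refine (linked_chain_down hδ h₁ hΔD (B := vertexSimplex v) ?_ ?_ (hv v).ge ?_ hvΔ').trans
      (linked_chain_down hδ hΔD h₂ (B := vertexSimplex w) ?_ ?_ (hv w).ge ?_ hwΔ')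
    · simpa [vertexSimplex] using hv1
    · simpa [vertexSimplex] using hD1.1
    · rw [hv]
      omega
    · simpa [vertexSimplex] using hD1.2
    · simpa [vertexSimplex] using hw1
    · rw [hv, hD3]
      omega

end PathIndependence

/-! ### Path independence of composites -/

namespace LinearData

variable {F : Type u} [Field F] {δ : ℕ → ℤ}

/-- The composites of the restriction maps along paths. -/
inductive IsComposite (S : LinearData F K δ) :
    ∀ Δ Δ' : K.Simplex, (S.stalk Δ ⟶ S.stalk Δ') → Prop
  | refl (Δ : K.Simplex) : IsComposite S Δ Δ (𝟙 _)
  | head {Δ D Δ' : K.Simplex} (h : K.HasArrow δ Δ D) (f : S.stalk D ⟶ S.stalk Δ') :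
      IsComposite S D Δ' f → IsComposite S Δ Δ' (S.res h ≫ f)

variable {S T : LinearData F K δ}

lemma IsComposite.pathLE {Δ Δ' : K.Simplex} {f : S.stalk Δ ⟶ S.stalk Δ'}
    (hf : S.IsComposite Δ Δ' f) : K.PathLE δ Δ Δ' := by
  induction hf with
  | refl => exact Relation.ReflTransGen.refl
  | head h f _ ih => exact Relation.ReflTransGen.head h ih

lemma IsComposite.trans {Δ Δ' Δ'' : K.Simplex} {f : S.stalk Δ ⟶ S.stalk Δ'}
    {g : S.stalk Δ' ⟶ S.stalk Δ''} (hf : S.IsComposite Δ Δ' f) (hg : S.IsComposite Δ' Δ'' g) :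
    S.IsComposite Δ Δ'' (f ≫ g) := by
  induction hf with
  | refl => simpa using hg
  | head h f _ ih =>
    rw [Category.assoc]
    exact .head h _ (ih hg)

lemma exists_isComposite (S : LinearData F K δ) {Δ Δ' : K.Simplex} (h : K.PathLE δ Δ Δ') :
    ∃ f, S.IsComposite Δ Δ' f := by
  induction h using Relation.ReflTransGen.head_induction_on with
  | refl => exact ⟨_, .refl _⟩
  | head h _ ih =>
    obtain ⟨f, hf⟩ := ih
    exact ⟨_, .head h f hf⟩

/-- The composite of the restriction maps depends only on the ends of the path. -/
lemma IsComposite.unique (hδ : IsPerversity δ) {Δ Δ' : K.Simplex} {f g : S.stalk Δ ⟶ S.stalk Δ'}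
    (hf : S.IsComposite Δ Δ' f) (hg : S.IsComposite Δ Δ' g) : f = g := by
  obtain ⟨n, hn⟩ : ∃ n : ℕ, δ Δ.dim - δ Δ'.dim = n :=
    ⟨(δ Δ.dim - δ Δ'.dim).toNat, by have := hf.pathLE.rank_le; omega⟩
  induction n using Nat.strong_induction_on generalizing Δ with
  | _ n ih =>
  -- Induction on the drop in rank: after one arrow it is smaller by one, so uniqueness is known for
  -- paths starting at `D`.
  have step : ∀ {D : K.Simplex} (h : K.HasArrow δ Δ D) {f g : S.stalk D ⟶ S.stalk Δ'},
      S.IsComposite D Δ' f → S.IsComposite D Δ' g → f = g := by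
    intro D h f g hf hg
    have := h.1
    have := hf.pathLE.rank_le
    exact ih (n - 1) (by omega) hf hg (by omega)
  have key : ∀ {D₁ D₂ : K.Simplex}, Relation.ReflTransGen (Linked δ Δ Δ') D₁ D₂ →
      ∀ (h₁ : K.HasArrow δ Δ D₁) (h₂ : K.HasArrow δ Δ D₂) {f₁ : S.stalk D₁ ⟶ S.stalk Δ'}
        {f₂ : S.stalk D₂ ⟶ S.stalk Δ'}, S.IsComposite D₁ Δ' f₁ → S.IsComposite D₂ Δ' f₂ →
        S.res h₁ ≫ f₁ = S.res h₂ ≫ f₂ := by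
    intro D₁ D₂ h
    induction h with
    | refl =>
      intro h₁ h₂ f₁ f₂ hf₁ hf₂
      rw [step h₁ hf₁ hf₂]
    | tail _ hl ih' =>
      intro h₁ h₂ f₁ f₂ hf₁ hf₂
      obtain ⟨k₁, k₂, E, a₁, a₂, hE⟩ := hl
      obtain ⟨e, he⟩ := S.exists_isComposite hE
      -- Along one link both composites may be rerouted through `E`, where the equivalence axiom
      -- identifies them.
      rw [ih' h₁ k₁ hf₁ (.head a₁ e he), step h₂ hf₂ (.head a₂ e he), ← Category.assoc,
        ← Category.assoc, S.equivalence k₁ a₁ h₂ a₂]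
  cases hf with
  | refl =>
    cases hg with
    | refl => rfl
    | head h g hg =>
      have := h.1
      have := hg.pathLE.rank_le
      omega
  | head h₁ f₁ hf₁ =>
    generalize hR : S.res h₁ ≫ f₁ = r
    cases hg with
    | refl =>
      have := h₁.1
      have := hf₁.pathLE.rank_le
      omega
    | head h₂ f₂ hf₂ =>
      rw [← hR]
      exact key (linked_chain hδ h₁ h₂ hf₁.pathLE hf₂.pathLE) h₁ h₂ hf₁ hf₂

/-- The map of stalks given by any path from `Δ` to `Δ'`. -/
def pathMap (S : LinearData F K δ) {Δ Δ' : K.Simplex} (h : K.PathLE δ Δ Δ') :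
    S.stalk Δ ⟶ S.stalk Δ' :=
  (S.exists_isComposite h).choose

lemma isComposite_pathMap (S : LinearData F K δ) {Δ Δ' : K.Simplex} (h : K.PathLE δ Δ Δ') :
    S.IsComposite Δ Δ' (S.pathMap h) :=
  (S.exists_isComposite h).choose_spec

lemma pathMap_refl (hδ : IsPerversity δ) (S : LinearData F K δ) {Δ : K.Simplex}
    (h : K.PathLE δ Δ Δ) : S.pathMap h = 𝟙 _ :=
  (S.isComposite_pathMap h).unique hδ (.refl _)

lemma pathMap_arrow (hδ : IsPerversity δ) (S : LinearData F K δ) {Δ Δ' : K.Simplex}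
    (h : K.HasArrow δ Δ Δ') (h' : K.PathLE δ Δ Δ') : S.pathMap h' = S.res h := by
  have := IsComposite.head (S := S) h _ (.refl Δ')
  rw [Category.comp_id] at this
  exact (S.isComposite_pathMap h').unique hδ this

lemma pathMap_comp (hδ : IsPerversity δ) (S : LinearData F K δ) {Δ Δ' Δ'' : K.Simplex}
    (h : K.PathLE δ Δ Δ') (h' : K.PathLE δ Δ' Δ'') (h'' : K.PathLE δ Δ Δ'') :
    S.pathMap h ≫ S.pathMap h' = S.pathMap h'' :=
  ((S.isComposite_pathMap h).trans (S.isComposite_pathMap h')).unique hδ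
    (S.isComposite_pathMap h'')

lemma IsComposite.exists_comm (α : S ⟶ T) {Δ Δ' : K.Simplex} {f : S.stalk Δ ⟶ S.stalk Δ'}
    (hf : S.IsComposite Δ Δ' f) :
    ∃ g, T.IsComposite Δ Δ' g ∧ f ≫ LinearData.Hom.app α Δ' = LinearData.Hom.app α Δ ≫ g := by
  induction hf with
  | refl => exact ⟨𝟙 _, .refl _, by simp⟩
  | head h f _ ih =>
    obtain ⟨g, hg, e⟩ := ih
    refine ⟨_, .head h g hg, ?_⟩
    rw [Category.assoc, e, ← Category.assoc, LinearData.Hom.comm α h, Category.assoc]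

lemma pathMap_comm (hδ : IsPerversity δ) (α : S ⟶ T) {Δ Δ' : K.Simplex} (h : K.PathLE δ Δ Δ') :
    S.pathMap h ≫ LinearData.Hom.app α Δ' = LinearData.Hom.app α Δ ≫ T.pathMap h := by
  obtain ⟨g, hg, e⟩ := (S.isComposite_pathMap h).exists_comm α
  rw [e, hg.unique hδ (T.isComposite_pathMap h)]

end LinearData

end AbstractSimplicialComplex

end

noncomputable section

namespace AbstractSimplicialComplex

open Topology

variable {V : Type u} [Fintype V] {K : AbstractSimplicialComplex V}

/-! ### Carriers in the barycentric subdivision -/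

section Carrier

/-- The set `s` is a superlevel set of `x`, for a positive level. -/
def Cuts (x : V → ℝ) (s : Finset V) : Prop := ∀ v ∈ s, 0 < x v ∧ ∀ w ∉ s, x w < x v

open Classical in
/-- The barycenters spanning the open simplex of the barycentric subdivision containing `x`. -/
def carrierOf (K : AbstractSimplicialComplex V) (x : V → ℝ) : Finset K.Simplex :=
  Finset.univ.filter fun Δ ↦ Cuts x Δ.1

lemma mem_carrierOf {x : V → ℝ} {Δ : K.Simplex} : Δ ∈ carrierOf K x ↔ Cuts x Δ.1 := by
  simp [carrierOf]

/-- The linear combination of barycenters with weights `w`. -/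
def barycentricSum (c : Finset K.Simplex) (w : K.Simplex → ℝ) : V → ℝ :=
  ∑ Δ ∈ c, w Δ • Δ.barycenter

omit [Fintype V] in
lemma Simplex.barycenter_of_mem {Δ : K.Simplex} {v : V} (h : v ∈ Δ.1) :
    Δ.barycenter v = (Δ.1.card : ℝ)⁻¹ := by
  simp [Simplex.barycenter, h]

omit [Fintype V] in
lemma Simplex.barycenter_of_notMem {Δ : K.Simplex} {v : V} (h : v ∉ Δ.1) :
    Δ.barycenter v = 0 := by
  simp [Simplex.barycenter, h]

omit [Fintype V] in
lemma Simplex.inv_card_pos (Δ : K.Simplex) : 0 < (Δ.1.card : ℝ)⁻¹ := by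
  have := Δ.nonempty.card_pos
  positivity

omit [Fintype V] in
lemma Simplex.barycenter_nonneg (Δ : K.Simplex) (v : V) : 0 ≤ Δ.barycenter v := by
  by_cases h : v ∈ Δ.1
  · rw [Simplex.barycenter_of_mem h]
    exact Δ.inv_card_pos.le
  · rw [Simplex.barycenter_of_notMem h]

lemma Simplex.sum_barycenter (Δ : K.Simplex) : ∑ v, Δ.barycenter v = 1 := by
  classical
  have h := Δ.nonempty.card_pos
  simp only [Simplex.barycenter, Set.indicator_apply, Finset.mem_coe]
  rw [Finset.sum_ite_mem, Finset.univ_inter, Finset.sum_const, nsmul_eq_mul]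
  field_simp

omit [Fintype V] in
lemma barycentricSum_apply (c : Finset K.Simplex) (w : K.Simplex → ℝ) (v : V) :
    barycentricSum c w v = ∑ Δ ∈ c, w Δ * Δ.barycenter v := by
  simp [barycentricSum, Finset.sum_apply]

lemma sum_barycentricSum (c : Finset K.Simplex) (w : K.Simplex → ℝ) :
    ∑ v, barycentricSum c w v = ∑ Δ ∈ c, w Δ := by
  simp only [barycentricSum_apply]
  rw [Finset.sum_comm]
  refine Finset.sum_congr rfl fun Δ _ ↦ ?_
  rw [← Finset.mul_sum, Δ.sum_barycenter, mul_one]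

-- In a flag every barycenter is at least as large at a vertex of `Δ` as at a vertex outside, and
-- the barycenter of `Δ` itself is strictly larger there.
omit [Fintype V] in
lemma cuts_barycentricSum_of_mem {c : Finset K.Simplex} (hc : K.IsFlag c) {w : K.Simplex → ℝ}
    (hw : ∀ Δ ∈ c, 0 < w Δ) {Δ : K.Simplex} (hΔ : Δ ∈ c) : Cuts (barycentricSum c w) Δ.1 := by
  intro v hv
  have hvpos : 0 < w Δ * Δ.barycenter v := by
    rw [Simplex.barycenter_of_mem hv]
    exact mul_pos (hw Δ hΔ) Δ.inv_card_pos
  constructor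
  · rw [barycentricSum_apply]
    exact Finset.sum_pos' (fun D hD ↦ mul_nonneg (hw D hD).le (D.barycenter_nonneg v))
      ⟨Δ, hΔ, hvpos⟩
  · intro u hu
    rw [barycentricSum_apply, barycentricSum_apply]
    refine Finset.sum_lt_sum (fun D hD ↦ ?_) ⟨Δ, hΔ, ?_⟩
    · refine mul_le_mul_of_nonneg_left ?_ (hw D hD).le
      by_cases huD : u ∈ D.1
      · have hvD : v ∈ D.1 := by
          rcases hc.2 Δ hΔ D hD with h | h
          · exact h hv
          · exact absurd (h huD) hu
        rw [Simplex.barycenter_of_mem huD, Simplex.barycenter_of_mem hvD]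
      · rw [Simplex.barycenter_of_notMem huD]
        exact D.barycenter_nonneg v
    · rwa [Simplex.barycenter_of_notMem hu, mul_zero]

omit [Fintype V] in
lemma cuts_barycentricSum_iff {c : Finset K.Simplex} (hc : K.IsFlag c) {w : K.Simplex → ℝ}
    (hw : ∀ Δ ∈ c, 0 < w Δ) {Δ : K.Simplex} : Cuts (barycentricSum c w) Δ.1 ↔ Δ ∈ c := by
  classical
  refine ⟨fun h ↦ ?_, cuts_barycentricSum_of_mem hc hw⟩
  set x := barycentricSum c w
  obtain ⟨v, hv, hmin⟩ := Δ.1.exists_min_image x Δ.nonempty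
  obtain ⟨D₀, hD₀, hvD₀⟩ : ∃ D ∈ c, v ∈ D.1 := by
    by_contra! hcon
    refine (h v hv).1.ne' ((barycentricSum_apply c w v).trans (Finset.sum_eq_zero fun D hD ↦ ?_))
    rw [Simplex.barycenter_of_notMem (hcon D hD), mul_zero]
  -- With `v` a vertex of `Δ` where `x` is least, the smallest flag member `D` containing `v` must
  -- be `Δ`. A vertex of `Δ` outside `D` would have a smaller value than `v`. A vertex `u` of `D`
  -- outside `Δ` has a smaller value too, so some member contains `v` but not `u`, although it
  -- contains `D`.
  obtain ⟨D, hD, hDmin⟩ := (c.filter fun D ↦ v ∈ D.1).exists_min_image (fun D ↦ D.dim)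
    ⟨D₀, by simp [hD₀, hvD₀]⟩
  simp only [Finset.mem_filter, and_imp] at hD hDmin
  have h1 : Δ.1 ⊆ D.1 := fun u hu ↦ by
    by_contra huD
    exact absurd ((cuts_barycentricSum_of_mem hc hw hD.1 v hD.2).2 u huD) (hmin u hu).not_gt
  have h2 : D.1 ⊆ Δ.1 := fun u hu ↦ by
    by_contra huΔ
    obtain ⟨D', hD', hvD', huD'⟩ : ∃ D' ∈ c, v ∈ D'.1 ∧ u ∉ D'.1 := by
      by_contra! hcon
      refine absurd ((h v hv).2 u huΔ) (not_lt.mpr ?_)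
      change barycentricSum c w v ≤ barycentricSum c w u
      rw [barycentricSum_apply, barycentricSum_apply]
      refine Finset.sum_le_sum fun E hE ↦ mul_le_mul_of_nonneg_left ?_ (hw E hE).le
      by_cases hvE : v ∈ E.1
      · rw [Simplex.barycenter_of_mem hvE, Simplex.barycenter_of_mem (hcon E hE hvE)]
      · rw [Simplex.barycenter_of_notMem hvE]
        exact E.barycenter_nonneg u
    exact huD' ((hc.2 D hD.1 D' hD').subset (hDmin D' hD' hvD') hu)
  rw [show Δ = D from Subtype.ext (h1.antisymm h2)]
  exact hD.1

lemma carrierOf_barycentricSum {c : Finset K.Simplex} (hc : K.IsFlag c) {w : K.Simplex → ℝ}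
    (hw : ∀ Δ ∈ c, 0 < w Δ) : carrierOf K (barycentricSum c w) = c := by
  ext Δ
  rw [mem_carrierOf, cuts_barycentricSum_iff hc hw]

omit [Fintype V] in
lemma IsFlag.exists_max {c : Finset K.Simplex} (hc : K.IsFlag c) :
    ∃ D ∈ c, ∀ Δ ∈ c, Δ.1 ⊆ D.1 := by
  obtain ⟨D, hD, hmax⟩ := c.exists_max_image (fun D ↦ D.dim) hc.1
  exact ⟨D, hD, fun Δ hΔ ↦ (hc.2 Δ hΔ D hD).subset (hmax Δ hΔ)⟩

lemma barycentricSum_mem_realization {c : Finset K.Simplex} (hc : K.IsFlag c)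
    {w : K.Simplex → ℝ} (hw : ∀ Δ ∈ c, 0 < w Δ) (hsum : ∑ Δ ∈ c, w Δ = 1) :
    barycentricSum c w ∈ K.realization := by
  classical
  refine ⟨fun v ↦ ?_, ?_, ?_⟩
  · rw [barycentricSum_apply]
    exact Finset.sum_nonneg fun D hD ↦ mul_nonneg (hw D hD).le (D.barycenter_nonneg v)
  · rw [sum_barycentricSum, hsum]
  · obtain ⟨D, hD, hmax⟩ := hc.exists_max
    refine ⟨D.1, D.2, ?_⟩
    ext v
    rw [Finset.mem_coe, Function.mem_support]
    refine ⟨fun h ↦ (cuts_barycentricSum_of_mem hc hw hD v h).1.ne', fun h ↦ ?_⟩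
    by_contra hv
    refine h ?_
    rw [barycentricSum_apply]
    exact Finset.sum_eq_zero fun E hE ↦ by
      rw [Simplex.barycenter_of_notMem fun h ↦ hv (hmax E hE h), mul_zero]

/-- Induction on the size of the support `T`: subtracting the least positive coordinate on all of
`T` removes exactly `T` from the superlevel sets and shrinks the support. -/
lemma exists_barycentricSum_eq (x : V → ℝ) (h0 : ∀ v, 0 ≤ x v) (Δ₀ : K.Simplex)
    (hsupp : ∀ v, x v ≠ 0 → v ∈ Δ₀.1) :
    ∃ w : K.Simplex → ℝ, (∀ Δ ∈ carrierOf K x, 0 < w Δ) ∧ x = barycentricSum (carrierOf K x) w := by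
  classical
  induction hn : (Finset.univ.filter fun v ↦ x v ≠ 0).card using Nat.strong_induction_on
    generalizing x with
  | _ n ih =>
  set T := Finset.univ.filter fun v ↦ x v ≠ 0 with hT
  have memT : ∀ v, v ∈ T ↔ x v ≠ 0 := fun v ↦ by simp [hT]
  have posT : ∀ v, v ∈ T ↔ 0 < x v := fun v ↦ by rw [memT, (h0 v).lt_iff_ne']
  have zeroT : ∀ v, v ∉ T → x v = 0 := fun v hv ↦ not_not.mp fun h ↦ hv ((memT v).mpr h)
  by_cases hTe : T = ∅
  · have hx : ∀ v, x v = 0 := fun v ↦ zeroT v (by simp [hTe])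
    have hc : carrierOf K x = ∅ := by
      refine Finset.eq_empty_of_forall_notMem fun Δ hΔ ↦ ?_
      obtain ⟨v, hv⟩ := Δ.nonempty
      exact (mem_carrierOf.mp hΔ v hv).1.ne' (hx v)
    refine ⟨fun _ ↦ 1, fun _ _ ↦ one_pos, ?_⟩
    rw [hc]
    ext v
    simp [barycentricSum, hx]
  have hTne := Finset.nonempty_iff_ne_empty.mpr hTe
  obtain ⟨m, hm, hmin⟩ := T.exists_min_image x hTne
  have hmpos := (posT m).mp hm
  obtain ⟨ΔT, hΔT⟩ : ∃ Δ : K.Simplex, Δ.1 = T :=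
    ⟨Δ₀.face T (fun v hv ↦ hsupp v ((memT v).mp hv)) hTne, rfl⟩
  let x' : V → ℝ := fun v ↦ if v ∈ T then x v - x m else 0
  have x'T : ∀ v, v ∈ T → x' v = x v - x m := fun v hv ↦ if_pos hv
  have x'nT : ∀ v, v ∉ T → x' v = 0 := fun v hv ↦ if_neg hv
  have x'0 : ∀ v, 0 ≤ x' v := fun v ↦ by
    by_cases hv : v ∈ T
    · rw [x'T v hv]
      linarith [hmin v hv]
    · rw [x'nT v hv]
  have hcuts : ∀ Δ : K.Simplex, Cuts x Δ.1 ↔ Δ = ΔT ∨ Cuts x' Δ.1 := by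
    intro Δ
    constructor
    · intro h
      by_cases hΔ : Δ = ΔT
      · exact Or.inl hΔ
      right
      have hsub : Δ.1 ⊆ T := fun v hv ↦ (posT v).mpr (h v hv).1
      obtain ⟨t, htT, htΔ⟩ : ∃ t ∈ T, t ∉ Δ.1 := by
        by_contra! hcon
        exact hΔ (Subtype.ext (by rw [hΔT]; exact hsub.antisymm hcon))
      intro v hv
      have hvt := (h v hv).2 t htΔ
      have hmt := hmin t htT
      rw [x'T v (hsub hv)]
      refine ⟨by linarith, fun u hu ↦ ?_⟩
      have huv := (h v hv).2 u hu
      by_cases huT : u ∈ T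
      · rw [x'T u huT]
        linarith
      · rw [x'nT u huT]
        linarith
    · rintro (rfl | h)
      · intro v hv
        rw [hΔT] at hv
        refine ⟨(posT v).mp hv, fun u hu ↦ ?_⟩
        rw [zeroT u (hΔT ▸ hu)]
        exact (posT v).mp hv
      · intro v hv
        have hvT : v ∈ T := by
          by_contra hvT
          exact (h v hv).1.ne' (x'nT v hvT)
        refine ⟨(posT v).mp hvT, fun u hu ↦ ?_⟩
        by_cases huT : u ∈ T
        · have := (h v hv).2 u hu
          rw [x'T v hvT, x'T u huT] at this
          linarith
        · rw [zeroT u huT]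
          exact (posT v).mp hvT
  have hnot : ΔT ∉ carrierOf K x' := fun h ↦ by
    have := (mem_carrierOf.mp h m (hΔT ▸ hm)).1
    rw [x'T m hm, sub_self] at this
    exact lt_irrefl _ this
  have hins : carrierOf K x = insert ΔT (carrierOf K x') := by
    ext Δ
    rw [Finset.mem_insert, mem_carrierOf, mem_carrierOf, hcuts]
  obtain ⟨w', hw', hx'⟩ := ih _ (by
    rw [← hn]
    refine Finset.card_lt_card ((Finset.ssubset_iff_of_subset fun v hv ↦ ?_).mpr ⟨m, hm, ?_⟩)
    · by_contra hvT
      exact (Finset.mem_filter.mp hv).2 (x'nT v hvT)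
    · simp [x'T m hm]) x' x'0 (fun v hv ↦ hsupp v ((memT v).mp (by
        by_contra hvT
        exact hv (x'nT v hvT)))) rfl
  -- The barycenter of `T` has coordinates `1 / T.card`, so this weight restores the subtracted `x
  -- m`.
  refine ⟨Function.update w' ΔT (x m * T.card), fun Δ hΔ ↦ ?_, ?_⟩
  · rw [hins, Finset.mem_insert] at hΔ
    rcases hΔ with rfl | hΔ
    · rw [Function.update_self]
      exact mul_pos hmpos (Nat.cast_pos.mpr hTne.card_pos)
    · rw [Function.update_of_ne (ne_of_mem_of_not_mem hΔ hnot)]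
      exact hw' Δ hΔ
  · ext v
    have hv' : x' v = ∑ Δ ∈ carrierOf K x', Function.update w' ΔT (x m * T.card) Δ *
        Δ.barycenter v := by
      rw [congrFun hx' v, barycentricSum_apply]
      exact Finset.sum_congr rfl fun Δ hΔ ↦ by
        rw [Function.update_of_ne (ne_of_mem_of_not_mem hΔ hnot)]
    rw [hins, barycentricSum_apply, Finset.sum_insert hnot, ← hv', Function.update_self]
    have hcard : (T.card : ℝ) ≠ 0 := Nat.cast_ne_zero.mpr hTne.card_pos.ne'
    by_cases hvT : v ∈ T
    · rw [Simplex.barycenter_of_mem (hΔT ▸ hvT), hΔT, x'T v hvT]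
      field_simp
      ring
    · rw [Simplex.barycenter_of_notMem (hΔT ▸ hvT), x'nT v hvT, zeroT v hvT]
      simp

/-- The carrier of a point of the realization. -/
abbrev carrier (x : K.space) : Finset K.Simplex := carrierOf K x.1

lemma exists_weights (x : K.space) : ∃ w : K.Simplex → ℝ, (∀ Δ ∈ carrier x, 0 < w Δ) ∧
    ∑ Δ ∈ carrier x, w Δ = 1 ∧ x.1 = barycentricSum (carrier x) w := by
  obtain ⟨h0, h1, s, hs, hsupp⟩ := x.2
  obtain ⟨w, hw, hx⟩ := exists_barycentricSum_eq (K := K) x.1 h0 ⟨s, hs⟩ fun v hv ↦ by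
    have : v ∈ (s : Set V) := hsupp ▸ hv
    exact this
  refine ⟨w, hw, ?_, hx⟩
  rw [← sum_barycentricSum, ← hx, h1]

lemma isFlag_carrier (x : K.space) : K.IsFlag (carrier x) := by
  obtain ⟨w, -, hw, -⟩ := exists_weights x
  refine ⟨?_, fun Δ hΔ Δ' hΔ' ↦ ?_⟩
  · by_contra h
    rw [Finset.not_nonempty_iff_eq_empty] at h
    simp [h] at hw
  · by_contra h
    simp only [Simplex.Incident, not_or] at h
    obtain ⟨v, hv, hv'⟩ := Finset.not_subset.mp h.1
    obtain ⟨u, hu, hu'⟩ := Finset.not_subset.mp h.2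
    exact lt_asymm ((mem_carrierOf.mp hΔ v hv).2 u hu') ((mem_carrierOf.mp hΔ' u hu).2 v hv')

lemma mem_openSubdivisionSimplex_iff {c : Finset K.Simplex} (hc : K.IsFlag c) {x : K.space} :
    x ∈ K.openSubdivisionSimplex c ↔ carrier x = c := by
  constructor
  · rintro ⟨w, hw, -, hx⟩
    change carrierOf K x.1 = c
    rw [hx]
    exact carrierOf_barycentricSum hc hw
  · rintro rfl
    exact exists_weights x

/-- Membership in the carrier is expressed by finitely many strict inequalities between continuous
functions, hence persists nearby. -/
lemma eventually_carrier_subset (x : K.space) : ∀ᶠ y in 𝓝 x, carrier x ⊆ carrier y := by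
  have : ∀ Δ ∈ carrier x, ∀ᶠ y in 𝓝 x, Δ ∈ carrier y := by
    intro Δ hΔ
    simp only [mem_carrierOf] at hΔ ⊢
    have hcont : ∀ v, Continuous fun y : K.space ↦ y.1 v := fun v ↦
      (continuous_apply v).comp continuous_subtype_val
    have : ∀ v, ∀ᶠ y in 𝓝 x, v ∈ Δ.1 → 0 < y.1 v ∧ ∀ w ∉ Δ.1, y.1 w < y.1 v := by
      intro v
      by_cases hv : v ∈ Δ.1
      · have h2 : ∀ w, ∀ᶠ y in 𝓝 x, w ∉ Δ.1 → y.1 w < y.1 v := fun w ↦ by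
          by_cases hw : w ∈ Δ.1
          · simp [hw]
          · filter_upwards [(hcont w).continuousAt.eventually_lt (hcont v).continuousAt
              ((hΔ v hv).2 w hw)] with y hy _ using hy
        filter_upwards [continuousAt_const.eventually_lt (hcont v).continuousAt (hΔ v hv).1,
          Filter.eventually_all.mpr h2] with y h3 h4 _ using ⟨h3, h4⟩
      · simp [hv]
    exact Filter.eventually_all.mpr this
  exact (Filter.eventually_all_finset _).mpr this

/-- The point with given weights on a flag. -/
lemma exists_carrier_eq {c : Finset K.Simplex} (hc : K.IsFlag c) :
    ∃ x : K.space, carrier x = c := by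
  have hcard : (c.card : ℝ) ≠ 0 := by
    have := hc.1.card_pos
    positivity
  have hw : ∀ Δ ∈ c, (0 : ℝ) < (fun _ : K.Simplex ↦ (c.card : ℝ)⁻¹) Δ := fun _ _ ↦ by
    have := hc.1.card_pos
    positivity
  exact ⟨⟨_, barycentricSum_mem_realization hc hw (by simp [hcard])⟩,
    carrierOf_barycentricSum hc hw⟩

/-- As soon as `t > 0` the interpolated weights are positive on all of `carrier y`: a segment enters
the open subdivision simplex of `y` immediately after leaving `x`. -/
lemma exists_mix {x y : K.space} (h : carrier x ⊆ carrier y) {t : ℝ} (ht : 0 < t) (ht1 : t ≤ 1) :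
    (1 - t) • x.1 + t • y.1 ∈ K.realization ∧
      carrierOf K ((1 - t) • x.1 + t • y.1) = carrier y := by
  classical
  obtain ⟨w, hw, hws, hx⟩ := exists_weights x
  obtain ⟨w', hw', hws', hy⟩ := exists_weights y
  have hw0 : ∀ Δ, 0 ≤ if Δ ∈ carrier x then w Δ else 0 := fun Δ ↦ by
    split_ifs with hΔ
    exacts [(hw Δ hΔ).le, le_rfl]
  let u : K.Simplex → ℝ := fun Δ ↦ (1 - t) * (if Δ ∈ carrier x then w Δ else 0) + t * w' Δ
  have hu : ∀ Δ ∈ carrier y, 0 < u Δ := fun Δ hΔ ↦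
    add_pos_of_nonneg_of_pos (mul_nonneg (by linarith) (hw0 Δ)) (mul_pos ht (hw' Δ hΔ))
  have hsum : ∑ Δ ∈ carrier y, u Δ = 1 := by
    simp only [u, Finset.sum_add_distrib, ← Finset.mul_sum]
    rw [Finset.sum_ite_mem, Finset.inter_eq_right.mpr h, hws, hws']
    ring
  have heq : (1 - t) • x.1 + t • y.1 = barycentricSum (carrier y) u := by
    ext v
    rw [Pi.add_apply, Pi.smul_apply, Pi.smul_apply, congrFun hx v, congrFun hy v,
      barycentricSum_apply, barycentricSum_apply, barycentricSum_apply, smul_eq_mul, smul_eq_mul,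
      ← Finset.inter_eq_right.mpr h, ← Finset.sum_ite_mem, Finset.mul_sum, Finset.mul_sum,
      ← Finset.sum_add_distrib]
    refine Finset.sum_congr rfl fun Δ _ ↦ ?_
    simp only [u]
    split_ifs <;> ring
  rw [heq]
  exact ⟨barycentricSum_mem_realization (isFlag_carrier y) hu hsum,
    carrierOf_barycentricSum (isFlag_carrier y) hu⟩

/-- The points of the segment from `x` to `y`. -/
def mix (x y : K.space) (h : carrier x ⊆ carrier y) (t : unitInterval) : K.space :=
  ⟨(1 - (t : ℝ)) • x.1 + (t : ℝ) • y.1, by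
    rcases eq_or_lt_of_le t.2.1 with h0 | h0
    · rw [← h0]
      simp
    · exact (exists_mix h h0 t.2.2).1⟩

lemma mix_zero {x y : K.space} (h : carrier x ⊆ carrier y) : mix x y h 0 = x :=
  Subtype.ext (by simp [mix])

lemma mix_one {x y : K.space} (h : carrier x ⊆ carrier y) : mix x y h 1 = y :=
  Subtype.ext (by simp [mix])

lemma carrier_mix {x y : K.space} (h : carrier x ⊆ carrier y) {t : unitInterval} (ht : 0 < t) :
    carrier (mix x y h t) = carrier y :=
  (exists_mix h ht t.2.2).2

lemma dist_mix_le {x y : K.space} (h : carrier x ⊆ carrier y) (t : unitInterval) :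
    dist (mix x y h t) x ≤ dist y x := by
  change dist ((1 - (t : ℝ)) • x.1 + (t : ℝ) • y.1) x.1 ≤ dist y.1 x.1
  rw [dist_eq_norm, dist_eq_norm, show (1 - (t : ℝ)) • x.1 + (t : ℝ) • y.1 - x.1 =
    (t : ℝ) • (y.1 - x.1) by module, norm_smul, Real.norm_of_nonneg t.2.1]
  exact mul_le_of_le_one_left (norm_nonneg _) t.2.2

lemma continuous_mix {Y : Type*} [TopologicalSpace Y] {f g : Y → K.space} {t : Y → unitInterval}
    (h : ∀ y, carrier (f y) ⊆ carrier (g y)) (hf : Continuous f) (hg : Continuous g)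
    (ht : Continuous t) : Continuous fun y ↦ mix (f y) (g y) (h y) (t y) := by
  unfold mix
  fun_prop

end Carrier

/-! ### The perverse stratification -/

section Stratification

variable (δ : ℕ → ℤ)

lemma exists_pole (x : K.space) :
    ∃ Δ ∈ carrier x, ∀ Δ' ∈ carrier x, δ Δ.dim ≤ δ Δ'.dim :=
  (carrier x).exists_min_image (fun Δ ↦ δ Δ.dim) (isFlag_carrier x).1

/-- The simplex `Δ` such that `x` lies in the `(-δ)`-perverse simplex of `Δ`. -/
def pole (x : K.space) : K.Simplex := (exists_pole δ x).choose

lemma pole_mem (x : K.space) : pole δ x ∈ carrier x := (exists_pole δ x).choose_spec.1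

lemma pole_le (x : K.space) {Δ : K.Simplex} (h : Δ ∈ carrier x) :
    δ (pole δ x).dim ≤ δ Δ.dim :=
  (exists_pole δ x).choose_spec.2 Δ h

variable {δ} (hδ : IsPerversity δ)
include hδ

-- Makes the vertex of least rank in a carrier unique, so that the perverse simplices partition the
-- realization.
omit [Fintype V] in
lemma IsFlag.eq_of_rank_eq {c : Finset K.Simplex} (hc : K.IsFlag c) {Δ Δ' : K.Simplex}
    (h : Δ ∈ c) (h' : Δ' ∈ c) (hr : δ Δ.dim = δ Δ'.dim) : Δ = Δ' := by
  have hd := hδ.injective hr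
  exact Simplex.eq_of_subset ((hc.2 Δ h Δ' h').subset hd.le) hd.ge

lemma pole_eq_iff {x : K.space} {Δ : K.Simplex} :
    pole δ x = Δ ↔ Δ ∈ carrier x ∧ ∀ Δ' ∈ carrier x, δ Δ.dim ≤ δ Δ'.dim := by
  constructor
  · rintro rfl
    exact ⟨pole_mem δ x, fun Δ' h ↦ pole_le δ x h⟩
  · rintro ⟨h1, h2⟩
    exact (isFlag_carrier x).eq_of_rank_eq hδ (pole_mem δ x) h1
      ((pole_le δ x h1).antisymm (h2 _ (pole_mem δ x)))

lemma pole_congr {x y : K.space} (h : carrier x = carrier y) : pole δ x = pole δ y := by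
  rw [pole_eq_iff hδ, h, ← pole_eq_iff hδ]

lemma mem_perverseSimplex_iff {x : K.space} {Δ : K.Simplex} :
    x ∈ K.perverseSimplex (fun k ↦ -δ k) Δ ↔ pole δ x = Δ := by
  rw [pole_eq_iff hδ]
  simp only [perverseSimplex, Set.mem_iUnion, Set.mem_ofPred_eq, exists_prop, neg_le_neg_iff]
  constructor
  · rintro ⟨c, ⟨hc, h1, h2⟩, hx⟩
    rw [(mem_openSubdivisionSimplex_iff hc).mp hx]
    exact ⟨h1, h2⟩
  · rintro ⟨h1, h2⟩
    exact ⟨carrier x, ⟨isFlag_carrier x, h1, h2⟩,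
      (mem_openSubdivisionSimplex_iff (isFlag_carrier x)).mpr rfl⟩

/-- The pole of `x` is a vertex in the flag of `y`, so it is incident to the pole of `y` and has at
least its rank. With `eventually_carrier_subset`, this makes `pole` continuous for the topology of
upper sets of the path order. -/
lemma pathLE_pole {x y : K.space} (h : carrier x ⊆ carrier y) :
    K.PathLE δ (pole δ x) (pole δ y) :=
  pathLE_of_incident hδ ((isFlag_carrier y).2 _ (h (pole_mem δ x)) _ (pole_mem δ y))
    (pole_le δ y (h (pole_mem δ x)))

lemma eventually_pathLE_pole (x : K.space) : ∀ᶠ y in 𝓝 x, K.PathLE δ (pole δ x) (pole δ y) := by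
  filter_upwards [eventually_carrier_subset x] with y h using pathLE_pole hδ h

/-- The union of the strata reachable from `Δ` is already open by `eventually_pathLE_pole`, so the
interior in the definition of the star changes nothing. -/
lemma mem_perverseStar_iff {x : K.space} {Δ : K.Simplex} :
    x ∈ K.perverseStar δ Δ ↔ K.PathLE δ Δ (pole δ x) := by
  have : (⋃ Δ' ∈ {Δ' | K.PathLE δ Δ Δ'}, K.perverseSimplex (fun k ↦ -δ k) Δ') =
      {x : K.space | K.PathLE δ Δ (pole δ x)} := by
    ext y
    simp only [Set.mem_iUnion, Set.mem_ofPred_eq, exists_prop, mem_perverseSimplex_iff hδ]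
    exact ⟨by rintro ⟨D, h, rfl⟩; exact h, fun h ↦ ⟨_, h, rfl⟩⟩
  have hopen : IsOpen {x : K.space | K.PathLE δ Δ (pole δ x)} := by
    rw [isOpen_iff_mem_nhds]
    intro y hy
    filter_upwards [eventually_pathLE_pole hδ y] with z hz using Relation.ReflTransGen.trans hy hz
  change x ∈ interior _ ↔ _
  rw [this, hopen.interior_eq]
  rfl

end Stratification

/-! ### Points with prescribed carriers -/

section Centers

omit [Fintype V] in
lemma isFlag_singleton (Δ : K.Simplex) : K.IsFlag {Δ} :=
  ⟨Finset.singleton_nonempty _, by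
    simp only [Finset.mem_singleton]
    rintro _ rfl _ rfl
    exact Or.inl subset_rfl⟩

open Classical in
omit [Fintype V] in
lemma isFlag_pair {Δ Δ' : K.Simplex} (h : Δ.Incident Δ') : K.IsFlag {Δ, Δ'} :=
  ⟨Finset.insert_nonempty _ _, by
    simp only [Finset.mem_insert, Finset.mem_singleton]
    rintro _ (rfl | rfl) _ (rfl | rfl)
    exacts [Or.inl subset_rfl, h, h.symm, Or.inl subset_rfl]⟩

open Classical in
omit [Fintype V] in
lemma isFlag_triple {Δ₁ Δ₂ Δ₃ : K.Simplex} (h₁₂ : Δ₁.Incident Δ₂) (h₂₃ : Δ₂.Incident Δ₃)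
    (h₁₃ : Δ₁.Incident Δ₃) : K.IsFlag {Δ₁, Δ₂, Δ₃} :=
  ⟨Finset.insert_nonempty _ _, by
    simp only [Finset.mem_insert, Finset.mem_singleton]
    rintro _ (rfl | rfl | rfl) _ (rfl | rfl | rfl)
    exacts [Or.inl subset_rfl, h₁₂, h₁₃, h₁₂.symm, Or.inl subset_rfl, h₂₃, h₁₃.symm, h₂₃.symm,
      Or.inl subset_rfl]⟩

/-- The barycenter of a simplex, as a point of the realization. -/
def center (Δ : K.Simplex) : K.space := (exists_carrier_eq (isFlag_singleton Δ)).choose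

lemma carrier_center (Δ : K.Simplex) : carrier (center Δ) = {Δ} :=
  (exists_carrier_eq (isFlag_singleton Δ)).choose_spec

lemma carrier_center_subset {Δ : K.Simplex} {x : K.space} (h : Δ ∈ carrier x) :
    carrier (center Δ) ⊆ carrier x := by
  rw [carrier_center]
  simpa using h

open Classical in
/-- A point in the open segment between the barycenters of two incident simplices. -/
def pairCenter {Δ Δ' : K.Simplex} (h : Δ.Incident Δ') : K.space :=
  (exists_carrier_eq (isFlag_pair h)).choose

open Classical in
lemma carrier_pairCenter {Δ Δ' : K.Simplex} (h : Δ.Incident Δ') :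
    carrier (pairCenter h) = {Δ, Δ'} :=
  (exists_carrier_eq (isFlag_pair h)).choose_spec

lemma mem_carrier_pairCenter_left {Δ Δ' : K.Simplex} (h : Δ.Incident Δ') :
    Δ ∈ carrier (pairCenter h) := by
  rw [carrier_pairCenter]
  simp

lemma mem_carrier_pairCenter_right {Δ Δ' : K.Simplex} (h : Δ.Incident Δ') :
    Δ' ∈ carrier (pairCenter h) := by
  rw [carrier_pairCenter]
  simp

lemma carrier_pairCenter_subset {Δ Δ' : K.Simplex} (h : Δ.Incident Δ') {x : K.space}
    (h1 : Δ ∈ carrier x) (h2 : Δ' ∈ carrier x) : carrier (pairCenter h) ⊆ carrier x := by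
  rw [carrier_pairCenter]
  intro D
  simp only [Finset.mem_insert, Finset.mem_singleton]
  rintro (rfl | rfl)
  exacts [h1, h2]

variable {δ : ℕ → ℤ} (hδ : IsPerversity δ)
include hδ

lemma pole_center (Δ : K.Simplex) : pole δ (center Δ) = Δ := by
  rw [pole_eq_iff hδ, carrier_center]
  simp

lemma pole_pairCenter {Δ Δ' : K.Simplex} (h : Δ.Incident Δ') (hr : δ Δ'.dim ≤ δ Δ.dim) :
    pole δ (pairCenter h) = Δ' := by
  rw [pole_eq_iff hδ, carrier_pairCenter]
  simp [hr]

lemma pole_mix {x y : K.space} (h : carrier x ⊆ carrier y) {t : unitInterval} (ht : 0 < t) :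
    pole δ (mix x y h t) = pole δ y :=
  pole_congr hδ (carrier_mix h ht)

end Centers

end AbstractSimplicialComplex

end

noncomputable section

namespace AbstractSimplicialComplex

open Topology

variable {F : Type u} [Field F] {V : Type u} [Fintype V] {K : AbstractSimplicialComplex V}
  {δ : ℕ → ℤ}

namespace LinearData

/-! ### The sheaf of linear algebra data -/

section SheafOf

variable (S T : LinearData F K δ)

/-- The graphs of the maps of stalks along paths. -/
def pathRelation (x y : K.space) :
    Submodule F (S.stalk (pole δ x) × S.stalk (pole δ y)) where
  -- Without a path the condition is vacuous; this is harmless, since a path exists for all `y` near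
  -- `x`.
  carrier := {a | ∀ h : K.PathLE δ (pole δ x) (pole δ y), a.2 = S.pathMap h a.1}
  zero_mem' h := (map_zero (S.pathMap h).hom).symm
  add_mem' {a b} ha hb h := by
    rw [Prod.snd_add, Prod.fst_add, ha h, hb h, map_add]
  smul_mem' r a ha h := by
    rw [Prod.smul_snd, Prod.smul_fst, ha h, map_smul]

/-- The sheaf whose sections are the families of elements of the stalks of `S` that are locally
compatible with the maps along paths. -/
abbrev sheafOf : TopCat.Sheaf (ModuleCat.{u} F) K.space :=
  localSections (fun x ↦ S.stalk (pole δ x)) S.pathRelation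

variable {S T}

lemma eventually_eq_pathMap {U : Opens K.space}
    (s : localSectionsSubmodule (fun x ↦ S.stalk (pole δ x)) S.pathRelation U) {x : K.space}
    (hx : x ∈ U) : ∀ᶠ y in 𝓝 x, ∀ (hy : y ∈ U) (h : K.PathLE δ (pole δ x) (pole δ y)),
      s.1 ⟨y, hy⟩ = S.pathMap h (s.1 ⟨x, hx⟩) :=
  localSections_eventually (M := fun x ↦ S.stalk (pole δ x)) (C := S.pathRelation) s hx

omit [Fintype V] in
lemma pathMap_pathMap (hδ : IsPerversity δ) {Δ Δ' Δ'' : K.Simplex} (h : K.PathLE δ Δ Δ')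
    (h' : K.PathLE δ Δ' Δ'') (h'' : K.PathLE δ Δ Δ'') (m : S.stalk Δ) :
    S.pathMap h' (S.pathMap h m) = S.pathMap h'' m := by
  rw [← S.pathMap_comp hδ h h' h'']
  rfl

omit [Fintype V] in
lemma pathMap_self (hδ : IsPerversity δ) {Δ : K.Simplex} (h : K.PathLE δ Δ Δ) (m : S.stalk Δ) :
    S.pathMap h m = m := by
  rw [S.pathMap_refl hδ]
  rfl

-- Paths in both directions exist only between equal simplices; their maps identify the stalks at
-- simplices that are known to be equal, such as poles of points in one stratum.
omit [Fintype V] in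
lemma pathMap_cancel (hδ : IsPerversity δ) {Δ Δ' : K.Simplex} (h : K.PathLE δ Δ Δ')
    (h' : K.PathLE δ Δ' Δ) (m : S.stalk Δ) : S.pathMap h' (S.pathMap h m) = m := by
  rw [pathMap_pathMap hδ h h' (pathLE_refl _), pathMap_self hδ]

omit [Fintype V] in
lemma pathMap_bijective (hδ : IsPerversity δ) {Δ Δ' : K.Simplex} (h : K.PathLE δ Δ Δ')
    (h' : K.PathLE δ Δ' Δ) : Function.Bijective (S.pathMap h) :=
  Function.bijective_iff_has_inverse.mpr
    ⟨S.pathMap h', pathMap_cancel hδ h h', pathMap_cancel hδ h' h⟩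

omit [Fintype V] in
lemma app_pathMap (hδ : IsPerversity δ) (α : S ⟶ T) {Δ Δ' : K.Simplex} (h : K.PathLE δ Δ Δ')
    (m : S.stalk Δ) : Hom.app α Δ' (S.pathMap h m) = T.pathMap h (Hom.app α Δ m) :=
  congr($(pathMap_comm hδ α h) m)

/-- The section of `S.sheafOf` on the perverse star of `Δ` with value `m` at `Δ`. -/
def starSection (hδ : IsPerversity δ) (Δ : K.Simplex) :
    S.stalk Δ →ₗ[F] localSectionsSubmodule (fun x ↦ S.stalk (pole δ x)) S.pathRelation
      (K.perverseStar δ Δ) where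
  toFun m := ⟨fun x ↦ S.pathMap ((mem_perverseStar_iff hδ).mp x.2) m, fun _ ↦
    Filter.Eventually.of_forall fun _ h ↦ (pathMap_pathMap hδ _ h _ m).symm⟩
  map_add' _ _ := Subtype.ext (funext fun _ ↦ map_add _ _ _)
  map_smul' _ _ := Subtype.ext (funext fun _ ↦ map_smul _ _ _)

lemma starSection_apply (hδ : IsPerversity δ) (Δ : K.Simplex) (m : S.stalk Δ)
    (x : K.perverseStar δ Δ) :
    (starSection hδ Δ m).1 x = S.pathMap ((mem_perverseStar_iff hδ).mp x.2) m := rfl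

/-- Nearby values are images of the value at `x` under path maps, so they vanish with it; every
value extends over the star of the pole. -/
lemma stalkEval_sheafOf_bijective (hδ : IsPerversity δ) (x : K.space) :
    Function.Bijective (stalkEval (fun x ↦ S.stalk (pole δ x)) S.pathRelation x) := by
  refine stalkEval_bijective _ _ x ?_ fun m ↦ ?_
  · filter_upwards [eventually_pathLE_pole hδ x] with y h b hb
    exact (hb h).trans (map_zero (S.pathMap h).hom)
  · exact ⟨K.perverseStar δ (pole δ x), (mem_perverseStar_iff hδ).mpr (pathLE_refl _),
      starSection hδ _ m, pathMap_self hδ _ m⟩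

/-- Along a stratum the pole is constant and the path maps are identities, so compatible families
are locally constant there. -/
lemma nonempty_stalkTrivialization_sheafOf (hδ : IsPerversity δ) (S : LinearData F K δ)
    (Δ : K.Simplex) :
    Nonempty (StalkTrivialization (S.stalk Δ) (K.perverseInclusion (fun k ↦ -δ k) Δ)
      S.sheafOf) := by
  have hz : ∀ z : K.perverseSimplex (fun k ↦ -δ k) Δ, pole δ z.1 = Δ := fun z ↦
    (mem_perverseSimplex_iff hδ).mp z.2
  have h1 : ∀ z : K.perverseSimplex (fun k ↦ -δ k) Δ, K.PathLE δ (pole δ z.1) Δ := fun z ↦ by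
    rw [hz z]
    exact pathLE_refl _
  have h2 : ∀ z : K.perverseSimplex (fun k ↦ -δ k) Δ, K.PathLE δ Δ (pole δ z.1) := fun z ↦ by
    rw [hz z]
    exact pathLE_refl _
  have hiso : ∀ z : K.perverseSimplex (fun k ↦ -δ k) Δ,
      IsIso (stalkEval (fun x ↦ S.stalk (pole δ x)) S.pathRelation z.1 ≫ S.pathMap (h1 z)) :=
    fun z ↦ by
      rw [ConcreteCategory.isIso_iff_bijective]
      exact (pathMap_bijective hδ (h1 z) (h2 z)).comp (stalkEval_sheafOf_bijective hδ z.1)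
  refine ⟨⟨fun z ↦ @asIso _ _ _ _ _ (hiso z), fun U s z hzU ↦ ?_⟩⟩
  have key : ∀ (z : K.perverseSimplex (fun k ↦ -δ k) Δ) (hz : z.1 ∈ U),
      (stalkEval (fun x ↦ S.stalk (pole δ x)) S.pathRelation z.1 ≫ S.pathMap (h1 z))
        (S.sheafOf.presheaf.germ U z.1 hz s) = S.pathMap (h1 z) (s.1 ⟨z.1, hz⟩) := fun z hz ↦
    congrArg (S.pathMap (h1 z)) (stalkEval_germ _ _ z.1 U hz s)
  have hcont : ContinuousAt (Subtype.val : K.perverseSimplex (fun k ↦ -δ k) Δ → K.space) z :=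
    continuous_subtype_val.continuousAt
  have hs' := hcont.eventually (eventually_eq_pathMap s hzU)
  filter_upwards [hs'] with z' hz' hz'U
  refine (key z' hz'U).trans (Eq.trans ?_ (key z hzU).symm)
  have hzz' : K.PathLE δ (pole δ z.1) (pole δ z'.1) := (h1 z).trans (h2 z')
  have := hz' hz'U hzz'
  refine (congrArg (S.pathMap (h1 z')) this).trans ?_
  exact pathMap_pathMap hδ _ _ _ _

/-! ### Sections on perverse stars -/

/-- The values of a local section are transported along segments. -/
lemma eq_pathMap_of_mix_mem (hδ : IsPerversity δ) {U : Opens K.space}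
    (s : localSectionsSubmodule (fun x ↦ S.stalk (pole δ x)) S.pathRelation U) {x y : K.space}
    (h : carrier x ⊆ carrier y) (hU : ∀ t, mix x y h t ∈ U) (hx : x ∈ U) (hy : y ∈ U)
    (hxy : K.PathLE δ (pole δ x) (pole δ y)) :
    s.1 ⟨y, hy⟩ = S.pathMap hxy (s.1 ⟨x, hx⟩) := by
  -- The parameters at which transport is correct form a clopen set containing 0. At 0 only openness
  -- is at issue; for `t₀ > 0` the pole is constant near `t₀`, so correctness can be carried in both
  -- directions.
  let Q : Set unitInterval := {t | ∀ h' : K.PathLE δ (pole δ x) (pole δ (mix x y h t)),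
    s.1 ⟨mix x y h t, hU t⟩ = S.pathMap h' (s.1 ⟨x, hx⟩)}
  have hle : ∀ t, K.PathLE δ (pole δ x) (pole δ (mix x y h t)) := fun t ↦ by
    rcases eq_or_lt_of_le t.2.1 with h0 | h0
    · rw [show t = 0 from Subtype.ext h0.symm, mix_zero]
      exact pathLE_refl _
    · rw [pole_mix hδ h h0]
      exact hxy
  have hQ0 : (0 : unitInterval) ∈ Q := by
    have : ∀ z (hz : z ∈ U), z = x → ∀ h' : K.PathLE δ (pole δ x) (pole δ z),
        s.1 ⟨z, hz⟩ = S.pathMap h' (s.1 ⟨x, hx⟩) := by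
      rintro z hz rfl h'
      rw [pathMap_self hδ]
    exact this _ _ (mix_zero h)
  have hcont : Continuous fun t ↦ mix x y h t :=
    continuous_mix (fun _ ↦ h) continuous_const continuous_const continuous_id
  have hloc : ∀ t₀ : unitInterval, ∀ᶠ t in 𝓝 t₀, t ∈ Q ↔ t₀ ∈ Q := by
    intro t₀
    have h1 := hcont.continuousAt.eventually (eventually_eq_pathMap s (hU t₀))
    have h2 := hcont.continuousAt.eventually (eventually_pathLE_pole hδ (mix x y h t₀))
    by_cases h0 : t₀ = 0
    · filter_upwards [h1, h2] with t h1 h2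
      refine iff_of_true (fun h' ↦ ?_) (h0 ▸ hQ0)
      have hQ' : t₀ ∈ Q := h0 ▸ hQ0
      rw [h1 (hU t) h2, hQ' (hle t₀), pathMap_pathMap hδ]
    · have h0' : 0 < t₀ := lt_of_le_of_ne t₀.2.1 (Ne.symm h0)
      filter_upwards [h1, h2, lt_mem_nhds h0'] with t h1 h2 ht
      have h3 : K.PathLE δ (pole δ (mix x y h t)) (pole δ (mix x y h t₀)) := by
        rw [pole_mix hδ h ht, pole_mix hδ h h0']
        exact pathLE_refl _
      constructor
      · intro hQ h'
        apply (pathMap_bijective hδ h2 h3).1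
        rw [← h1 (hU t) h2, hQ (hle t), pathMap_pathMap hδ]
      · intro hQ h'
        rw [h1 (hU t) h2, hQ (hle t₀), pathMap_pathMap hδ]
  have hclopen : IsClopen Q := by
    refine ⟨⟨isOpen_iff_mem_nhds.mpr fun t ht ↦ ?_⟩, isOpen_iff_mem_nhds.mpr fun t ht ↦ ?_⟩
    · filter_upwards [hloc t] with t' h using mt h.mp ht
    · filter_upwards [hloc t] with t' h using h.mpr ht
  have hQ1 : (1 : unitInterval) ∈ Q := by
    rw [hclopen.eq_univ ⟨0, hQ0⟩]
    trivial
  have : ∀ z (hz : z ∈ U), z = y → (∀ h' : K.PathLE δ (pole δ x) (pole δ z),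
      s.1 ⟨z, hz⟩ = S.pathMap h' (s.1 ⟨x, hx⟩)) →
        s.1 ⟨y, hy⟩ = S.pathMap hxy (s.1 ⟨x, hx⟩) := by
    rintro z hz rfl h'
    exact h' _
  exact this _ _ (mix_one h) hQ1

lemma eq_pathMap_of_mem_perverseStar (hδ : IsPerversity δ) {Δ : K.Simplex}
    (s : localSectionsSubmodule (fun x ↦ S.stalk (pole δ x)) S.pathRelation
      (K.perverseStar δ Δ)) {x y : K.space}
    (h : carrier x ⊆ carrier y) (hx : x ∈ K.perverseStar δ Δ) (hy : y ∈ K.perverseStar δ Δ)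
    (hxy : K.PathLE δ (pole δ x) (pole δ y)) :
    s.1 ⟨y, hy⟩ = S.pathMap hxy (s.1 ⟨x, hx⟩) := by
  refine eq_pathMap_of_mix_mem hδ s h (fun t ↦ ?_) hx hy hxy
  rcases eq_or_lt_of_le t.2.1 with h0 | h0
  · rw [show t = 0 from Subtype.ext h0.symm, mix_zero]
    exact hx
  · rw [mem_perverseStar_iff hδ, pole_mix hδ h h0, ← mem_perverseStar_iff hδ]
    exact hy

/-- Induction along a path. For an arrow from `D` to `D'`, the point `pairCenter` lies in the
stratum of `D'` and is joined to both barycenters by segments inside the star. -/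
lemma eq_pathMap_center (hδ : IsPerversity δ) {Δ : K.Simplex}
    (s : localSectionsSubmodule (fun x ↦ S.stalk (pole δ x)) S.pathRelation
      (K.perverseStar δ Δ)) (h₀ : center Δ ∈ K.perverseStar δ Δ) {Δ' : K.Simplex}
    (h : K.PathLE δ Δ Δ') (h' : center Δ' ∈ K.perverseStar δ Δ)
    (hle : K.PathLE δ (pole δ (center Δ)) (pole δ (center Δ'))) :
    s.1 ⟨center Δ', h'⟩ = S.pathMap hle (s.1 ⟨center Δ, h₀⟩) := by
  induction h with
  | refl => rw [pathMap_self hδ]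
  | tail h a ih =>
    rename_i D D'
    have hr := a.1
    have hD : center D ∈ K.perverseStar δ Δ := by
      rw [mem_perverseStar_iff hδ, pole_center hδ]
      exact h
    have e : pole δ (pairCenter a.2) = D' := pole_pairCenter hδ a.2 (by omega)
    have hp : pairCenter a.2 ∈ K.perverseStar δ Δ := by
      rw [mem_perverseStar_iff hδ, e]
      exact h.tail a
    have l1 : K.PathLE δ (pole δ (center D)) (pole δ (pairCenter a.2)) := by
      rw [pole_center hδ, e]
      exact Relation.ReflTransGen.single a
    have l2 : K.PathLE δ (pole δ (center D')) (pole δ (pairCenter a.2)) := by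
      rw [pole_center hδ, e]
      exact pathLE_refl _
    have l2' : K.PathLE δ (pole δ (pairCenter a.2)) (pole δ (center D')) := by
      rw [pole_center hδ, e]
      exact pathLE_refl _
    have l0 : K.PathLE δ (pole δ (center Δ)) (pole δ (center D)) := by
      rw [pole_center hδ, pole_center hδ]
      exact h
    have e1 := eq_pathMap_of_mem_perverseStar hδ s
      (carrier_center_subset (mem_carrier_pairCenter_left a.2)) hD hp l1
    have e2 := eq_pathMap_of_mem_perverseStar hδ s
      (carrier_center_subset (mem_carrier_pairCenter_right a.2)) h' hp l2
    apply (pathMap_bijective hδ l2 l2').1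
    rw [← e2, e1, ih hD l0, pathMap_pathMap hδ l0 l1 (l0.trans l1),
      pathMap_pathMap hδ hle l2 (l0.trans l1)]

/-- Sections on a perverse star are determined by their value at the center. -/
lemma starSection_bijective (hδ : IsPerversity δ) (S : LinearData F K δ) (Δ : K.Simplex) :
    Function.Bijective (starSection (S := S) hδ Δ) := by
  have l1 : K.PathLE δ Δ (pole δ (center Δ)) := by
    rw [pole_center hδ]
    exact pathLE_refl _
  have l2 : K.PathLE δ (pole δ (center Δ)) Δ := by
    rw [pole_center hδ]
    exact pathLE_refl _
  have h₀ : center Δ ∈ K.perverseStar δ Δ := (mem_perverseStar_iff hδ).mpr l1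
  constructor
  · intro m n h
    exact (pathMap_bijective hδ l1 l2).1 (congrFun (congrArg Subtype.val h) ⟨center Δ, h₀⟩)
  · intro s
    refine ⟨S.pathMap l2 (s.1 ⟨center Δ, h₀⟩), Subtype.ext (funext fun x ↦ ?_)⟩
    have hx : K.PathLE δ Δ (pole δ x.1) := (mem_perverseStar_iff hδ).mp x.2
    have h' : center (pole δ x.1) ∈ K.perverseStar δ Δ := by
      rw [mem_perverseStar_iff hδ, pole_center hδ]
      exact hx
    have l3 : K.PathLE δ (pole δ (center Δ)) (pole δ (center (pole δ x.1))) := by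
      rw [pole_center hδ, pole_center hδ]
      exact hx
    have l4 : K.PathLE δ (pole δ (center (pole δ x.1))) (pole δ x.1) := by
      rw [pole_center hδ]
      exact pathLE_refl _
    rw [starSection_apply]
    -- The value travels from the center of `Δ` to the center of the pole of `x`, and from there
    -- along a segment to `x`.
    refine Eq.trans ?_ (eq_pathMap_of_mem_perverseStar hδ s
      (carrier_center_subset (pole_mem δ x.1)) h' x.2 l4).symm
    rw [eq_pathMap_center hδ s h₀ hx h' l3, pathMap_pathMap hδ l3 l4 (l3.trans l4),
      pathMap_pathMap hδ l2 _ (l3.trans l4)]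

end SheafOf

end LinearData

end AbstractSimplicialComplex

end

noncomputable section

namespace AbstractSimplicialComplex

open Topology

variable {F : Type u} [Field F] {V : Type u} [Fintype V] {K : AbstractSimplicialComplex V}
  {δ : ℕ → ℤ}

/-! ### The functor from linear algebra data to sheaves -/

namespace LinearData

variable {S T : LinearData F K δ}

/-- The map on sections induced by a morphism of linear algebra data. -/
def sheafOfMapApp (hδ : IsPerversity δ) (α : S ⟶ T) (U : Opens K.space) :
    localSectionsSubmodule (fun x ↦ S.stalk (pole δ x)) S.pathRelation U →ₗ[F]
      localSectionsSubmodule (fun x ↦ T.stalk (pole δ x)) T.pathRelation U where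
  toFun s := ⟨fun x ↦ Hom.app α _ (s.1 x), fun x ↦ by
    filter_upwards [s.2 x] with y hy h
    refine (congrArg (Hom.app α _) (hy h)).trans (app_pathMap hδ α h _)⟩
  map_add' _ _ := Subtype.ext (funext fun _ ↦ map_add _ _ _)
  map_smul' _ _ := Subtype.ext (funext fun _ ↦ map_smul _ _ _)

/-- The morphism of sheaves induced by a morphism of linear algebra data. -/
def sheafOfMap (hδ : IsPerversity δ) (α : S ⟶ T) : S.sheafOf ⟶ T.sheafOf :=
  ⟨{ app := fun U ↦ ModuleCat.ofHom (sheafOfMapApp hδ α U.unop)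
     naturality := fun _ _ _ ↦ rfl }⟩

end LinearData

variable (F K) in
/-- The functor from linear algebra data to sheaves. -/
def sheafOfFunctor (hδ : IsPerversity δ) :
    LinearData F K δ ⥤ TopCat.Sheaf (ModuleCat.{u} F) K.space where
  obj S := S.sheafOf
  map α := LinearData.sheafOfMap hδ α
  map_id _ := rfl
  map_comp _ _ := rfl

/-- A morphism of linear algebra data that is bijective on stalks is an isomorphism. -/
def LinearData.isoOfBijective {S T : LinearData F K δ} (α : S ⟶ T)
    (h : ∀ Δ, Function.Bijective (LinearData.Hom.app α Δ)) : S ≅ T :=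
  have : ∀ Δ, IsIso (LinearData.Hom.app α Δ) := fun Δ ↦
    (ConcreteCategory.isIso_iff_bijective _).mpr (h Δ)
  { hom := α
    inv :=
      { app := fun Δ ↦ inv (LinearData.Hom.app α Δ)
        comm := fun a ↦ by
          rw [IsIso.comp_inv_eq, Category.assoc, LinearData.Hom.comm α a, IsIso.inv_hom_id_assoc] }
    hom_inv_id := LinearData.Hom.ext (funext fun _ ↦ IsIso.hom_inv_id _)
    inv_hom_id := LinearData.Hom.ext (funext fun _ ↦ IsIso.inv_hom_id _) }

/-- The canonical morphism from linear algebra data to the sections of their sheaf. -/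
def starHom (hδ : IsPerversity δ) (S : LinearData F K δ) :
    S ⟶ (K.sheafData F δ).obj S.sheafOf where
  app Δ := ModuleCat.ofHom (LinearData.starSection hδ Δ)
  comm {Δ Δ'} a := by
    ext m
    refine Subtype.ext (funext fun x ↦ ?_)
    change S.pathMap _ (S.res a m) = S.pathMap _ m
    rw [← S.pathMap_arrow hδ a (Relation.ReflTransGen.single a)]
    exact LinearData.pathMap_pathMap hδ _ _ _ m

variable (F K) in
/-- Passing to the sheaf and back to the sections on perverse stars is the identity. -/
def sheafOfCompSheafDataIso (hδ : IsPerversity δ) :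
    𝟭 (LinearData F K δ) ≅ sheafOfFunctor F K hδ ⋙ K.sheafData F δ :=
  NatIso.ofComponents
    (fun S ↦ LinearData.isoOfBijective (starHom hδ S) (LinearData.starSection_bijective hδ S))
    fun α ↦ LinearData.Hom.ext <| funext fun _ ↦ ModuleCat.hom_ext <| LinearMap.ext fun m ↦
      Subtype.ext <| funext fun _ ↦ (LinearData.app_pathMap hδ α _ m).symm

/-- Morphisms out of the sheaf of linear algebra data are determined by the sections on
perverse stars. -/
lemma sheafData_map_injective (hδ : IsPerversity δ) {S T : LinearData F K δ}
    {f g : S.sheafOf ⟶ T.sheafOf} (h : (K.sheafData F δ).map f = (K.sheafData F δ).map g) :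
    f = g := by
  have hstar : ∀ Δ (m : S.stalk Δ), f.hom.app (op (K.perverseStar δ Δ))
      (LinearData.starSection hδ Δ m) = g.hom.app (op (K.perverseStar δ Δ))
        (LinearData.starSection hδ Δ m) := fun Δ m ↦
    congr($(congrFun (congrArg LinearData.Hom.app h) Δ) (LinearData.starSection hδ Δ m))
  refine CategoryTheory.Sheaf.hom_ext (NatTrans.ext (funext fun U ↦ ?_))
  ext s
  refine Subtype.ext (funext fun x ↦ ?_)
  obtain ⟨O, hO, hOo, hxO⟩ := eventually_nhds_iff.mp
    ((LinearData.eventually_eq_pathMap (S := S) s x.2).and (eventually_pathLE_pole hδ x.1))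
  -- On this neighbourhood of `x` the section `s` coincides with the star section of value `s x`, so
  -- naturality reduces the claim to stars.
  let W : Opens K.space := ⟨O, hOo⟩ ⊓ U.unop
  have hW1 : W ≤ U.unop := inf_le_right
  have hW2 : W ≤ K.perverseStar δ (pole δ x.1) := fun y hy ↦
    (mem_perverseStar_iff hδ).mpr (hO y hy.1).2
  have hres : S.sheafOf.presheaf.map (homOfLE hW1).op s = S.sheafOf.presheaf.map
      (homOfLE hW2).op (LinearData.starSection hδ (pole δ x.1) (s.1 x)) :=
    Subtype.ext (funext fun y ↦ (hO y.1 y.2.1).1 (hW1 y.2) (hO y.1 y.2.1).2)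
  have key : ∀ k : S.sheafOf ⟶ T.sheafOf, (k.hom.app U s).1 x =
      (k.hom.app (op (K.perverseStar δ (pole δ x.1)))
        (LinearData.starSection hδ (pole δ x.1) (s.1 x))).1
          ⟨x.1, (mem_perverseStar_iff hδ).mpr (pathLE_refl _)⟩ := by
    intro k
    have e1 : k.hom.app (op W) (S.sheafOf.presheaf.map (homOfLE hW1).op s) =
        T.sheafOf.presheaf.map (homOfLE hW1).op (k.hom.app U s) :=
      NatTrans.naturality_apply k.hom (homOfLE hW1).op s
    have e2 : k.hom.app (op W) (S.sheafOf.presheaf.map (homOfLE hW2).op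
        (LinearData.starSection hδ (pole δ x.1) (s.1 x))) =
        T.sheafOf.presheaf.map (homOfLE hW2).op (k.hom.app (op (K.perverseStar δ (pole δ x.1)))
          (LinearData.starSection hδ (pole δ x.1) (s.1 x))) :=
      NatTrans.naturality_apply k.hom (homOfLE hW2).op _
    have e3 := (e1.symm.trans (congrArg _ hres)).trans e2
    exact congrFun (congrArg Subtype.val e3) ⟨x.1, hxO, x.2⟩
  rw [key f, key g, hstar]

lemma sheafOfFunctor_faithful (hδ : IsPerversity δ) : (sheafOfFunctor F K hδ).Faithful :=
  Functor.Faithful.of_comp_iso (sheafOfCompSheafDataIso F K hδ).symm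

/-- The candidate preimage is the map induced by `f` on star sections; its sheaf map has the same
effect on stars as `f`, and stars determine morphisms. -/
lemma sheafOfFunctor_full (hδ : IsPerversity δ) : (sheafOfFunctor F K hδ).Full where
  map_surjective {S T} f := by
    let e := sheafOfCompSheafDataIso F K hδ
    refine ⟨e.hom.app S ≫ (K.sheafData F δ).map f ≫ e.inv.app T, sheafData_map_injective hδ ?_⟩
    let g : (K.sheafData F δ).obj S.sheafOf ⟶ (K.sheafData F δ).obj T.sheafOf :=
      (K.sheafData F δ).map f
    have h := e.hom.naturality (e.hom.app S ≫ g ≫ e.inv.app T)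
    have h' : (e.hom.app S ≫ g ≫ e.inv.app T) ≫ e.hom.app T = e.hom.app S ≫ g := by
      have := e.inv_hom_id_app T
      refine (Category.assoc _ _ _).trans (congrArg (e.hom.app S ≫ ·) ?_)
      exact (Category.assoc _ _ _).trans ((congrArg (g ≫ ·) this).trans (Category.comp_id _))
    exact (cancel_epi (e.hom.app S)).mp (h.symm.trans h')

lemma sheafOf_isPerverselyConstructible (hδ : IsPerversity δ) (S : K.FinLinearData F δ) :
    K.IsPerverselyConstructible F (fun k ↦ -δ k) S.obj.sheafOf := fun Δ ↦ by
  obtain ⟨τ⟩ := S.obj.nonempty_stalkTrivialization_sheafOf hδ Δ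
  exact ⟨S.obj.stalk Δ, S.property Δ, τ.nonempty_iso⟩

variable (F K) in
/-- The functor from finite-dimensional linear algebra data to constructible sheaves. -/
def finSheafOf (hδ : IsPerversity δ) : K.FinLinearData F δ ⥤ K.DeltaSheaf F δ :=
  ObjectProperty.lift _ (ObjectProperty.ι _ ⋙ sheafOfFunctor F K hδ)
    (sheafOf_isPerverselyConstructible hδ)

lemma finSheafOf_faithful (hδ : IsPerversity δ) : (finSheafOf F K hδ).Faithful :=
  have := sheafOfFunctor_faithful (F := F) (K := K) hδ
  Functor.Faithful.of_comp_iso (H := ObjectProperty.ι _ ⋙ sheafOfFunctor F K hδ)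
    (ObjectProperty.liftCompιIso _ _ _)

lemma finSheafOf_full (hδ : IsPerversity δ) : (finSheafOf F K hδ).Full :=
  have := sheafOfFunctor_full (F := F) (K := K) hδ
  Functor.Full.of_comp_faithful_iso (H := ObjectProperty.ι _ ⋙ sheafOfFunctor F K hδ)
    (ObjectProperty.liftCompιIso _ _ _)

end AbstractSimplicialComplex

end

noncomputable section

namespace AbstractSimplicialComplex

open Topology

variable {F : Type u} [Field F] {V : Type u} [Fintype V] {K : AbstractSimplicialComplex V}
  {δ : ℕ → ℤ}

/-! ### Transport between the strata of a constructible sheaf -/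

/-- Identifications of the stalks of `A` along each stratum with a fixed vector space, such that
the values of sections are locally constant along the strata. -/
structure StratumValues (δ : ℕ → ℤ) (A : TopCat.Sheaf (ModuleCat.{u} F) K.space)
    (W : K.Simplex → ModuleCat.{u} F) where
  /-- the identifications -/
  val : ∀ {Δ : K.Simplex} {x : K.space}, pole δ x = Δ → A.presheaf.stalk x ≃ₗ[F] W Δ
  eventually_eq : ∀ {U : Opens K.space} (s : A.presheaf.obj (op U)) {Δ : K.Simplex} {x : K.space}
    (hx : x ∈ U) (h : pole δ x = Δ), ∀ᶠ y in 𝓝 x, ∀ (hy : y ∈ U) (h' : pole δ y = Δ),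
      val h' (A.presheaf.germ U y hy s) = val h (A.presheaf.germ U x hx s)

lemma exists_stratumValues (hδ : IsPerversity δ) (A : TopCat.Sheaf (ModuleCat.{u} F) K.space)
    (hA : K.IsPerverselyConstructible F (fun k ↦ -δ k) A) :
    ∃ W : K.Simplex → ModuleCat.{u} F, (∀ Δ, Module.Finite F (W Δ)) ∧
      Nonempty (StratumValues δ A W) := by
  choose W hW φ using hA
  have τ : ∀ Δ, StalkTrivialization (W Δ) (K.perverseInclusion (fun k ↦ -δ k) Δ) A := fun Δ ↦
    (nonempty_stalkTrivialization (W Δ) _ A (φ Δ).some).some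
  refine ⟨W, hW, ⟨⟨fun {Δ x} h ↦
    ((τ Δ).iso ⟨x, (mem_perverseSimplex_iff hδ).mpr h⟩).toLinearEquiv, ?_⟩⟩⟩
  intro U s Δ x hx h
  have := (τ Δ).eventually_eq U s ⟨x, (mem_perverseSimplex_iff hδ).mpr h⟩ hx
  rw [nhds_subtype, Filter.eventually_comap] at this
  filter_upwards [this] with y hy hyU h'
  exact hy ⟨y, (mem_perverseSimplex_iff hδ).mpr h'⟩ rfl hyU

namespace StratumValues

variable {A : TopCat.Sheaf (ModuleCat.{u} F) K.space} {W : K.Simplex → ModuleCat.{u} F}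
  (v : StratumValues δ A W)

/-- The value of a section at a point. -/
def value {U : Opens K.space} (s : A.presheaf.obj (op U)) {Δ : K.Simplex} {x : K.space}
    (hx : x ∈ U) (h : pole δ x = Δ) : W Δ :=
  v.val h (A.presheaf.germ U x hx s)

lemma value_congr {U : Opens K.space} (s : A.presheaf.obj (op U)) {Δ : K.Simplex} {x y : K.space}
    (e : x = y) (hx : x ∈ U) (h : pole δ x = Δ) (hy : y ∈ U) (h' : pole δ y = Δ) :
    v.value s hx h = v.value s hy h' := by
  subst e
  rfl

lemma value_add {U : Opens K.space} (s t : A.presheaf.obj (op U)) {Δ : K.Simplex} {x : K.space}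
    (hx : x ∈ U) (h : pole δ x = Δ) :
    v.value (s + t) hx h = v.value s hx h + v.value t hx h := by
  simp [value]

lemma value_smul {U : Opens K.space} (r : F) (s : A.presheaf.obj (op U)) {Δ : K.Simplex}
    {x : K.space} (hx : x ∈ U) (h : pole δ x = Δ) :
    v.value (r • s) hx h = r • v.value s hx h := by
  simp [value]

lemma value_restrict {U U' : Opens K.space} (i : U' ⟶ U) (s : A.presheaf.obj (op U))
    {Δ : K.Simplex} {x : K.space} (hx : x ∈ U) (hx' : x ∈ U') (h : pole δ x = Δ) :
    v.value (A.presheaf.map i.op s) hx' h = v.value s hx h :=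
  congrArg (v.val h) (A.presheaf.germ_res_apply i x hx' s)

lemma value_eventually {U : Opens K.space} (s : A.presheaf.obj (op U)) {Δ : K.Simplex}
    {x : K.space} (hx : x ∈ U) (h : pole δ x = Δ) :
    ∀ᶠ y in 𝓝 x, ∀ (hy : y ∈ U) (h' : pole δ y = Δ), v.value s hy h' = v.value s hx h :=
  v.eventually_eq s hx h

lemma exists_value_eq {Δ : K.Simplex} {x : K.space} (h : pole δ x = Δ) (a : W Δ) :
    ∃ (U : Opens K.space) (hx : x ∈ U) (s : A.presheaf.obj (op U)), v.value s hx h = a := by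
  obtain ⟨U, hx, s, e⟩ := A.presheaf.exists_germ_eq ((v.val h).symm a)
  exact ⟨U, hx, s, (congrArg (v.val h) e).trans ((v.val h).apply_symm_apply a)⟩

/-- Sections with the same value at a point have the same values at all nearby points. -/
lemma value_eq_of_value_eq {U U' : Opens K.space} (s : A.presheaf.obj (op U))
    (s' : A.presheaf.obj (op U')) {Δ : K.Simplex} {x : K.space} (hx : x ∈ U) (hx' : x ∈ U')
    (h : pole δ x = Δ) (e : v.value s hx h = v.value s' hx' h) :
    ∀ᶠ y in 𝓝 x, ∀ (hy : y ∈ U) (hy' : y ∈ U') {D : K.Simplex} (hD : pole δ y = D),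
      v.value s hy hD = v.value s' hy' hD := by
  obtain ⟨O, hO, i, j, e'⟩ := A.presheaf.germ_eq x hx hx' s s' ((v.val h).injective e)
  filter_upwards [O.2.mem_nhds hO] with y hyO hy hy' D hD
  rw [← v.value_restrict i s hy hyO hD, ← v.value_restrict j s' hy' hyO hD, e']

variable (hδ : IsPerversity δ)
include hδ

/-- The values of a section are constant along half-open segments. -/
lemma value_mix_eq {U : Opens K.space} (s : A.presheaf.obj (op U)) {x y : K.space}
    (hxy : carrier x ⊆ carrier y) {Δ : K.Simplex} {t₁ : unitInterval}
    (hU : ∀ t ≤ t₁, mix x y hxy t ∈ U) {t t' : unitInterval} (h0 : 0 < t) (ht : t ≤ t₁)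
    (h0' : 0 < t') (ht' : t' ≤ t₁) (h : pole δ (mix x y hxy t) = Δ)
    (h' : pole δ (mix x y hxy t') = Δ) :
    v.value s (hU t ht) h = v.value s (hU t' ht') h' := by
  have hcont : Continuous fun t ↦ mix x y hxy t :=
    continuous_mix (fun _ ↦ hxy) continuous_const continuous_const continuous_id
  have hpole : ∀ t : unitInterval, 0 < t → pole δ (mix x y hxy t) = Δ := fun t ht ↦ by
    rw [pole_mix hδ hxy ht, ← pole_mix hδ hxy h0, h]
  -- The values are locally constant on the connected interval `(0, t₁]`; the endpoint 0 is left out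
  -- because `x` may lie in another stratum.
  refine (isPreconnected_Ioc (a := (0 : unitInterval)) (b := t₁)).induction₂
    (fun t t' ↦ ∀ (hm : mix x y hxy t ∈ U) (hm' : mix x y hxy t' ∈ U)
      (h : pole δ (mix x y hxy t) = Δ) (h' : pole δ (mix x y hxy t') = Δ),
      v.value s hm h = v.value s hm' h') ?_ ?_ ?_ ⟨h0, ht⟩ ⟨h0', ht'⟩ _ _ h h'
  · intro t ht
    have := hcont.continuousAt.eventually
      (v.value_eventually s (hU t ht.2) (hpole t ht.1))
    filter_upwards [this.filter_mono nhdsWithin_le_nhds] with t' h' hm hm' hp hp'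
    exact (h' hm' hp').symm
  · intro a b c _ hb _ hab hbc hm hm' hp hp'
    exact (hab hm (hU b hb.2) hp (hpole b hb.1)).trans (hbc _ hm' _ hp')
  · intro a b _ _ hab hm hm' hp hp'
    exact (hab hm' hm hp' hp).symm

end StratumValues

lemma exists_pos_forall_le {P : unitInterval → Prop} (h : ∀ᶠ t in 𝓝 0, P t) :
    ∃ t₁ : unitInterval, 0 < t₁ ∧ ∀ t ≤ t₁, P t := by
  obtain ⟨u, hu, h'⟩ := exists_Ico_subset_of_mem_nhds h ⟨1, zero_lt_one⟩
  obtain ⟨t₁, h0, h1⟩ := _root_.exists_between hu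
  exact ⟨t₁, h0, fun t ht ↦ h' ⟨t.2.1, ht.trans_lt h1⟩⟩

/-! ### Transport along segments -/

namespace StratumValues

variable {A : TopCat.Sheaf (ModuleCat.{u} F) K.space} {W : K.Simplex → ModuleCat.{u} F}
  (v : StratumValues δ A W)

/-- Some section has the value `a` at `x` and the value `b` on an initial part of the segment from
`x` to `y`. -/
def Transports {x y : K.space} (hxy : carrier x ⊆ carrier y) {Δ₁ Δ₂ : K.Simplex}
    (h₁ : pole δ x = Δ₁) (a : W Δ₁) (b : W Δ₂) : Prop :=
  ∃ (U : Opens K.space) (s : A.presheaf.obj (op U)) (hx : x ∈ U) (t₁ : unitInterval)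
    (_ : 0 < t₁) (hU : ∀ t ≤ t₁, mix x y hxy t ∈ U) (hp : pole δ (mix x y hxy t₁) = Δ₂),
    v.value s hx h₁ = a ∧ v.value s (hU t₁ le_rfl) hp = b

lemma exists_mix_mem {U : Opens K.space} {x y : K.space} (hx : x ∈ U)
    (hxy : carrier x ⊆ carrier y) :
    ∃ t₁ : unitInterval, 0 < t₁ ∧ ∀ t ≤ t₁, mix x y hxy t ∈ U := by
  have hcont : Continuous fun t ↦ mix x y hxy t :=
    continuous_mix (fun _ ↦ hxy) continuous_const continuous_const continuous_id
  have hmem : mix x y hxy 0 ∈ U := by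
    rw [mix_zero]
    exact hx
  exact exists_pos_forall_le (hcont.continuousAt.eventually (U.2.mem_nhds hmem))

variable (hδ : IsPerversity δ)
include hδ

variable {x y : K.space} {hxy : carrier x ⊆ carrier y} {Δ₁ Δ₂ : K.Simplex} {h₁ : pole δ x = Δ₁}

/-- Two sections with the same value at `x` agree near `x`, so their values agree at some small `t >
0`, and each is constant along the rest of its part of the segment. -/
lemma Transports.eq {a : W Δ₁} {b : W Δ₂} (h : v.Transports hxy h₁ a b) {U : Opens K.space}
    (s : A.presheaf.obj (op U)) (hx : x ∈ U) {t₁ : unitInterval} (h0 : 0 < t₁)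
    (hU : ∀ t ≤ t₁, mix x y hxy t ∈ U) (hp : pole δ (mix x y hxy t₁) = Δ₂)
    (ha : v.value s hx h₁ = a) : v.value s (hU t₁ le_rfl) hp = b := by
  obtain ⟨U', s', hx', t₂, h0', hU', hp', ha', hb⟩ := h
  obtain ⟨O, hO, hOo, hxO⟩ := eventually_nhds_iff.mp
    (v.value_eq_of_value_eq s s' hx hx' h₁ (ha.trans ha'.symm))
  obtain ⟨t₃, h0'', hO'⟩ := exists_mix_mem (U := ⟨O, hOo⟩) hxO hxy
  let t := min t₁ (min t₂ t₃)
  have ht : 0 < t := lt_min h0 (lt_min h0' h0'')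
  have ht₁ : t ≤ t₁ := min_le_left _ _
  have ht₂ : t ≤ t₂ := (min_le_right _ _).trans (min_le_left _ _)
  have ht₃ : t ≤ t₃ := (min_le_right _ _).trans (min_le_right _ _)
  have hpt : pole δ (mix x y hxy t) = Δ₂ := by
    rw [pole_mix hδ hxy ht, ← pole_mix hδ hxy h0, hp]
  rw [← hb, ← v.value_mix_eq hδ s hxy hU ht ht₁ h0 le_rfl hpt hp,
    ← v.value_mix_eq hδ s' hxy hU' ht ht₂ h0' le_rfl hpt hp']
  exact hO _ (hO' t ht₃) (hU t ht₁) (hU' t ht₂) hpt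

lemma Transports.unique {a : W Δ₁} {b b' : W Δ₂} (h : v.Transports hxy h₁ a b)
    (h' : v.Transports hxy h₁ a b') : b = b' := by
  obtain ⟨U, s, hx, t₁, h0, hU, hp, ha, hb⟩ := h
  exact hb.symm.trans (h'.eq v hδ s hx h0 hU hp ha)

variable (hxy h₁) in
lemma exists_transports (h₂ : pole δ y = Δ₂) (a : W Δ₁) :
    ∃ b : W Δ₂, v.Transports hxy h₁ a b := by
  obtain ⟨U, hx, s, e⟩ := v.exists_value_eq h₁ a
  obtain ⟨t₁, h0, hU⟩ := exists_mix_mem hx hxy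
  exact ⟨_, U, s, hx, t₁, h0, hU, (pole_mix hδ hxy h0).trans h₂, e, rfl⟩

lemma Transports.add {a a' : W Δ₁} {b b' : W Δ₂} (h : v.Transports hxy h₁ a b)
    (h' : v.Transports hxy h₁ a' b') : v.Transports hxy h₁ (a + a') (b + b') := by
  obtain ⟨U, hx, s, e⟩ := v.exists_value_eq h₁ a
  obtain ⟨U', hx', s', e'⟩ := v.exists_value_eq h₁ a'
  let i : U ⊓ U' ⟶ U := homOfLE inf_le_left
  let j : U ⊓ U' ⟶ U' := homOfLE inf_le_right
  have hm : x ∈ U ⊓ U' := ⟨hx, hx'⟩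
  have hb : pole δ y = Δ₂ := by
    obtain ⟨_, _, _, t, h0, _, hp, _⟩ := h
    rw [← hp, pole_mix hδ hxy h0]
  obtain ⟨t₁, h0, hU⟩ := exists_mix_mem hm hxy
  have hp := (pole_mix hδ hxy h0).trans hb
  have ei : v.value (A.presheaf.map i.op s) hm h₁ = a := (v.value_restrict i s hx hm h₁).trans e
  have ej : v.value (A.presheaf.map j.op s') hm h₁ = a' :=
    (v.value_restrict j s' hx' hm h₁).trans e'
  exact ⟨U ⊓ U', A.presheaf.map i.op s + A.presheaf.map j.op s', hm, t₁, h0, hU, hp,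
    (v.value_add _ _ _ _).trans (congrArg₂ _ ei ej),
    (v.value_add _ _ _ _).trans (congrArg₂ _ (h.eq v hδ _ hm h0 hU hp ei)
      (h'.eq v hδ _ hm h0 hU hp ej))⟩

omit hδ in
lemma Transports.smul {a : W Δ₁} {b : W Δ₂} (r : F) (h : v.Transports hxy h₁ a b) :
    v.Transports hxy h₁ (r • a) (r • b) := by
  obtain ⟨U, s, hx, t₁, h0, hU, hp, ha, hb⟩ := h
  exact ⟨U, r • s, hx, t₁, h0, hU, hp, (v.value_smul _ _ _ _).trans (congrArg _ ha),
    (v.value_smul _ _ _ _).trans (congrArg _ hb)⟩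

variable (hxy h₁) in
/-- Transport along the segment from `x` to `y`, as a linear map. -/
lemma exists_linearMap_transports (h₂ : pole δ y = Δ₂) :
    ∃ g : W Δ₁ →ₗ[F] W Δ₂, ∀ a b, v.Transports hxy h₁ a b ↔ g a = b := by
  choose g hg using v.exists_transports hδ hxy h₁ h₂
  exact ⟨⟨⟨g, fun a a' ↦ (hg _).unique v hδ ((hg a).add v hδ (hg a'))⟩,
    fun r a ↦ (hg _).unique v hδ ((hg a).smul v r)⟩, fun a b ↦
      ⟨fun h ↦ (hg a).unique v hδ h, fun h ↦ h ▸ hg a⟩⟩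

/-- Transport is invariant under deformations of the segment inside the strata. -/
lemma transports_homotopy {f g : unitInterval → K.space} (hf : Continuous f) (hg : Continuous g)
    (hfg : ∀ r, carrier (f r) ⊆ carrier (g r)) (h₁ : ∀ r, pole δ (f r) = Δ₁)
    (h₂ : ∀ r, pole δ (g r) = Δ₂) {a : W Δ₁} {b : W Δ₂} (r r' : unitInterval)
    (h : v.Transports (hfg r) (h₁ r) a b) : v.Transports (hfg r') (h₁ r') a b := by
  have key : v.Transports (hfg r) (h₁ r) a b ↔ v.Transports (hfg r') (h₁ r') a b := by
    refine isPreconnected_univ.induction₂ (fun r r' ↦ v.Transports (hfg r) (h₁ r) a b ↔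
      v.Transports (hfg r') (h₁ r') a b) ?_ (fun _ _ _ _ _ _ h h' ↦ h.trans h')
      (fun _ _ _ _ h ↦ h.symm) (Set.mem_univ r) (Set.mem_univ r')
    intro r _
    rw [nhdsWithin_univ]
    obtain ⟨U, hx, s, e⟩ := v.exists_value_eq (h₁ r) a
    have hcont : Continuous fun p : unitInterval × unitInterval ↦
        mix (f p.1) (g p.1) (hfg p.1) p.2 :=
      continuous_mix _ (hf.comp continuous_fst) (hg.comp continuous_fst) continuous_snd
    have hmem : mix (f r) (g r) (hfg r) 0 ∈ U := by
      rw [mix_zero]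
      exact hx
    -- A product neighbourhood gives one section and one length `t₁` that serve for all segments
    -- with parameter near `r`. Its values at both ends are locally constant in the parameter.
    have hev : ∀ᶠ p : unitInterval × unitInterval in 𝓝 (r, 0),
        mix (f p.1) (g p.1) (hfg p.1) p.2 ∈ U :=
      hcont.continuousAt.eventually (U.2.mem_nhds hmem)
    rw [nhds_prod_eq, Filter.eventually_prod_iff] at hev
    obtain ⟨P, hP, Q, hQ, hPQ⟩ := hev
    obtain ⟨t₁, h0, ht₁⟩ := exists_pos_forall_le hQ
    have hp : ∀ r, pole δ (mix (f r) (g r) (hfg r) t₁) = Δ₂ := fun r ↦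
      (pole_mix hδ _ h0).trans (h₂ r)
    have hr : P r := hP.self_of_nhds
    have c1 := hf.continuousAt.eventually (v.value_eventually s hx (h₁ r))
    have hcont' : Continuous fun r ↦ mix (f r) (g r) (hfg r) t₁ :=
      hcont.comp (Continuous.prodMk continuous_id continuous_const)
    have c2 := hcont'.continuousAt.eventually
      (v.value_eventually s (hPQ hr (ht₁ t₁ le_rfl)) (hp r))
    have c3 := hf.continuousAt.eventually (U.2.mem_nhds hx)
    filter_upwards [hP, c1, c2, c3] with r' hr' c1 c2 hx'
    have ev := c2 (hPQ hr' (ht₁ t₁ le_rfl)) (hp r')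
    have ea : v.value s hx' (h₁ r') = a := (c1 hx' (h₁ r')).trans e
    constructor
    · intro hT
      exact ⟨U, s, hx', t₁, h0, fun t ht ↦ hPQ hr' (ht₁ t ht), hp r', ea,
        ev.trans (hT.eq v hδ s hx h0 (fun t ht ↦ hPQ hr (ht₁ t ht)) (hp r) e)⟩
    · intro hT
      exact ⟨U, s, hx, t₁, h0, fun t ht ↦ hPQ hr (ht₁ t ht), hp r, e,
        ev.symm.trans (hT.eq v hδ s hx' h0 (fun t ht ↦ hPQ hr' (ht₁ t ht)) (hp r') ea)⟩
  exact key.mp h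

omit hδ in
lemma Transports.congr {x' y' : K.space} (ex : x = x') (ey : y = y')
    (hxy' : carrier x' ⊆ carrier y') (h₁' : pole δ x' = Δ₁) {a : W Δ₁} {b : W Δ₂}
    (h : v.Transports hxy h₁ a b) : v.Transports hxy' h₁' a b := by
  subst ex ey
  exact h

variable (hxy h₁) in
/-- Transport only depends on the strata. -/
lemma transports_center (h₂ : pole δ y = Δ₂) (hi : Δ₁.Incident Δ₂)
    (hc : carrier (center Δ₁) ⊆ carrier (pairCenter hi)) {a : W Δ₁} {b : W Δ₂}
    (h : v.Transports hxy h₁ a b) : v.Transports hc (pole_center hδ Δ₁) a b := by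
  have m₁ : Δ₁ ∈ carrier x := h₁ ▸ pole_mem δ x
  have m₂ : Δ₂ ∈ carrier y := h₂ ▸ pole_mem δ y
  have hf := carrier_center_subset m₁
  have hg := carrier_pairCenter_subset hi (hxy m₁) m₂
  have hr : δ Δ₂.dim ≤ δ Δ₁.dim := h₂ ▸ pole_le δ y (hxy m₁)
  have hpos : ∀ r : unitInterval, r ≠ 0 → 0 < r := fun r hr ↦ lt_of_le_of_ne r.2.1 (Ne.symm hr)
  -- Both ends move along segments: from the center of `Δ₁` to `x`, and from the pair center to `y`.
  -- The inclusion of carriers persists, so the deformation stays within the two strata.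
  have hcar : ∀ r, carrier (mix (center Δ₁) x hf r) ⊆ carrier (mix (pairCenter hi) y hg r) := by
    intro r
    by_cases h0 : r = 0
    · rw [h0, mix_zero, mix_zero]
      exact hc
    · rw [carrier_mix hf (hpos r h0), carrier_mix hg (hpos r h0)]
      exact hxy
  have hp₁ : ∀ r, pole δ (mix (center Δ₁) x hf r) = Δ₁ := by
    intro r
    by_cases h0 : r = 0
    · rw [h0, mix_zero, pole_center hδ]
    · rw [pole_mix hδ hf (hpos r h0), h₁]
  have hp₂ : ∀ r, pole δ (mix (pairCenter hi) y hg r) = Δ₂ := by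
    intro r
    by_cases h0 : r = 0
    · rw [h0, mix_zero, pole_pairCenter hδ hi hr]
    · rw [pole_mix hδ hg (hpos r h0), h₂]
  have hcf : Continuous fun r ↦ mix (center Δ₁) x hf r :=
    continuous_mix (fun _ ↦ hf) continuous_const continuous_const continuous_id
  have hcg : Continuous fun r ↦ mix (pairCenter hi) y hg r :=
    continuous_mix (fun _ ↦ hg) continuous_const continuous_const continuous_id
  exact (v.transports_homotopy hδ hcf hcg hcar hp₁ hp₂ 1 0
    (h.congr v (mix_one hf).symm (mix_one hg).symm (hcar 1) (hp₁ 1))).congr v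
      (mix_zero hf) (mix_zero hg) hc _

/-- Transport from the center of `Δ₁` to the pair center serves for all points of the stratum: if
`y` is close to `x`, the whole segment lies in a ball inside `U`, so `s` itself realizes the
transport. -/
lemma exists_transport (Δ₁ Δ₂ : K.Simplex) : ∃ g : W Δ₁ →ₗ[F] W Δ₂,
    ∀ {U : Opens K.space} (s : A.presheaf.obj (op U)) {x : K.space} (hx : x ∈ U)
      (h₁ : pole δ x = Δ₁), ∀ᶠ y in 𝓝 x, ∀ (hy : y ∈ U) (h₂ : pole δ y = Δ₂),
        v.value s hy h₂ = g (v.value s hx h₁) := by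
  by_cases hi : Δ₁.Incident Δ₂ ∧ δ Δ₂.dim ≤ δ Δ₁.dim
  · obtain ⟨hi, hr⟩ := hi
    have hc := carrier_center_subset (mem_carrier_pairCenter_left hi)
    obtain ⟨g, hg⟩ := v.exists_linearMap_transports hδ hc (pole_center hδ Δ₁)
      (pole_pairCenter hδ hi hr)
    refine ⟨g, fun {U} s {x} hx h₁ ↦ ?_⟩
    obtain ⟨ε, hε, hball⟩ := Metric.mem_nhds_iff.mp (U.2.mem_nhds hx)
    filter_upwards [eventually_carrier_subset x, Metric.ball_mem_nhds x hε] with y hxy hyε hy h₂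
    refine ((hg _ _).mp (v.transports_center hδ hxy h₁ h₂ hi hc ⟨U, s, hx, 1, zero_lt_one,
      fun t _ ↦ hball ((dist_mix_le hxy t).trans_lt hyε), (pole_mix hδ hxy zero_lt_one).trans h₂,
      rfl, ?_⟩)).symm
    exact v.value_congr s (mix_one hxy) _ _ hy h₂
  · refine ⟨0, fun {U} s {x} hx h₁ ↦ ?_⟩
    filter_upwards [eventually_carrier_subset x] with y hxy hy h₂
    have m₁ : Δ₁ ∈ carrier y := hxy (h₁ ▸ pole_mem δ x)
    have m₂ : Δ₂ ∈ carrier y := h₂ ▸ pole_mem δ y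
    exact (hi ⟨(isFlag_carrier y).2 _ m₁ _ m₂, h₂ ▸ pole_le δ y m₁⟩).elim

/-- The map between the stalks at two strata induced by the extension of sections from the first
stratum. -/
def transport (Δ₁ Δ₂ : K.Simplex) : W Δ₁ →ₗ[F] W Δ₂ := (v.exists_transport hδ Δ₁ Δ₂).choose

lemma transport_eventually {U : Opens K.space} (s : A.presheaf.obj (op U)) {x : K.space}
    (hx : x ∈ U) (h₁ : pole δ x = Δ₁) : ∀ᶠ y in 𝓝 x, ∀ (hy : y ∈ U) (h₂ : pole δ y = Δ₂),
      v.value s hy h₂ = v.transport hδ Δ₁ Δ₂ (v.value s hx h₁) :=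
  (v.exists_transport hδ Δ₁ Δ₂).choose_spec s hx h₁

lemma transport_self (Δ : K.Simplex) (a : W Δ) : v.transport hδ Δ Δ a = a := by
  obtain ⟨U, hx, s, e⟩ := v.exists_value_eq (pole_center hδ Δ) a
  have := (v.transport_eventually hδ (Δ₂ := Δ) s hx (pole_center hδ Δ)).self_of_nhds hx
    (pole_center hδ Δ)
  rw [e] at this
  exact this.symm

/-- A section near the center of `Δ₁` is followed to a close point of the stratum of `Δ₂`, then to a
still closer point of the stratum of `Δ₃`, and its value there is computed in two ways. Pairwise
incidence provides a point `z` whose carrier is the whole triple, which gives the direction of the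
second move. -/
lemma transport_transport {Δ₁ Δ₂ Δ₃ : K.Simplex} (h₁₂ : Δ₁.Incident Δ₂) (h₂₃ : Δ₂.Incident Δ₃)
    (h₁₃ : Δ₁.Incident Δ₃) (r₁₂ : δ Δ₂.dim ≤ δ Δ₁.dim) (r₂₃ : δ Δ₃.dim ≤ δ Δ₂.dim) (a : W Δ₁) :
    v.transport hδ Δ₂ Δ₃ (v.transport hδ Δ₁ Δ₂ a) = v.transport hδ Δ₁ Δ₃ a := by
  classical
  obtain ⟨U, hx, s, e⟩ := v.exists_value_eq (pole_center hδ Δ₁) a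
  have e₂ := v.transport_eventually hδ (Δ₂ := Δ₂) s hx (pole_center hδ Δ₁)
  have e₃ := v.transport_eventually hδ (Δ₂ := Δ₃) s hx (pole_center hδ Δ₁)
  rw [e] at e₂ e₃
  obtain ⟨O, hO, hOo, hxO⟩ := eventually_nhds_iff.mp (e₂.and (e₃.and (U.2.mem_nhds hx)))
  have hc := carrier_center_subset (mem_carrier_pairCenter_left h₁₂)
  obtain ⟨t, h0, ht⟩ := exists_mix_mem (U := ⟨O, hOo⟩) hxO hc
  have hyO := ht t le_rfl
  have hyU := (hO _ hyO).2.2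
  have hp₂ := (pole_mix hδ hc h0).trans (pole_pairCenter hδ h₁₂ r₁₂)
  have hy := (hO _ hyO).1 hyU hp₂
  obtain ⟨z, hz⟩ := exists_carrier_eq (isFlag_triple h₁₂ h₂₃ h₁₃)
  have hcz : carrier (mix _ _ hc t) ⊆ carrier z := by
    rw [carrier_mix hc h0, hz, carrier_pairCenter]
    intro D
    simp only [Finset.mem_insert, Finset.mem_singleton]
    tauto
  have hpz : pole δ z = Δ₃ := by
    rw [pole_eq_iff hδ, hz]
    simp only [Finset.mem_insert, Finset.mem_singleton]
    refine ⟨by simp, ?_⟩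
    rintro D (rfl | rfl | rfl)
    exacts [r₂₃.trans r₁₂, r₂₃, le_rfl]
  obtain ⟨O', hO', hOo', hxO'⟩ := eventually_nhds_iff.mp
    (v.transport_eventually hδ (Δ₂ := Δ₃) s hyU hp₂)
  obtain ⟨t', h0', ht'⟩ := exists_mix_mem (U := ⟨O, hOo⟩ ⊓ ⟨O', hOo'⟩) ⟨hyO, hxO'⟩ hcz
  have hw := ht' t' le_rfl
  have hwU := (hO _ hw.1).2.2
  have hp₃ := (pole_mix hδ hcz h0').trans hpz
  rw [← hy, ← hO' _ hw.2 hwU hp₃]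
  exact (hO _ hw.1).2.1 hwU hp₃

end StratumValues

/-! ### Every constructible sheaf comes from linear algebra data -/

omit [Fintype V] in
/-- A simplex whose rank is not minimal among two incident simplices has an arrow to a simplex that
is incident to both. -/
lemma exists_arrow_of_incident (hδ : IsPerversity δ) {Δ Δ' : K.Simplex} (h : Δ.Incident Δ')
    (hlt : δ Δ'.dim < δ Δ.dim) : ∃ D, K.HasArrow δ Δ D ∧ D.Incident Δ' := by
  by_cases h0 : 0 ≤ δ Δ'.dim
  · obtain ⟨D, h1, h2, -⟩ := exists_arrow_down hδ
      (h.symm.subset (hδ.le_of_nonneg h0 hlt.le)) h0 hlt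
    exact ⟨D, h1, Or.inr h2⟩
  by_cases h1 : δ Δ.dim ≤ 0
  · obtain ⟨D, h1, -, h2⟩ := exists_arrow_up hδ (h.subset (hδ.le_of_nonpos h1 hlt.le)) h1 hlt
    exact ⟨D, h1, Or.inl h2⟩
  -- The rank of `Δ` is positive and that of `Δ'` negative, so dimension is no guide along the path;
  -- a target `D` of dimension `j` is chosen below or above `Δ'` as sizes allow.
  obtain ⟨j, hj, e⟩ := hδ.exists_le_of_nonneg (k := Δ.dim) (i := δ Δ.dim - 1)
    (by omega) (by omega)
  rcases h with h | h
  · obtain ⟨D, -, h2, h3⟩ := exists_between (Finset.empty_subset Δ.1) (j := j) (by simp) hj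
    exact ⟨D, ⟨by rw [h3]; omega, Or.inr h2⟩, Or.inl (h2.trans h)⟩
  · rcases le_total j Δ'.dim with hj' | hj'
    · obtain ⟨D, -, h2, h3⟩ := exists_between (Finset.empty_subset Δ'.1) (j := j) (by simp) hj'
      exact ⟨D, ⟨by rw [h3]; omega, Or.inr (h2.trans h)⟩, Or.inl h2⟩
    · obtain ⟨D, h1, h2, h3⟩ := exists_between h (j := j) (by rw [Δ'.card_eq]; omega) hj
      exact ⟨D, ⟨by rw [h3]; omega, Or.inr h2⟩, Or.inr h1⟩

namespace StratumValues

variable {A : TopCat.Sheaf (ModuleCat.{u} F) K.space} {W : K.Simplex → ModuleCat.{u} F}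
  (v : StratumValues δ A W) (hδ : IsPerversity δ)

/-- The linear algebra data of a constructible sheaf. -/
def linearData : LinearData F K δ where
  stalk := W
  res {Δ Δ'} _ := ModuleCat.ofHom (v.transport hδ Δ Δ')
  equivalence {Δ' Δ₁ Δ₂ Δ''} h₁ h₁' h₂ h₂' := by
    by_cases hne : Δ₁ = Δ₂
    · subst hne
      rfl
    -- Different middle vertices force the ends to be incident, and both composites are then the
    -- direct transport.
    · have hi := incident_of_two_paths hδ h₁ h₁' h₂ h₂' hne
      have r₁ := h₁.1
      have r₁' := h₁'.1
      have r₂ := h₂.1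
      have r₂' := h₂'.1
      refine ModuleCat.hom_ext (LinearMap.ext fun a ↦ ?_)
      exact (v.transport_transport hδ h₁.2 h₁'.2 hi (by omega) (by omega) a).trans
        (v.transport_transport hδ h₂.2 h₂'.2 hi (by omega) (by omega) a).symm

/-- By path independence any path may be used, and there is one all of whose vertices are incident
to `Δ'`. Along it the transports compose by `transport_transport`. -/
lemma pathMap_linearData {Δ Δ' : K.Simplex} (hi : Δ.Incident Δ') (h : K.PathLE δ Δ Δ')
    (a : W Δ) : (v.linearData hδ).pathMap h a = v.transport hδ Δ Δ' a := by
  have hle := h.rank_le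
  obtain ⟨n, hn⟩ : ∃ n : ℕ, δ Δ.dim = δ Δ'.dim + n := ⟨(δ Δ.dim - δ Δ'.dim).toNat, by omega⟩
  induction n generalizing Δ with
  | zero =>
    obtain rfl := h.eq_of_rank_eq (by omega)
    exact (LinearData.pathMap_self (S := v.linearData hδ) hδ h a).trans (v.transport_self hδ Δ a).symm
  | succ n ih =>
    obtain ⟨D, h1, h2⟩ := exists_arrow_of_incident hδ hi (by omega)
    have hr := h1.1
    have hD := pathLE_of_incident hδ h2 (by omega)
    have h1' : K.PathLE δ Δ D := Relation.ReflTransGen.single h1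
    have e : (v.linearData hδ).pathMap h1' a = v.transport hδ Δ D a :=
      congr($((v.linearData hδ).pathMap_arrow hδ h1 h1') a)
    refine (LinearData.pathMap_pathMap (S := v.linearData hδ) hδ h1' hD h a).symm.trans
      ((congrArg ((v.linearData hδ).pathMap hD) e).trans ?_)
    exact (ih h2 hD _ hD.rank_le (by omega)).trans
      (v.transport_transport hδ h1.2 h2 hi (by omega) (by omega) a)

/-- The values of a section of `A`, as a section of the sheaf of linear algebra data. -/
def toSheafOfApp (U : Opens K.space) : A.presheaf.obj (op U) →ₗ[F]
    localSectionsSubmodule (fun x ↦ (v.linearData hδ).stalk (pole δ x))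
      (v.linearData hδ).pathRelation U where
  toFun s := ⟨fun x ↦ v.value s x.2 rfl, fun x ↦ by
    have hc : ContinuousAt (Subtype.val : U → K.space) x := continuous_subtype_val.continuousAt
    have h1 : ∀ᶠ y in 𝓝 x.1, ∀ Δ (hy : y ∈ U) (h₂ : pole δ y = Δ),
        v.value s hy h₂ = v.transport hδ (pole δ x.1) Δ (v.value s x.2 rfl) :=
      Filter.eventually_all.mpr fun _ ↦ v.transport_eventually hδ s x.2 rfl
    filter_upwards [hc.eventually h1, hc.eventually (eventually_carrier_subset x.1)] with y h1 h2 h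
    have hi := (isFlag_carrier y.1).2 _ (h2 (pole_mem δ x.1)) _ (pole_mem δ y.1)
    exact (h1 _ y.2 rfl).trans (v.pathMap_linearData hδ hi h _).symm⟩
  map_add' s t := Subtype.ext (funext fun x ↦ v.value_add s t x.2 rfl)
  map_smul' r s := Subtype.ext (funext fun x ↦ v.value_smul r s x.2 rfl)

/-- The comparison of a constructible sheaf with the sheaf of its linear algebra data. -/
def toSheafOf : A ⟶ (v.linearData hδ).sheafOf :=
  ⟨{ app := fun U ↦ ModuleCat.ofHom (v.toSheafOfApp hδ U.unop)
     naturality := fun _ _ i ↦ ModuleCat.hom_ext (LinearMap.ext fun s ↦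
      Subtype.ext (funext fun x ↦ v.value_restrict i.unop s (leOfHom i.unop x.2) x.2 rfl)) }⟩

/-- Followed by evaluation at `x`, the map on stalks is the chosen identification of the stalk of
`A` at `x`. -/
lemma stalkHom_toSheafOf_bijective (x : K.space) :
    Function.Bijective (stalkHom (v.toSheafOf hδ).hom x) := by
  have h := LinearData.stalkEval_sheafOf_bijective (S := v.linearData hδ) hδ x
  refine (Function.Bijective.of_comp_iff' h _).mp ?_
  have : stalkEval _ _ x ∘ stalkHom (v.toSheafOf hδ).hom x = v.val (x := x) rfl := by
    funext a
    obtain ⟨U, hx, s, rfl⟩ := A.presheaf.exists_germ_eq a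
    exact (congrArg (stalkEval _ _ x) (stalkHom_germ _ U x hx s)).trans
      (stalkEval_germ _ _ x U hx _)
  rw [this]
  exact (v.val rfl).bijective

lemma isIso_toSheafOf : IsIso (v.toSheafOf hδ) := by
  have : ∀ x, IsIso ((TopCat.Presheaf.stalkFunctor (ModuleCat.{u} F) x).map
      (v.toSheafOf hδ).hom) := fun x ↦
    (ConcreteCategory.isIso_iff_bijective _).mpr (v.stalkHom_toSheafOf_bijective hδ x)
  exact TopCat.Presheaf.isIso_of_stalkFunctor_map_iso (v.toSheafOf hδ)

end StratumValues

lemma finSheafOf_essSurj (hδ : IsPerversity δ) : (finSheafOf F K hδ).EssSurj where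
  mem_essImage A := by
    obtain ⟨W, hW, ⟨v⟩⟩ := exists_stratumValues hδ A.obj A.property
    have := v.isIso_toSheafOf hδ
    exact ⟨⟨v.linearData hδ, hW⟩, ⟨ObjectProperty.isoMk _ (asIso (v.toSheafOf hδ)).symm⟩⟩

lemma finSheafOf_isEquivalence (hδ : IsPerversity δ) : (finSheafOf F K hδ).IsEquivalence where
  faithful := finSheafOf_faithful hδ
  full := finSheafOf_full hδ
  essSurj := finSheafOf_essSurj hδ

end AbstractSimplicialComplex

end

/-! ### Assembly of the two equivalences -/

theorem theoremB {F : Type u} [Field F] [CharZero F] {V : Type u} [Fintype V]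
    (K : AbstractSimplicialComplex V) (hK : ConnectedSpace K.space)
    (δ : ℕ → ℤ) (hδ : IsPerversity δ) :
    (∃ E : K.CategoryR F δ ≌ K.DeltaSheaf F δ,
      Nonempty (E.functor ⋙ ObjectProperty.ι _ ⋙ K.sheafData F δ ≅
        ObjectProperty.ι _ ⋙ K.moduleData F δ)) ∧
    (∃ E' : K.CategoryR F δ ≌ K.FinLinearData F δ,
      Nonempty (E'.functor ⋙ ObjectProperty.ι _ ≅ ObjectProperty.ι _ ⋙ K.moduleData F δ)) := by
  have := AbstractSimplicialComplex.finSheafOf_isEquivalence (F := F) (K := K) hδ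
  let G := AbstractSimplicialComplex.finModuleData F K δ
  let H := AbstractSimplicialComplex.finSheafOf F K hδ
  refine ⟨⟨G.asEquivalence.trans H.asEquivalence, ⟨?_⟩⟩, ⟨G.asEquivalence, ⟨Iso.refl _⟩⟩⟩
  -- The sheaf attached to `M` is the sheaf of its linear algebra data, and sections on the stars
  -- recover these data.
  exact Functor.isoWhiskerLeft (ObjectProperty.ι _ ⋙ K.moduleData F δ)
    (AbstractSimplicialComplex.sheafOfCompSheafDataIso F K hδ).symm
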